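/- **Proposition 1 (Noise-robustness of Trotterization).** *Setting.* Qubits are placed on the vertices of a finite set $\Lambda\subset\mathbb Z^d$ with the Manhattan distance. A family of operators or superoperators $(o_\alpha)_\alpha$, each supported on a region $S_\alpha\subseteq\Lambda$, has *range* $a$ and *coordination number* $\mathcal Z$ if $\operatorname{diam}S_\alpha\le a$ and $|\{\alpha':S_{\alpha'}\cap S_\alpha\neq\emptyset\}|\le\mathcal Z$ for all $\alpha$; a Hamiltonian $\sum_\alpha h_\alpha$ with Hermitian terms is *$(a,\mathcal Z,J)$-geometrically local* if moreover $\|h_\alpha\|\le J$ for all $\alpha$. The target $H_0=\sum_\alpha h_\alpha$ is an $(a_0,\mathcal Z_0,J_0)$-geometrically local Hamiltonian whose terms are partitioned into $K$ classes of mutually commuting terms, $H_0=\sum_{j=1}^K H_j$ with $H_j$ the sum of the terms of class $j$. Let $p\ge1$ and let $r_1,\dots,r_M\in\{1,\dots,K\}$, $x_1,\dots,x_M\in\mathbb R$ specify a $p$-th order Trotter formula $S(s)=\prod_{j=1}^M e^{-ix_jsH_{r_j}}$, i.e. $\frac{d^k}{ds^k}S(s)\big|_{s=0}=(-i\sum_jH_j)^k$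 for all $0\le k\le p$ and all Hermitian $H_1,\dots,H_K$ on a finite-dimensional space. Evolution under $H_0$ for time $\tau$ is simulated with $T\ge1$ Trotter steps: the simulator has a time-dependent $(a_1,\mathcal Z_1,J_1)$-geometrically local Hamiltonian $H(t)=\sum_\alpha h'_\alpha(t)$ (the regions not depending on $t$) and runs for a time $0\le t_{\rm sim}\le cT$ (as for a circuit over a fixed universal gate set), and its noiseless evolution up to $t_{\rm sim}$ is exactly $\rho\mapsto U\rho U^\dagger$ with $U=S(\tau/T)^T$. With noise at rate $\gamma>0$ the generator is $\mathcal L_\gamma(t)=-i[H(t),\cdot]+\gamma\sum_\alpha\mathcal N_\alpha$, where the $\mathcal N_\alpha$ are Lindbladians with $\|\mathcal N_\alpha\|_\diamond\le1$, range $a_2$ and coordination number $\mathcal Z_2$. For an observable $O$ supported on $X\subseteq\Lambda$ and an initial state $\rho(0)$ put $$\Delta\mathcal O=\Big|\operatorname{Tr}[O\,e^{-iH_0\tau}\rho(0)e^{iH_0\tau}]-\operatorname{Tr}\Big[O\,\mathcal T\exp\Big(\int_0^{t_{\rm sim}}\mathcal L_\gamma(s)\,ds\Big)(\rho(0))\Big]\Big|.$$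 *Claim.* Fix $\tau_0>0$. There are constants $A,B>0$, depending only on $d$, $p$, the Trotter formula, $(a_0,\mathcal Z_0,J_0)$, $(a_1,\mathcal Z_1,J_1)$, $(a_2,\mathcal Z_2)$, $c$ and $\tau_0$ (in particular not on $\Lambda$, $H_0$, $\rho(0)$, $O$, $\tau$, $T$, $\gamma$), such that: 1. For all $\tau\ge\tau_0$, all integers $T\ge1$ and all $\gamma>0$, $$\Delta\mathcal O\le|X|^2\|O\|\Big(A\,\frac{\tau^{d+p+1}}{T^p}+B\,\gamma\,T^{d+1}\Big).$$ 2. As a function of a real number $T>0$, the expression in brackets has a unique minimum, at $T=\kappa\,\tau\,\gamma^{-1/(p+d+1)}$ with a constant $\kappa>0$ independent of $\tau>0$ and $\gamma>0$. 3. For all $c_1,c_2>0$ there is a constant $C$, depending only on these and on the data listed above, such that for all $\tau\ge\tau_0$ and $\gamma>0$ and every integer $T\ge 1$ with $c_1\tau\gamma^{-1/(p+d+1)}\le T\le c_2\tau\gamma^{-1/(p+d+1)}$, $$\Delta\mathcal O\le C\,|X|^2\|O\|\,\gamma^{p/(p+d+1)}\,\tau^{d+1}\qquad\text{and}\qquad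 t_{\rm sim}\le C\,\tau\,\gamma^{-1/(p+d+1)}.$$ -/

import Mathlib

open scoped Matrix.Norms.L2Operator ComplexOrder

namespace TrotterNoise

noncomputable section

/-! ### Qubits on the lattice `ℤ^d`

Matrices carry the operator norm induced by the Euclidean vector norm throughout
(`Matrix.Norms.L2Operator`). -/

/-- Vertices of the lattice `ℤ^d`. -/
abbrev Site (d : ℕ) : Type := Fin d → ℤ

/-- The Manhattan distance on `ℤ^d`. -/
def latticeDist {d : ℕ} (x y : Site d) : ℕ := ∑ i, (x i - y i).natAbs

/-- Computational basis states of one qubit on every site of `Λ`. -/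
abbrev Config {d : ℕ} (Λ : Finset (Site d)) : Type := Λ → Fin 2

/-- Operators on the Hilbert space `(ℂ²)^{⊗Λ}`. -/
abbrev Op {d : ℕ} (Λ : Finset (Site d)) : Type := Matrix (Config Λ) (Config Λ) ℂ

/-- Superoperators: (automatically continuous) linear maps on operators. -/
abbrev Superop {d : ℕ} (Λ : Finset (Site d)) : Type := Op Λ →L[ℂ] Op Λ

/-- `A` acts as the identity outside `S`, i.e. `A = B ⊗ 1` with `B` an operator on the qubits
in `S`. -/
def SupportedOn {d : ℕ} {Λ : Finset (Site d)} (A : Op Λ) (S : Finset Λ) : Prop :=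
  ∃ B : Matrix (S → Fin 2) (S → Fin 2) ℂ, ∀ σ η : Config Λ,
    A σ η = if ∀ x, x ∉ S → σ x = η x then B (fun x => σ x) (fun x => η x) else 0

/-- A family of regions of diameter at most `a`, each of which meets at most `Z` regions of the
family. -/
structure GeomLocalRegions {d m : ℕ} {Λ : Finset (Site d)} (S : Fin m → Finset Λ)
    (a Z : ℕ) : Prop where
  diam_le : ∀ α, ∀ x ∈ S α, ∀ y ∈ S α, latticeDist (x : Site d) (y : Site d) ≤ a
  coord_le : ∀ α, {β | ¬ Disjoint (S α) (S β)}.ncard ≤ Z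

/-- The terms `h α`, supported on the regions `S α`, form an `(a, Z, J)`-geometrically local
Hamiltonian `∑ α, h α`. -/
structure GeomLocalTerms {d m : ℕ} {Λ : Finset (Site d)} (h : Fin m → Op Λ)
    (S : Fin m → Finset Λ) (a Z : ℕ) (J : ℝ) : Prop where
  regions : GeomLocalRegions S a Z
  hermitian : ∀ α, (h α).IsHermitian
  supported : ∀ α, SupportedOn (h α) (S α)
  norm_le : ∀ α, ‖h α‖ ≤ J

/-- Density matrices. -/
structure IsDensityMatrix {n : Type*} [Fintype n] (ρ : Matrix n n ℂ) : Prop where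
  posSemidef : ρ.PosSemidef
  trace_eq_one : ρ.trace = 1

/-! ### Product formulas -/

/-- `exp(-i s H)`. -/
def evolution {n : Type*} [Fintype n] [DecidableEq n] (H : Matrix n n ℂ) (s : ℝ) :
    Matrix n n ℂ :=
  NormedSpace.exp ((-(Complex.I * (s : ℂ))) • H)

/-- The product formula
`S(s) = exp(-i x₁ s H_{r₁}) exp(-i x₂ s H_{r₂}) ⋯ exp(-i x_M s H_{r_M})`. -/
def productFormula {n : Type*} [Fintype n] [DecidableEq n] {K M : ℕ} (r : Fin M → Fin K)
    (x : Fin M → ℝ) (H : Fin K → Matrix n n ℂ) (s : ℝ) : Matrix n n ℂ :=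
  (List.ofFn fun j => evolution (H (r j)) (x j * s)).prod

/-- `(r, x)` specifies a Trotter formula of order `p`: for all Hermitian `H₁, …, H_K` on a
finite-dimensional space, the derivatives at `0` of `S(s)` and of `exp(-i s (H₁ + ⋯ + H_K))`
agree up to order `p`. -/
def IsTrotterFormula (p : ℕ) {K M : ℕ} (r : Fin M → Fin K) (x : Fin M → ℝ) : Prop :=
  ∀ (n : ℕ) (H : Fin K → Matrix (Fin n) (Fin n) ℂ), (∀ j, (H j).IsHermitian) →
    ∀ k ≤ p, iteratedDeriv k (productFormula r x H) 0 = ((-Complex.I) • ∑ j, H j) ^ k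

/-! ### Superoperators, Lindbladians and the diamond norm -/

/-- The superoperator `-i [H, ·]`. -/
def hamiltonianGenerator {d : ℕ} {Λ : Finset (Site d)} (H : Op Λ) : Superop Λ :=
  (-Complex.I) •
    (ContinuousLinearMap.mul ℂ (Op Λ) H - (ContinuousLinearMap.mul ℂ (Op Λ)).flip H)

/-- `𝓝` is a Lindbladian (in Gorini–Kossakowski–Sudarshan–Lindblad form) supported on `S`. -/
def IsLindbladianOn {d : ℕ} {Λ : Finset (Site d)} (𝓝 : Superop Λ) (S : Finset Λ) : Prop :=
  ∃ (n : ℕ) (G : Op Λ) (L : Fin n → Op Λ),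
    G.IsHermitian ∧ SupportedOn G S ∧ (∀ k, SupportedOn (L k) S) ∧
    ∀ ρ : Op Λ, 𝓝 ρ = (-Complex.I) • (G * ρ - ρ * G) +
      ∑ k, (L k * ρ * (L k).conjTranspose -
        (1 / 2 : ℂ) • ((L k).conjTranspose * L k * ρ + ρ * ((L k).conjTranspose * L k)))

/-- The trace norm: the sum of the singular values of `A`. -/
def traceNorm {n : Type*} [Fintype n] [DecidableEq n] (A : Matrix n n ℂ) : ℝ :=
  ∑ i, Real.sqrt ((Matrix.isHermitian_conjTranspose_mul_self A).eigenvalues i)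

/-- The superoperator `𝓝 ⊗ id_n`, acting blockwise. -/
def ampliation {d : ℕ} {Λ : Finset (Site d)} (𝓝 : Superop Λ) (n : ℕ)
    (A : Matrix (Config Λ × Fin n) (Config Λ × Fin n) ℂ) :
    Matrix (Config Λ × Fin n) (Config Λ × Fin n) ℂ :=
  Matrix.of fun i j => 𝓝 (Matrix.of fun σ η => A (σ, i.2) (η, j.2)) i.1 j.1

/-- The diamond norm, i.e. the completely bounded `1 → 1` norm. -/
def diamondNorm {d : ℕ} {Λ : Finset (Site d)} (𝓝 : Superop Λ) : ENNReal :=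
  ⨆ (n : ℕ) (A : Matrix (Config Λ × Fin n) (Config Λ × Fin n) ℂ) (_ : traceNorm A ≤ 1),
    ENNReal.ofReal (traceNorm (ampliation 𝓝 n A))

/-- The `n`-th term of the Dyson series of the generator `𝓛(s)`: the integral of
`𝓛(s₁) ⋯ 𝓛(s_n)` over `t ≥ s₁ ≥ ⋯ ≥ s_n ≥ 0`. -/
def dysonTerm {d : ℕ} {Λ : Finset (Site d)} (𝓛 : ℝ → Superop Λ) : ℕ → ℝ → Superop Λ
  | 0, _ => ContinuousLinearMap.id ℂ (Op Λ)
  | n + 1, t => ∫ s in (0 : ℝ)..t, (𝓛 s).comp (dysonTerm 𝓛 n s)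

/-- The time-ordered exponential `𝓣 exp(∫₀ᵗ 𝓛(s) ds)`, the propagator from time `0` to time `t`
of `ρ' = 𝓛(t) ρ`. -/
def timeOrderedExp {d : ℕ} {Λ : Finset (Site d)} (𝓛 : ℝ → Superop Λ) (t : ℝ) : Superop Λ :=
  ∑' n, dysonTerm 𝓛 n t

/-! ### Target, simulator and noise -/

/-- An `(a, Z, J)`-geometrically local target Hamiltonian `H₀ = ∑ α, h_α`, split into `K` parts,
each of them a sum of mutually commuting terms: `color α` is the part that `h_α` belongs to. -/
structure TargetHamiltonian {d : ℕ} (Λ : Finset (Site d)) (K a Z : ℕ) (J : ℝ) where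
  numTerms : ℕ
  term : Fin numTerms → Op Λ
  region : Fin numTerms → Finset Λ
  color : Fin numTerms → Fin K
  isLocal : GeomLocalTerms term region a Z J
  commute : ∀ α β, color α = color β → Commute (term α) (term β)

/-- The part `H_j`. -/
def TargetHamiltonian.part {d : ℕ} {Λ : Finset (Site d)} {K a Z : ℕ} {J : ℝ}
    (H₀ : TargetHamiltonian Λ K a Z J) (j : Fin K) : Op Λ :=
  ∑ α with H₀.color α = j, H₀.term α

/-- The full Hamiltonian `H₀ = H₁ + ⋯ + H_K`. -/
def TargetHamiltonian.total {d : ℕ} {Λ : Finset (Site d)} {K a Z : ℕ} {J : ℝ}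
    (H₀ : TargetHamiltonian Λ K a Z J) : Op Λ :=
  ∑ α, H₀.term α

/-- A time-dependent `(a, Z, J)`-geometrically local Hamiltonian `H(t) = ∑ α, h_α(t)`, depending
measurably on time. -/
structure SimulatorHamiltonian {d : ℕ} (Λ : Finset (Site d)) (a Z : ℕ) (J : ℝ) where
  numTerms : ℕ
  term : Fin numTerms → ℝ → Op Λ
  region : Fin numTerms → Finset Λ
  isLocal : ∀ t, GeomLocalTerms (fun α => term α t) region a Z J
  measurable : ∀ α σ η, Measurable fun t => term α t σ η

/-- `H(t)`. -/
def SimulatorHamiltonian.total {d : ℕ} {Λ : Finset (Site d)} {a Z : ℕ} {J : ℝ}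
    (H : SimulatorHamiltonian Λ a Z J) (t : ℝ) : Op Λ :=
  ∑ α, H.term α t

/-- Geometrically local noise: Lindbladians `𝓝_α` of diamond norm at most `1`, on regions of
diameter at most `a` and with coordination number at most `Z`. -/
structure LocalNoise {d : ℕ} (Λ : Finset (Site d)) (a Z : ℕ) where
  numTerms : ℕ
  term : Fin numTerms → Superop Λ
  region : Fin numTerms → Finset Λ
  regions : GeomLocalRegions region a Z
  lindbladian : ∀ α, IsLindbladianOn (term α) (region α)
  diamond_le : ∀ α, diamondNorm (term α) ≤ 1

/-- The noisy generator `𝓛_γ(t) = -i [H(t), ·] + γ ∑ α, 𝓝_α`. -/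
def noisyGenerator {d : ℕ} {Λ : Finset (Site d)} {a Z a' Z' : ℕ} {J : ℝ}
    (H : SimulatorHamiltonian Λ a Z J) (N : LocalNoise Λ a' Z') (γ t : ℝ) : Superop Λ :=
  hamiltonianGenerator (H.total t) + (γ : ℂ) • ∑ α, N.term α

/-- A noisy quantum simulation, on a finite set `Λ ⊆ ℤ^d` of qubits, of the evolution for time
`τ` under `H₀` by `T` steps of the product formula `(r, x)`.

The simulator runs for the time `t_sim ≤ c T`, and its geometrically local Hamiltonian `H(t)`
is such that without noise it implements exactly the circuit `S(τ/T)^T`; the noise acts at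
rate `γ`. -/
structure NoisySimulation (d : ℕ) {K M : ℕ} (r : Fin M → Fin K) (x : Fin M → ℝ)
    (a₀ Z₀ : ℕ) (J₀ : ℝ) (a₁ Z₁ : ℕ) (J₁ : ℝ) (a₂ Z₂ : ℕ) (c : ℝ) where
  Λ : Finset (Site d)
  target : TargetHamiltonian Λ K a₀ Z₀ J₀
  τ : ℝ
  τ_pos : 0 < τ
  T : ℕ
  T_pos : 0 < T
  simulator : SimulatorHamiltonian Λ a₁ Z₁ J₁
  tsim : ℝ
  tsim_nonneg : 0 ≤ tsim
  tsim_le : tsim ≤ c * T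
  implements : ∀ A : Op Λ,
    timeOrderedExp (fun t => hamiltonianGenerator (simulator.total t)) tsim A =
      productFormula r x target.part (τ / T) ^ T * A *
        (productFormula r x target.part (τ / T) ^ T).conjTranspose
  noise : LocalNoise Λ a₂ Z₂
  γ : ℝ
  γ_pos : 0 < γ
  ρ₀ : Op Λ
  isState : IsDensityMatrix ρ₀
  X : Finset Λ
  O : Op Λ
  O_hermitian : O.IsHermitian
  O_supported : SupportedOn O X

namespace NoisySimulation

variable {d K M : ℕ} {r : Fin M → Fin K} {x : Fin M → ℝ} {a₀ Z₀ a₁ Z₁ a₂ Z₂ : ℕ}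
  {J₀ J₁ c : ℝ}

/-- `Tr[O exp(-i H₀ τ) ρ(0) exp(i H₀ τ)]`. -/
def targetValue (E : NoisySimulation d r x a₀ Z₀ J₀ a₁ Z₁ J₁ a₂ Z₂ c) : ℂ :=
  (E.O * (evolution E.target.total E.τ * E.ρ₀ * evolution E.target.total (-E.τ))).trace

/-- `Tr[O 𝓔_γ(t_sim)(ρ(0))]`. -/
def simulatedValue (E : NoisySimulation d r x a₀ Z₀ J₀ a₁ Z₁ J₁ a₂ Z₂ c) : ℂ :=
  (E.O * timeOrderedExp (noisyGenerator E.simulator E.noise E.γ) E.tsim E.ρ₀).trace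

/-- The observable error `Δ𝓞`. -/
def error (E : NoisySimulation d r x a₀ Z₀ J₀ a₁ Z₁ J₁ a₂ Z₂ c) : ℝ :=
  ‖E.targetValue - E.simulatedValue‖

end NoisySimulation

end

end TrotterNoise

open TrotterNoise

/-! Both error sources are measured by one quantity, the total variation of an observable: the sum
over all sites of the norms of its commutators with the two Pauli generators `pauli b y` there.
Lieb–Robinson bounds show that a Heisenberg-evolved observable `O` has total variation at most a
constant times `(1 + t)^d |X|^2 ‖O‖` (`sum_siteVariation_heisenberg_le`): only sites in a light cone
of radius `O(t)` contribute. Moreover, any operator differs from one acting trivially on a region by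
at most its variation inside that region (`exists_approx_isLocalTo_compl`). A local perturbation
therefore sees only the nearby variation, and summing over all perturbations gives the total
variation, independently of the size of `Λ`. The triangle inequality through the noiseless circuit
separates the two errors.

Noise (`noise_error_le`): pair the noisy state at time `s` with the observable pulled back from the
final time by the noiseless evolution. The Hamiltonian parts cancel in the derivative, leaving `γ`
times a sum of local Lindbladians tested against that observable. Each annihilates, under the trace,
the part of the observable acting trivially on its region, and the diamond norm controls the rest.
Integrating the total variation over a time `O(T)` gives `γ T^{d+1}`. This needs the noisy evolution
to contract the trace norm, which is obtained from first-order dissipativity, and a generator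
continuous in time, which is obtained by averaging.

Trotter error (`IsTrotterFormula.exists_trotter_error_le`): the product formula solves `P' = G P`,
where `G` is a sum of terms of bounded range whose derivatives up to order `p` are bounded uniformly
in `Λ`; commutativity inside a class is what keeps the range finite. The order conditions make `G +
iH` vanish to order `p` at zero. This is known only for the whole sum, so Taylor's estimate is
applied to the full commutator of `G + iH` with the observable, while the derivative bounds are
taken term by term after localization. One step costs `(τ/T)^{p+1} τ^d`, and `T` steps cost
`τ^{d+p+1}/T^p`.

Optimization: with `T = y τ γ^{-1/(p+d+1)}` the bracket factors into a power of `τ` and `γ` times `A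
/ y^p + B y^{d+1}`, whose unique minimum comes from the strict Bernoulli inequality. -/

namespace TrotterNoise

noncomputable section

/-! ### Pauli operators and locality -/

section Pauli

variable {d : ℕ} {Λ : Finset (Site d)}

/-- The configuration `σ` with the qubit `x` flipped. -/
def bitFlip (x : Λ) (σ : Config Λ) : Config Λ := Function.update σ x (σ x + 1)

/-- The Pauli operators `Z` (for `false`) and `X` (for `true`) on the qubit `x`. -/
def pauli : Bool → Λ → Op Λ
  | false, x => Matrix.diagonal fun σ => if σ x = 0 then 1 else -1
  | true, x => Matrix.of fun σ η => if bitFlip x σ = η then 1 else 0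

theorem bitFlip_bitFlip (x : Λ) (σ : Config Λ) : bitFlip x (bitFlip x σ) = σ := by
  funext y
  have h : ∀ b : Fin 2, b + 1 + 1 = b := by decide
  by_cases hy : y = x
  · subst hy; simp [bitFlip, h]
  · simp [bitFlip, hy]

theorem bitFlip_eq_iff (x : Λ) (σ η : Config Λ) : bitFlip x σ = η ↔ σ = bitFlip x η := by
  constructor
  · rintro rfl; rw [bitFlip_bitFlip]
  · rintro rfl; rw [bitFlip_bitFlip]

theorem pauliX_mul_apply (x : Λ) (A : Op Λ) (σ η : Config Λ) :
    (pauli true x * A) σ η = A (bitFlip x σ) η := by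
  simp [pauli, Matrix.mul_apply]

theorem mul_pauliX_apply (x : Λ) (A : Op Λ) (σ η : Config Λ) :
    (A * pauli true x) σ η = A σ (bitFlip x η) := by
  simp [pauli, Matrix.mul_apply, bitFlip_eq_iff]

theorem pauliZ_mul_apply (x : Λ) (A : Op Λ) (σ η : Config Λ) :
    (pauli false x * A) σ η = (if σ x = 0 then 1 else -1) * A σ η := by
  simp [pauli]

theorem mul_pauliZ_apply (x : Λ) (A : Op Λ) (σ η : Config Λ) :
    (A * pauli false x) σ η = A σ η * (if η x = 0 then 1 else -1) := by
  simp [pauli]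

theorem pauli_mul_self (b : Bool) (x : Λ) : pauli b x * pauli b x = (1 : Op Λ) := by
  cases b
  · ext σ η
    rw [pauliZ_mul_apply]
    by_cases h : σ = η
    · subst h; by_cases hx : σ x = 0 <;> simp [pauli, hx]
    · simp [pauli, h]
  · ext σ η
    rw [pauliX_mul_apply]
    simp [pauli, Matrix.one_apply, bitFlip_bitFlip]

theorem star_pauli (b : Bool) (x : Λ) : star (pauli b x : Op Λ) = pauli b x := by
  cases b
  · ext σ η
    by_cases h : σ = η
    · subst h; by_cases hx : σ x = 0 <;> simp [pauli, hx, Matrix.star_apply]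
    · simp [pauli, h, Matrix.star_apply, Ne.symm h]
  · ext σ η
    simp only [pauli, Matrix.star_apply, Matrix.of_apply]
    by_cases h : bitFlip x η = σ
    · have h' : bitFlip x σ = η := by rw [← h, bitFlip_bitFlip]
      simp [h, h']
    · have h' : ¬ bitFlip x σ = η := fun h' => h (by rw [← h', bitFlip_bitFlip])
      simp [h, h']

theorem norm_pauli (b : Bool) (x : Λ) : ‖(pauli b x : Op Λ)‖ = 1 := by
  refine CStarRing.norm_of_mem_unitary (Unitary.mem_iff.mpr ?_)
  rw [star_pauli, pauli_mul_self]; simp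

/-- In both cases the sign cancels under conjugation, so averaging over one Pauli operator preserves
commutation with any other (`Commute.pauliTwirl`). -/
theorem pauli_mul_pauli (b c : Bool) (x y : Λ) :
    (pauli b x * pauli c y : Op Λ) = pauli c y * pauli b x ∨
      (pauli b x * pauli c y : Op Λ) = -(pauli c y * pauli b x) := by
  have key : ∀ x y : Λ, (pauli true x * pauli false y : Op Λ) = pauli false y * pauli true x ∨
      (pauli true x * pauli false y : Op Λ) = -(pauli false y * pauli true x) := by
    intro x y
    by_cases hxy : y = x
    · subst hxy
      right
      ext σ η
      rw [Matrix.neg_apply, mul_pauliZ_apply, pauliZ_mul_apply]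
      have h : ∀ b : Fin 2, b = 0 ∨ b = 1 := by decide
      by_cases hf : bitFlip y σ = η
      · subst hf
        rcases h (σ y) with h | h <;> simp [pauli, bitFlip, h]
      · simp [pauli, hf]
    · left
      ext σ η
      rw [mul_pauliZ_apply, pauliZ_mul_apply]
      by_cases hf : bitFlip x σ = η
      · subst hf
        simp [pauli, bitFlip, hxy]
      · simp [pauli, hf]
  cases b <;> cases c
  · left
    ext σ η
    rw [mul_pauliZ_apply, pauliZ_mul_apply]
    by_cases hf : σ = η
    · subst hf
      by_cases h1 : σ x = 0 <;> by_cases h2 : σ y = 0 <;> simp [pauli, h1, h2]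
    · simp [pauli, hf]
  · rcases key y x with h | h
    · left; rw [h]
    · right; rw [h, neg_neg]
  · exact key x y
  · left
    ext σ η
    rw [pauliX_mul_apply, pauliX_mul_apply]
    have : bitFlip y (bitFlip x σ) = bitFlip x (bitFlip y σ) := by
      by_cases hxy : x = y
      · rw [hxy]
      · funext z
        by_cases h1 : z = x <;> by_cases h2 : z = y <;>
          simp_all [bitFlip, Function.update_apply]
    simp [pauli, this]

/-- `A` commutes with all operators outside `S`. -/
def IsLocalTo (A : Op Λ) (S : Finset Λ) : Prop := ∀ x, x ∉ S → ∀ b, Commute A (pauli b x)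

theorem commute_pauliX_iff (A : Op Λ) (x : Λ) :
    Commute A (pauli true x) ↔ ∀ σ η, A (bitFlip x σ) (bitFlip x η) = A σ η := by
  constructor
  · intro h σ η
    have := congrFun (congrFun h.eq (bitFlip x σ)) η
    rw [mul_pauliX_apply, pauliX_mul_apply, bitFlip_bitFlip] at this
    exact this
  · intro h
    ext σ η
    rw [mul_pauliX_apply, pauliX_mul_apply, ← h σ, bitFlip_bitFlip]

theorem commute_pauliZ_iff (A : Op Λ) (x : Λ) :
    Commute A (pauli false x) ↔ ∀ σ η, σ x ≠ η x → A σ η = 0 := by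
  have h2 : ∀ b : Fin 2, b = 0 ∨ b = 1 := by decide
  constructor
  · intro h σ η hne
    have := congrFun (congrFun h.eq σ) η
    rw [mul_pauliZ_apply, pauliZ_mul_apply] at this
    rcases h2 (σ x) with h | h <;> rcases h2 (η x) with h' | h' <;> rw [h, h'] at this hne
    · exact absurd rfl hne
    · exact self_eq_neg.mp (by simpa using this.symm)
    · exact self_eq_neg.mp (by simpa using this)
    · exact absurd rfl hne
  · intro h
    ext σ η
    rw [mul_pauliZ_apply, pauliZ_mul_apply]
    by_cases hne : σ x = η x
    · rw [hne, mul_comm]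
    · rw [h σ η hne]; simp

/-- Commutation with the outside Paulis is a closed linear condition, stable under products,
exponentials and time averages, so the remaining proof uses only this form of locality. -/
theorem SupportedOn.isLocalTo {A : Op Λ} {S : Finset Λ} (h : SupportedOn A S) :
    IsLocalTo A S := by
  obtain ⟨B, hB⟩ := h
  intro x hx b
  cases b
  · rw [commute_pauliZ_iff]
    intro σ η hne
    rw [hB, if_neg]
    exact fun h => hne (h x hx)
  · rw [commute_pauliX_iff]
    intro σ η
    rw [hB, hB]
    have h1 : ∀ (σ : Config Λ), (fun y : S => bitFlip x σ y) = fun y : S => σ y := by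
      intro σ; funext y
      have : (y : Λ) ≠ x := fun h => hx (h ▸ y.2)
      simp [bitFlip, this]
    have h2 : (∀ y, y ∉ S → bitFlip x σ y = bitFlip x η y) ↔ ∀ y, y ∉ S → σ y = η y := by
      refine forall_congr' fun y => imp_congr_right fun _ => ?_
      by_cases hy : y = x
      · subst hy; simp [bitFlip]
      · simp [bitFlip, hy]
    rw [h1, h1]
    by_cases h : ∀ y, y ∉ S → σ y = η y
    · rw [if_pos h, if_pos (h2.mpr h)]
    · rw [if_neg h, if_neg (fun h' => h (h2.mp h'))]

theorem IsLocalTo.mono {A : Op Λ} {S S' : Finset Λ} (h : IsLocalTo A S) (hS : S ⊆ S') :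
    IsLocalTo A S' := fun x hx b => h x (fun h' => hx (hS h')) b

theorem IsLocalTo.apply_eq_zero {A : Op Λ} {S : Finset Λ} (h : IsLocalTo A S) {σ η : Config Λ}
    {x : Λ} (hx : x ∉ S) (hne : σ x ≠ η x) : A σ η = 0 :=
  (commute_pauliZ_iff A x).mp (h x hx false) σ η hne

/-- Commuting with the flip at `x` allows row and column to be flipped there simultaneously; the
induction changes the sites of `D` one at a time. -/
theorem IsLocalTo.apply_congr {A : Op Λ} {S : Finset Λ} (h : IsLocalTo A S) (D : Finset Λ) :
    ∀ σ η σ' η' : Config Λ, (∀ x ∈ D, x ∉ S ∧ σ x = η x ∧ σ' x = η' x) →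
      (∀ x, x ∉ D → σ x = σ' x ∧ η x = η' x) → A σ η = A σ' η' := by
  induction D using Finset.induction_on with
  | empty =>
    intro σ η σ' η' _ h2
    rw [show σ = σ' from funext fun x => (h2 x (by simp)).1,
      show η = η' from funext fun x => (h2 x (by simp)).2]
  | insert x D hxD ih =>
    intro σ η σ' η' h1 h2
    obtain ⟨hxS, hx1, hx2⟩ := h1 x (Finset.mem_insert_self x D)
    have hne : ∀ y ∈ D, y ≠ x := fun y hy h => hxD (h ▸ hy)
    by_cases hc : σ x = σ' x
    · refine ih σ η σ' η' (fun y hy => h1 y (Finset.mem_insert_of_mem hy)) fun y hy => ?_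
      by_cases hyx : y = x
      · subst hyx; exact ⟨hc, by rw [← hx1, ← hx2, hc]⟩
      · exact h2 y (by simp [hyx, hy])
    · have hflip : ∀ a b : Fin 2, a ≠ b → a + 1 = b := by decide
      rw [← (commute_pauliX_iff A x).mp (h x hxS true) σ η]
      refine ih _ _ σ' η' (fun y hy => ?_) fun y hy => ?_
      · have := h1 y (Finset.mem_insert_of_mem hy)
        simpa [bitFlip, hne y hy] using this
      · by_cases hyx : y = x
        · subst hyx
          have e1 : σ y + 1 = σ' y := hflip _ _ hc
          exact ⟨by simp [bitFlip, e1], by simp [bitFlip, ← hx1, ← hx2, e1]⟩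
        · simpa [bitFlip, hyx] using h2 y (by simp [hyx, hy])

theorem IsLocalTo.commute {A B : Op Λ} {S S' : Finset Λ} (hA : IsLocalTo A S)
    (hB : IsLocalTo B S') (hSS : Disjoint S S') : Commute A B := by
  have hB : IsLocalTo B Sᶜ := hB.mono fun x hx => by
    rw [Finset.mem_compl]; exact fun h => Finset.disjoint_left.mp hSS h hx
  clear hSS
  ext σ η
  -- Locality leaves one intermediate configuration in each product: `ζ₀` for `A * B`, `ζ₁` for `B *
  -- A`. The surviving entries then agree because they differ only at sites where the operator acts
  -- trivially.
  set ζ₀ : Config Λ := fun x => if x ∈ S then η x else σ x with hζ₀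
  set ζ₁ : Config Λ := fun x => if x ∈ S then σ x else η x with hζ₁
  have e1 : (A * B) σ η = A σ ζ₀ * B ζ₀ η := by
    rw [Matrix.mul_apply]
    refine Finset.sum_eq_single ζ₀ (fun ζ _ hne => ?_) (by simp)
    obtain ⟨x, hx⟩ := Function.ne_iff.mp hne
    by_cases hxS : x ∈ S
    · rw [hB.apply_eq_zero (x := x) (by simpa using hxS), mul_zero]
      simpa [hζ₀, hxS] using hx
    · rw [hA.apply_eq_zero hxS, zero_mul]
      simpa [hζ₀, hxS] using Ne.symm hx
  have e2 : (B * A) σ η = B σ ζ₁ * A ζ₁ η := by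
    rw [Matrix.mul_apply]
    refine Finset.sum_eq_single ζ₁ (fun ζ _ hne => ?_) (by simp)
    obtain ⟨x, hx⟩ := Function.ne_iff.mp hne
    by_cases hxS : x ∈ S
    · rw [hB.apply_eq_zero (x := x) (by simpa using hxS), zero_mul]
      simpa [hζ₁, hxS] using Ne.symm hx
    · rw [hA.apply_eq_zero hxS, mul_zero]
      simpa [hζ₁, hxS] using hx
  rw [e1, e2, hA.apply_congr Sᶜ σ ζ₀ ζ₁ η, hB.apply_congr S ζ₀ η σ ζ₁, mul_comm]
  · intro x hx; simp [hζ₀, hζ₁, hx]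
  · intro x hx; simp [hζ₀, hζ₁, hx]
  · intro x hx
    rw [Finset.mem_compl] at hx
    simp [hζ₀, hζ₁, hx]
  · intro x hx
    rw [Finset.mem_compl, not_not] at hx
    simp [hζ₀, hζ₁, hx]

/-- The commutators of `A` with the Pauli operators at `x`. -/
def siteVariation (A : Op Λ) (x : Λ) : ℝ := ∑ b, ‖A * pauli b x - pauli b x * A‖

theorem siteVariation_nonneg (A : Op Λ) (x : Λ) : 0 ≤ siteVariation A x :=
  Finset.sum_nonneg fun _ _ => norm_nonneg _

/-- Averaging over the group generated by a Pauli operator. -/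
def pauliTwirl (A : Op Λ) (i : Bool × Λ) : Op Λ :=
  (1 / 2 : ℂ) • (A + pauli i.1 i.2 * A * pauli i.1 i.2)

theorem norm_pauliTwirl_le (A : Op Λ) (i : Bool × Λ) : ‖pauliTwirl A i‖ ≤ ‖A‖ := by
  have h : ‖pauli i.1 i.2 * A * pauli i.1 i.2‖ ≤ ‖A‖ := by
    refine (norm_mul_le _ _).trans ?_
    rw [norm_pauli, mul_one]
    refine (norm_mul_le _ _).trans ?_
    rw [norm_pauli, one_mul]
  calc ‖pauliTwirl A i‖ ≤ ‖(1 / 2 : ℂ)‖ * (‖A‖ + ‖pauli i.1 i.2 * A * pauli i.1 i.2‖) := by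
        rw [pauliTwirl, norm_smul]; gcongr; exact norm_add_le _ _
    _ ≤ ‖A‖ := by norm_num; linarith

/-- As a Pauli operator `P` squares to one, the difference is half of `[A, P] P`. -/
theorem norm_sub_pauliTwirl_le (A : Op Λ) (i : Bool × Λ) :
    ‖A - pauliTwirl A i‖ ≤ ‖A * pauli i.1 i.2 - pauli i.1 i.2 * A‖ := by
  have h : A - pauliTwirl A i =
      (1 / 2 : ℂ) • ((A * pauli i.1 i.2 - pauli i.1 i.2 * A) * pauli i.1 i.2) := by
    rw [sub_mul, mul_assoc, pauli_mul_self, mul_one, pauliTwirl]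
    module
  rw [h, norm_smul]
  have := norm_mul_le (A * pauli i.1 i.2 - pauli i.1 i.2 * A) (pauli i.1 i.2)
  rw [norm_pauli, mul_one] at this
  have h0 := norm_nonneg (A * pauli i.1 i.2 - pauli i.1 i.2 * A)
  norm_num
  linarith

theorem pauliTwirl_sub (A B : Op Λ) (i : Bool × Λ) :
    pauliTwirl (A - B) i = pauliTwirl A i - pauliTwirl B i := by
  simp only [pauliTwirl, mul_sub, sub_mul]
  module

theorem commute_pauliTwirl_self (A : Op Λ) (i : Bool × Λ) :
    Commute (pauliTwirl A i) (pauli i.1 i.2) := by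
  rw [Commute, SemiconjBy, pauliTwirl, smul_mul_assoc, mul_smul_comm, add_mul, mul_add, mul_assoc,
    pauli_mul_self, mul_one, ← mul_assoc, ← mul_assoc, pauli_mul_self, one_mul, add_comm]

theorem Commute.pauliTwirl {A : Op Λ} {j : Bool × Λ} (h : Commute A (pauli j.1 j.2))
    (i : Bool × Λ) : Commute (pauliTwirl A i) (pauli j.1 j.2) := by
  have key : pauli i.1 i.2 * A * pauli i.1 i.2 * pauli j.1 j.2 =
      pauli j.1 j.2 * (pauli i.1 i.2 * A * pauli i.1 i.2) := by
    rcases pauli_mul_pauli i.1 j.1 i.2 j.2 with e | e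
    · rw [mul_assoc, e, ← mul_assoc, mul_assoc _ A, h.eq, ← mul_assoc, e]
      simp only [mul_assoc]
    · rw [mul_assoc, e, mul_neg, ← mul_assoc, mul_assoc _ A, h.eq, ← mul_assoc, e]
      simp only [mul_assoc, neg_mul, neg_neg]
  rw [Commute, SemiconjBy, TrotterNoise.pauliTwirl, smul_mul_assoc, mul_smul_comm, add_mul,
    mul_add, key, h.eq]

/-- Twirls are contractions, so the cost of each additional one can be measured on the original `A`,
and the costs add up. -/
theorem exists_twirl (A : Op Λ) (l : List (Bool × Λ)) :
    ∃ A' : Op Λ, (∀ i ∈ l, Commute A' (pauli i.1 i.2)) ∧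
      ‖A - A'‖ ≤ (l.map fun i => ‖A * pauli i.1 i.2 - pauli i.1 i.2 * A‖).sum := by
  induction l with
  | nil => exact ⟨A, by simp, by simp⟩
  | cons i l ih =>
    obtain ⟨A', h1, h2⟩ := ih
    refine ⟨pauliTwirl A' i, fun j hj => ?_, ?_⟩
    · rcases List.mem_cons.mp hj with rfl | hj
      · exact commute_pauliTwirl_self A' j
      · exact (h1 j hj).pauliTwirl i
    · calc ‖A - pauliTwirl A' i‖ = ‖(A - pauliTwirl A i) + pauliTwirl (A - A') i‖ := by
            rw [pauliTwirl_sub]; congr 1; abel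
        _ ≤ _ := (norm_add_le _ _).trans (add_le_add (norm_sub_pauliTwirl_le A i)
            ((norm_pauliTwirl_le _ i).trans h2))
        _ = _ := by simp

/-- The localization tool for both error estimates: after twirling over all Paulis in `S`, nothing
acting on `S` sees the operator. -/
theorem exists_approx_isLocalTo_compl (A : Op Λ) (S : Finset Λ) :
    ∃ A' : Op Λ, IsLocalTo A' Sᶜ ∧ ‖A - A'‖ ≤ ∑ x ∈ S, siteVariation A x := by
  obtain ⟨A', h1, h2⟩ := exists_twirl A ((Finset.univ : Finset Bool) ×ˢ S).toList
  refine ⟨A', fun x hx b => h1 (b, x) ?_, h2.trans (le_of_eq ?_)⟩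
  · simpa using hx
  · rw [Finset.sum_map_toList, Finset.sum_product_right]
    rfl

end Pauli

end

end TrotterNoise

namespace TrotterNoise

noncomputable section

/-! ### Differential inequalities -/

section Growth

open Filter Topology Set

/-- If `f' = D + g`, where `D` does not increase the seminorm `p` to first order, then `p ∘ f`
grows at most at rate `p ∘ g`. -/
theorem le_add_integral_of_dissipative {E : Type*} [NormedAddCommGroup E] [NormedSpace ℝ E]
    {p : E → ℝ} (hpc : Continuous p) (hadd : ∀ x y, p (x + y) ≤ p x + p y)
    (hsmul : ∀ c : ℝ, 0 < c → ∀ x, p (c • x) = c * p x) (hp0 : p 0 = 0)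
    {f D g : ℝ → E} {b : ℝ → ℝ} (hf : ∀ t, HasDerivAt f (D t + g t) t)
    (hD : ∀ t, ∃ C : ℝ, ∀ ε : ℝ, 0 < ε → p (f t + ε • D t) ≤ (1 + C * ε ^ 2) * p (f t))
    (hg : ∀ t, p (g t) ≤ b t) (hb : Continuous b) {s t : ℝ} (hst : s ≤ t) :
    p (f t) ≤ p (f s) + ∫ u in s..t, b u := by
  have hfc : Continuous f := continuous_iff_continuousAt.mpr fun t => (hf t).continuousAt
  have hB : ∀ x, HasDerivAt (fun x => p (f s) + ∫ u in s..x, b u) (b x) x := fun x =>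
    (intervalIntegral.integral_hasDerivAt_right (hb.intervalIntegrable _ _)
      (hb.stronglyMeasurableAtFilter _ _) hb.continuousAt).const_add _
  refine image_le_of_liminf_slope_right_le_deriv_boundary (f := fun x => p (f x))
    (B := fun x => p (f s) + ∫ u in s..x, b u) (B' := b) (a := s) (b := t)
    (hpc.comp hfc).continuousOn (by simp) (fun x _ => (hB x).continuousAt.continuousWithinAt)
    (fun x _ => (hB x).hasDerivWithinAt) ?_ ⟨hst, le_rfl⟩
  intro x _ r hr
  obtain ⟨C, hC⟩ := hD x
  -- This function dominates the right slope of `p ∘ f`. The differentiation remainder tends to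
  -- zero, and the dissipativity loss, quadratic in the step, stays linear after division by the
  -- step; only `b x` survives.
  have hlim : Tendsto (fun z => p (slope f x z - (D x + g x)) + b x + C * (z - x) * p (f x))
      (𝓝[>] x) (𝓝 (b x)) := by
    have h1 : Tendsto (fun z => p (slope f x z - (D x + g x))) (𝓝[>] x) (𝓝 0) := by
      have := (hasDerivAt_iff_tendsto_slope.mp (hf x)).mono_left
        (show 𝓝[>] x ≤ 𝓝[≠] x from
          nhdsWithin_mono x fun z (hz : x < z) => ne_of_gt hz)
      have h := (hpc.tendsto _).comp (this.sub_const (D x + g x))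
      rw [sub_self, hp0] at h
      exact h
    have h2 : Tendsto (fun z => C * (z - x) * p (f x)) (𝓝[>] x) (𝓝 0) := by
      have : Continuous fun z : ℝ => C * (z - x) * p (f x) := by fun_prop
      have := (this.tendsto x).mono_left (nhdsWithin_le_nhds (s := Ioi x))
      simpa using this
    simpa using (h1.add_const (b x)).add h2
  refine Eventually.frequently ?_
  filter_upwards [hlim.eventually (gt_mem_nhds hr), self_mem_nhdsWithin] with z hz hxz
  have hε : 0 < z - x := sub_pos.mpr hxz
  refine lt_of_le_of_lt ?_ hz
  rw [slope_def_field, div_le_iff₀ hε]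
  have e : f z = (f x + (z - x) • D x) + (z - x) • g x +
      (z - x) • (slope f x z - (D x + g x)) := by
    have : (z - x) • slope f x z = f z - f x := by
      rw [slope_def_module, smul_inv_smul₀ hε.ne']
    rw [smul_sub, smul_add, this]; abel
  have hfz : p (f z) ≤ (1 + C * (z - x) ^ 2) * p (f x) + (z - x) * b x +
      (z - x) * p (slope f x z - (D x + g x)) := by
    refine ((congrArg p e).le.trans ((hadd _ _).trans
      (add_le_add_left (hadd _ _) _))).trans ?_
    rw [hsmul _ hε, hsmul _ hε]
    gcongr
    · exact hC _ hε
    · exact hg x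
  linarith

/-- Grönwall's inequality in integral form: the right-hand side of the hypothesis times `exp (-v (t
- s))` is nonincreasing. -/
theorem le_mul_exp_of_le_integral {m : ℝ → ℝ} (hm : Continuous m) {c v s : ℝ} (hv : 0 ≤ v)
    (h : ∀ t, s ≤ t → m t ≤ c + v * ∫ u in s..t, m u) {t : ℝ} (hst : s ≤ t) :
    m t ≤ c * Real.exp (v * (t - s)) := by
  have hφ : ∀ x, HasDerivAt (fun x => ∫ u in s..x, m u) (m x) x := fun x =>
    intervalIntegral.integral_hasDerivAt_right (hm.intervalIntegrable _ _)
      (hm.stronglyMeasurableAtFilter _ _) hm.continuousAt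
  have hψ : ∀ x, HasDerivAt (fun x => Real.exp (-(v * (x - s))) * (c + v * ∫ u in s..x, m u))
      (Real.exp (-(v * (x - s))) * (-(v * 1)) * (c + v * ∫ u in s..x, m u) +
        Real.exp (-(v * (x - s))) * (v * m x)) x := fun x =>
    ((((hasDerivAt_id x).sub_const s).const_mul v).neg.exp).mul (((hφ x).const_mul v).const_add c)
  have hanti : AntitoneOn (fun x => Real.exp (-(v * (x - s))) * (c + v * ∫ u in s..x, m u))
      (Ici s) := by
    refine antitoneOn_of_deriv_nonpos (convex_Ici s)
      (fun x _ => (hψ x).continuousAt.continuousWithinAt)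
      (fun x _ => (hψ x).differentiableAt.differentiableWithinAt) fun x hx => ?_
    rw [interior_Ici] at hx
    rw [(hψ x).deriv]
    have h1 := mul_le_mul_of_nonneg_left (h x (le_of_lt hx)) hv
    have h2 := mul_le_mul_of_nonneg_left h1 (Real.exp_nonneg (-(v * (x - s))))
    linarith
  have := hanti (self_mem_Ici) hst hst
  simp only [sub_self, mul_zero, neg_zero, Real.exp_zero, intervalIntegral.integral_same,
    add_zero, one_mul] at this
  rw [Real.exp_neg, inv_mul_le_iff₀ (Real.exp_pos _)] at this
  exact (h t hst).trans (this.trans (le_of_eq (mul_comm _ _)))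

end Growth

/-! ### Lattice geometry -/

section Lattice

variable {d : ℕ}

theorem latticeDist_self (x : Site d) : latticeDist x x = 0 := by simp [latticeDist]

theorem latticeDist_comm (x y : Site d) : latticeDist x y = latticeDist y x := by
  unfold latticeDist
  exact Finset.sum_congr rfl fun i _ => by omega

theorem latticeDist_triangle (x y z : Site d) :
    latticeDist x z ≤ latticeDist x y + latticeDist y z := by
  unfold latticeDist
  rw [← Finset.sum_add_distrib]
  exact Finset.sum_le_sum fun i _ => by omega

/-- Two geometric series of ratio `q = exp (-1/r)`, one per half-line; `exp (1/r) ≥ 1 + 1/r` gives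
`1 / (1 - q) ≤ r + 1`. -/
theorem sum_Icc_int_exp_le {r : ℝ} (hr : 0 < r) (N : ℕ) :
    ∑ k ∈ Finset.Icc (-(N : ℤ)) N, Real.exp (-(k.natAbs / r)) ≤ 2 * (r + 1) := by
  set q := Real.exp (-(1 / r)) with hq
  have hq0 : 0 ≤ q := Real.exp_nonneg _
  have hq1 : q < 1 := by rw [hq, Real.exp_lt_one_iff]; simpa using hr
  have hpow : ∀ k : ℕ, Real.exp (-(k / r)) = q ^ k := fun k => by
    rw [hq, ← Real.exp_nat_mul]; congr 1; ring
  have hgeo : ∑ k ∈ Finset.range (N + 1), q ^ k ≤ r + 1 := by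
    have h1 : ∑ k ∈ Finset.range (N + 1), q ^ k ≤ (1 - q)⁻¹ := by
      rw [← tsum_geometric_of_lt_one hq0 hq1]
      exact (summable_geometric_of_lt_one hq0 hq1).sum_le_tsum _ fun _ _ => pow_nonneg hq0 _
    refine h1.trans ?_
    have h2 : 1 / r + 1 ≤ Real.exp (1 / r) := Real.add_one_le_exp _
    have h3 : q ≤ (1 / r + 1)⁻¹ := by
      rw [hq, Real.exp_neg]; exact inv_anti₀ (by positivity) h2
    have h4 : (r + 1)⁻¹ ≤ 1 - q := by
      have : (1 / r + 1)⁻¹ = 1 - (r + 1)⁻¹ := by field_simp; ring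
      linarith
    exact inv_le_of_inv_le₀ (by positivity) h4
  have hsub : Finset.Icc (-(N : ℤ)) N ⊆
      (Finset.range (N + 1)).image (fun k : ℕ => (k : ℤ)) ∪
        (Finset.range (N + 1)).image (fun k : ℕ => -(k : ℤ)) := by
    intro k hk
    rw [Finset.mem_Icc] at hk
    simp only [Finset.mem_union, Finset.mem_image, Finset.mem_range]
    rcases le_total 0 k with h | h
    · exact Or.inl ⟨k.natAbs, by omega, by omega⟩
    · exact Or.inr ⟨k.natAbs, by omega, by omega⟩
  refine (Finset.sum_le_sum_of_subset_of_nonneg hsub fun _ _ _ => Real.exp_nonneg _).trans ?_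
  refine (le_add_of_nonneg_right (Finset.sum_nonneg fun _ _ => Real.exp_nonneg _)).trans
    (Finset.sum_union_inter (f := fun k : ℤ => Real.exp (-(k.natAbs / r)))).le |>.trans ?_
  rw [Finset.sum_image (fun a _ b _ h => by simpa using h),
    Finset.sum_image (fun a _ b _ h => by simpa using h)]
  simp only [Int.natAbs_neg, Int.natAbs_natCast, hpow]
  linarith

/-- The Manhattan distance is a sum over coordinates, so after enlarging `Λ` to a box the sum
factors into one-dimensional sums. With `r` growing linearly in time, this produces the light-cone
volume. -/
theorem sum_exp_latticeDist_le (Λ : Finset (Site d)) (x : Site d) {r : ℝ} (hr : 0 < r) :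
    ∑ y : Λ, Real.exp (-(latticeDist x (y : Site d) / r)) ≤ (2 * (r + 1)) ^ d := by
  obtain ⟨N, hN⟩ : ∃ N : ℕ, ∀ y ∈ Λ, ∀ i, (x i - y i).natAbs ≤ N := by
    refine ⟨Λ.sup fun y => Finset.univ.sup fun i => (x i - y i).natAbs, fun y hy i => ?_⟩
    exact (Finset.le_sup (f := fun i => (x i - y i).natAbs) (Finset.mem_univ i)).trans
      (Finset.le_sup (f := fun y => Finset.univ.sup fun i => (x i - y i).natAbs) hy)
  have hprod : ∀ z : Site d, Real.exp (-((∑ i, (z i).natAbs : ℕ) / r)) =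
      ∏ i, Real.exp (-((z i).natAbs / r)) := fun z => by
    rw [← Real.exp_sum]
    congr 1
    push_cast
    rw [Finset.sum_div, Finset.sum_neg_distrib]
  calc ∑ y : Λ, Real.exp (-(latticeDist x (y : Site d) / r))
      = ∑ y ∈ Λ, Real.exp (-((∑ i, ((x - y) i).natAbs : ℕ) / r)) :=
        Finset.sum_coe_sort Λ fun y => Real.exp (-(latticeDist x y / r))
    _ = ∑ z ∈ Λ.image (fun y => x - y), Real.exp (-((∑ i, (z i).natAbs : ℕ) / r)) := by
        rw [Finset.sum_image fun a _ b _ h => by simpa using h]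
    _ ≤ ∑ z ∈ Fintype.piFinset fun _ : Fin d => Finset.Icc (-(N : ℤ)) N,
          Real.exp (-((∑ i, (z i).natAbs : ℕ) / r)) := by
        refine Finset.sum_le_sum_of_subset_of_nonneg ?_ fun _ _ _ => Real.exp_nonneg _
        intro z hz
        obtain ⟨y, hy, rfl⟩ := Finset.mem_image.mp hz
        rw [Fintype.mem_piFinset]
        intro i
        have := hN y hy i
        rw [Finset.mem_Icc]
        simp only [Pi.sub_apply]
        omega
    _ = ∏ _i : Fin d, ∑ k ∈ Finset.Icc (-(N : ℤ)) N, Real.exp (-(k.natAbs / r)) := by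
        rw [Finset.prod_univ_sum]
        exact Finset.sum_congr rfl fun z _ => hprod z
    _ ≤ ∏ _i : Fin d, 2 * (r + 1) := Finset.prod_le_prod
        (fun _ _ => Finset.sum_nonneg fun _ _ => Real.exp_nonneg _)
        fun _ _ => sum_Icc_int_exp_le hr N
    _ = (2 * (r + 1)) ^ d := by simp

/-- Volume bound for balls of the lattice. -/
def ballVolume (d R : ℕ) : ℝ := Real.exp 1 * (2 * (R + 2)) ^ d

theorem ballVolume_nonneg (d R : ℕ) : 0 ≤ ballVolume d R := by unfold ballVolume; positivity

/-- Each site of the ball contributes at least `exp (-1)` to the exponential sum of decay length `R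
+ 1`. -/
theorem card_ball_le (Λ : Finset (Site d)) (x : Site d) (R : ℕ) :
    ((Finset.univ.filter fun y : Λ => latticeDist x (y : Site d) ≤ R).card : ℝ) ≤
      ballVolume d R := by
  have h := sum_exp_latticeDist_le Λ x (r := R + 1) (by positivity)
  have h2 : ∑ _y ∈ Finset.univ.filter fun y : Λ => latticeDist x (y : Site d) ≤ R,
      Real.exp (-1) ≤ ∑ y : Λ, Real.exp (-(latticeDist x (y : Site d) / ((R : ℝ) + 1))) := by
    refine (Finset.sum_le_sum fun y hy => ?_).trans
      (Finset.sum_le_sum_of_subset_of_nonneg (Finset.filter_subset _ _)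
        fun _ _ _ => Real.exp_nonneg _)
    rw [Finset.mem_filter] at hy
    refine Real.exp_le_exp.mpr (neg_le_neg ?_)
    rw [div_le_one (by positivity)]
    exact_mod_cast hy.2.trans (Nat.le_succ R)
  rw [Finset.sum_const, nsmul_eq_mul, Real.exp_neg, ← div_eq_mul_inv] at h2
  have h3 := (div_le_iff₀ (Real.exp_pos 1)).mp (h2.trans h)
  refine h3.trans (le_of_eq ?_)
  rw [ballVolume, mul_comm]
  congr 3
  ring

/-- A plateau of radius `R` with a unit-rate tail is traded, at the price of a factor `e`, for a
pure exponential of decay length `R + 1`, to which the lattice sum applies directly. -/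
theorem min_one_exp_le {R : ℝ} (hR : 0 ≤ R) (m : ℕ) :
    min 1 (Real.exp (R - m)) ≤ Real.exp 1 * Real.exp (-(m / (R + 1))) := by
  rw [← Real.exp_add]
  rcases le_total (m : ℝ) (R + 1) with h | h
  · refine (min_le_left _ _).trans (Real.one_le_exp ?_)
    have : (m : ℝ) / (R + 1) ≤ 1 := (div_le_one (by linarith)).mpr h
    linarith
  · refine (min_le_right _ _).trans (Real.exp_le_exp.mpr ?_)
    have hm : (m : ℝ) / (R + 1) = m - m / (R + 1) * R := by field_simp; ring
    have : 1 ≤ (m : ℝ) / (R + 1) := (one_le_div (by linarith)).mpr h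
    nlinarith

variable {Λ : Finset (Site d)}

/-- The distance from a region to a site (zero for the empty region). -/
def distTo (S : Finset Λ) (y : Λ) : ℕ :=
  sInf ((fun x : Λ => latticeDist (x : Site d) (y : Site d)) '' S)

theorem distTo_le {S : Finset Λ} {x : Λ} (hx : x ∈ S) (y : Λ) :
    distTo S y ≤ latticeDist (x : Site d) (y : Site d) :=
  Nat.sInf_le ⟨x, hx, rfl⟩

theorem exists_distTo_eq {S : Finset Λ} (hS : S.Nonempty) (y : Λ) :
    ∃ x ∈ S, latticeDist (x : Site d) (y : Site d) = distTo S y := by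
  have : ((fun x : Λ => latticeDist (x : Site d) (y : Site d)) '' S).Nonempty :=
    Set.Nonempty.image _ (by simpa using hS)
  obtain ⟨x, hx, h⟩ := Nat.sInf_mem this
  exact ⟨x, hx, h⟩

theorem distTo_eq_zero {S : Finset Λ} {y : Λ} (hy : y ∈ S) : distTo S y = 0 := by
  have := distTo_le hy y
  rw [latticeDist_self] at this
  omega

theorem distTo_le_add {S S' : Finset Λ} {a : ℕ} (h : ¬ Disjoint S S')
    (ha : ∀ x ∈ S', ∀ y ∈ S', latticeDist (x : Site d) (y : Site d) ≤ a) (y : Λ) :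
    distTo S y ≤ a + distTo S' y := by
  obtain ⟨z, hz, hz'⟩ := Finset.not_disjoint_iff.mp h
  obtain ⟨x, hx, hxy⟩ := exists_distTo_eq ⟨z, hz'⟩ y
  rw [← hxy]
  exact (distTo_le hz y).trans ((latticeDist_triangle _ (x : Site d) _).trans
    (Nat.add_le_add_right (ha z hz' x hx) _))

theorem GeomLocalRegions.card_meeting_le {m : ℕ} {S : Fin m → Finset Λ} {a Z : ℕ}
    (h : GeomLocalRegions S a Z) (α : Fin m) :
    (Finset.univ.filter fun β => ¬ Disjoint (S β) (S α)).card ≤ Z := by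
  refine le_trans (le_of_eq ?_) (h.coord_le α)
  rw [← Set.ncard_coe_finset]
  congr 1
  ext β
  simp [disjoint_comm]

/-- All regions containing `x` meet any fixed one of them, so the coordination number also bounds
how many regions cover a site. -/
theorem GeomLocalRegions.card_containing_le {m : ℕ} {S : Fin m → Finset Λ} {a Z : ℕ}
    (h : GeomLocalRegions S a Z) (x : Λ) :
    (Finset.univ.filter fun β => x ∈ S β).card ≤ Z := by
  rcases (Finset.univ.filter fun β => x ∈ S β).eq_empty_or_nonempty with he | ⟨α, hα⟩
  · simp [he]
  · refine (Finset.card_le_card fun β hβ => ?_).trans (h.card_meeting_le α)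
    simp only [Finset.mem_filter, Finset.mem_univ, true_and] at hα hβ ⊢
    exact Finset.not_disjoint_iff.mpr ⟨x, hβ, hα⟩

theorem GeomLocalRegions.card_meeting_finset_le {m : ℕ} {S : Fin m → Finset Λ} {a Z : ℕ}
    (h : GeomLocalRegions S a Z) (X : Finset Λ) :
    (Finset.univ.filter fun β => ¬ Disjoint (S β) X).card ≤ X.card * Z := by
  calc (Finset.univ.filter fun β => ¬ Disjoint (S β) X).card
      ≤ (X.biUnion fun x => Finset.univ.filter fun β => x ∈ S β).card := by
        refine Finset.card_le_card fun β hβ => ?_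
        simp only [Finset.mem_filter, Finset.mem_univ, true_and, Finset.mem_biUnion] at hβ ⊢
        obtain ⟨x, h1, h2⟩ := Finset.not_disjoint_iff.mp hβ
        exact ⟨x, h2, h1⟩
    _ ≤ X.card * Z := Finset.card_biUnion_le_card_mul _ _ _ fun x _ => h.card_containing_le x

end Lattice

end

end TrotterNoise

namespace TrotterNoise

noncomputable section

/-! ### Lieb–Robinson bounds -/

section LiebRobinson

open Complex (I)

variable {d m : ℕ} {Λ : Finset (Site d)}

/-- Hermitian terms of norm at most `J`, local to the regions of a geometrically local family. -/
structure LocalTerms (h : Fin m → Op Λ) (S : Fin m → Finset Λ) (a Z : ℕ) (J : ℝ) : Prop where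
  regions : GeomLocalRegions S a Z
  isSelfAdjoint : ∀ α, star (h α) = h α
  isLocal : ∀ α, IsLocalTo (h α) (S α)
  norm_le : ∀ α, ‖h α‖ ≤ J

theorem GeomLocalTerms.localTerms {h : Fin m → Op Λ} {S : Fin m → Finset Λ} {a Z : ℕ} {J : ℝ}
    (H : GeomLocalTerms h S a Z J) : LocalTerms h S a Z J :=
  ⟨H.regions, fun α => H.hermitian α, fun α => (H.supported α).isLocalTo, H.norm_le⟩

/-- `Q` is a unitary solution of the Schrödinger equation `Q' = -i H Q`. -/
structure IsPropagator (H Q : ℝ → Op Λ) : Prop where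
  hasDerivAt : ∀ t, HasDerivAt Q (-(I • (H t * Q t))) t
  star_mul_self : ∀ t, star (Q t) * Q t = 1

namespace IsPropagator

variable {H Q : ℝ → Op Λ}

theorem mul_star_self (hQ : IsPropagator H Q) (t : ℝ) : Q t * star (Q t) = 1 :=
  mul_eq_one_comm.mp (hQ.star_mul_self t)

theorem mem_unitary (hQ : IsPropagator H Q) (t : ℝ) : Q t ∈ unitary (Op Λ) :=
  Unitary.mem_iff.mpr ⟨hQ.star_mul_self t, hQ.mul_star_self t⟩

theorem continuous (hQ : IsPropagator H Q) : Continuous Q :=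
  continuous_iff_continuousAt.mpr fun t => (hQ.hasDerivAt t).continuousAt

theorem norm_heisenberg (hQ : IsPropagator H Q) (A : Op Λ) (t : ℝ) :
    ‖star (Q t) * A * Q t‖ = ‖A‖ := by
  rw [CStarRing.norm_mul_mem_unitary _ (hQ.mem_unitary t),
    CStarRing.norm_mem_unitary_mul _ (Unitary.star_mem (hQ.mem_unitary t))]

theorem hasDerivAt_heisenberg (hQ : IsPropagator H Q) (hH : ∀ t, star (H t) = H t) (A : Op Λ)
    (t : ℝ) : HasDerivAt (fun t => star (Q t) * A * Q t)
      (I • (star (Q t) * (H t * A - A * H t) * Q t)) t := by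
  have h := (((hQ.hasDerivAt t).star).mul_const A).mul (hQ.hasDerivAt t)
  convert! h using 1
  simp only [star_neg, star_smul, star_mul, hH, RCLike.star_def, Complex.conj_I, mul_sub, sub_mul,
    mul_neg, neg_smul, neg_neg, smul_mul_assoc, mul_smul_comm, smul_sub, mul_assoc]
  abel

end IsPropagator

/-- The norm of the commutator of `A` and `B`. -/
def commNorm (A B : Op Λ) : ℝ := ‖A * B - B * A‖

theorem commNorm_le (A B : Op Λ) : commNorm A B ≤ 2 * ‖A‖ * ‖B‖ := by
  refine (norm_sub_le _ _).trans ?_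
  have h1 := norm_mul_le A B
  have h2 := norm_mul_le B A
  linarith

/-- With `R = 1 + iεK`, the left side is the norm of `R f R* - ε² K f K`, and `R* R = 1 + ε² K²`: a
commutator flow preserves the operator norm up to second order. -/
theorem norm_add_smul_commutator_le {K f : Op Λ} (hK : star K = K) (ε : ℝ) :
    ‖f + ε • (I • (K * f - f * K))‖ ≤ (1 + 2 * ‖K‖ ^ 2 * ε ^ 2) * ‖f‖ := by
  set R : Op Λ := 1 + (ε : ℂ) • (I • K) with hR
  have hRs : star R = 1 - (ε : ℂ) • (I • K) := by
    rw [hR]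
    simp only [star_add, star_one, star_smul, hK, RCLike.star_def, Complex.conj_I,
      Complex.conj_ofReal, neg_smul, smul_neg]
    abel
  have hRR : star R * R = 1 + ((ε : ℂ) ^ 2) • (K * K) := by
    rw [hRs, hR]
    simp only [sub_mul, mul_add, one_mul, mul_one, smul_mul_assoc, mul_smul_comm, smul_smul,
      smul_sub]
    have : (ε : ℂ) * I * (ε * I) = -(ε : ℂ) ^ 2 := by
      rw [show (ε : ℂ) * I * (ε * I) = ε ^ 2 * (I * I) by ring, Complex.I_mul_I]; ring
    rw [this, neg_smul]; abel
  have hKK : ‖K * K‖ ≤ ‖K‖ ^ 2 := by rw [sq]; exact norm_mul_le _ _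
  have hε : ‖((ε : ℂ) ^ 2)‖ = ε ^ 2 := by
    rw [norm_pow, Complex.norm_real, Real.norm_eq_abs, sq_abs]
  have hRn : ‖R‖ * ‖R‖ ≤ 1 + ε ^ 2 * ‖K‖ ^ 2 := by
    rw [← CStarRing.norm_star_mul_self, hRR]
    refine (norm_add_le _ _).trans ?_
    rw [norm_smul, hε, CStarRing.norm_one]
    gcongr
  have e : f + ε • (I • (K * f - f * K)) = R * f * star R - ((ε : ℂ) ^ 2) • (K * f * K) := by
    rw [hRs, hR, ← Complex.coe_smul ε]
    simp only [mul_sub, add_mul, one_mul, mul_one, smul_mul_assoc,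
      mul_smul_comm, smul_smul, smul_sub, smul_add]
    have : (ε : ℂ) * I * (ε * I) = -(ε : ℂ) ^ 2 := by
      rw [show (ε : ℂ) * I * (ε * I) = ε ^ 2 * (I * I) by ring, Complex.I_mul_I]; ring
    rw [this, neg_smul]; abel
  rw [e]
  have h1 : ‖R * f * star R‖ ≤ (1 + ε ^ 2 * ‖K‖ ^ 2) * ‖f‖ := by
    calc ‖R * f * star R‖ ≤ ‖R‖ * ‖f‖ * ‖R‖ := by
          refine (norm_mul_le _ _).trans ?_
          rw [norm_star]
          gcongr
          exact norm_mul_le _ _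
      _ = ‖R‖ * ‖R‖ * ‖f‖ := by ring
      _ ≤ _ := by gcongr
  have h2 : ‖((ε : ℂ) ^ 2) • (K * f * K)‖ ≤ ε ^ 2 * ‖K‖ ^ 2 * ‖f‖ := by
    rw [norm_smul, hε]
    calc ε ^ 2 * ‖K * f * K‖ ≤ ε ^ 2 * (‖K‖ * ‖f‖ * ‖K‖) := by
          gcongr
          refine (norm_mul_le _ _).trans ?_
          gcongr
          exact norm_mul_le _ _
      _ = _ := by ring
  refine (norm_sub_le _ _).trans ((add_le_add h1 h2).trans (le_of_eq ?_))
  ring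

variable {h : Fin m → ℝ → Op Λ} {S : Fin m → Finset Λ} {a Z : ℕ} {J : ℝ} {Q : ℝ → Op Λ}

theorem LocalTerms.star_sum {h : Fin m → Op Λ} (H : LocalTerms h S a Z J) :
    star (∑ α, h α) = ∑ α, h α := by
  rw [_root_.star_sum]; exact Finset.sum_congr rfl fun α _ => H.isSelfAdjoint α

theorem LocalTerms.commutator_sum {h : Fin m → Op Λ} (H : LocalTerms h S a Z J) {A : Op Λ}
    {X : Finset Λ} (hA : IsLocalTo A X) :
    (∑ α, h α) * A - A * ∑ α, h α =
      (∑ α with ¬ Disjoint (S α) X, h α) * A - A * ∑ α with ¬ Disjoint (S α) X, h α := by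
  have : Commute (∑ α with ¬¬ Disjoint (S α) X, h α) A := by
    refine Commute.sum_left _ _ _ fun α hα => ?_
    rw [Finset.mem_filter, not_not] at hα
    exact (H.isLocal α).commute hA hα.2
  rw [← Finset.sum_filter_add_sum_filter_not Finset.univ (fun α => ¬ Disjoint (S α) X),
    add_mul, mul_add, this.eq]
  abel

/-- Only the terms meeting `X` move `A`. Let `A'` be the evolved `A` and `K'` the evolved sum of
those terms; by the Jacobi identity the derivative of `[A', P]` is `i[K', [A', P]] - i[A', [K',
P]]`. The first part does not increase the norm to first order, so only the second enters the
integral. -/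
theorem commNorm_heisenberg_le (hh : ∀ t, LocalTerms (fun α => h α t) S a Z J)
    (hc : ∀ α, Continuous (h α)) (hQ : IsPropagator (fun t => ∑ α, h α t) Q) {A : Op Λ}
    {X : Finset Λ} (hA : IsLocalTo A X) (P : Op Λ) {s t : ℝ} (hst : s ≤ t) :
    commNorm (star (Q t) * A * Q t) P ≤ commNorm (star (Q s) * A * Q s) P +
      ∫ u in s..t, 2 * ‖A‖ * ∑ α with ¬ Disjoint (S α) X,
        commNorm (star (Q u) * h α u * Q u) P := by
  set K : ℝ → Op Λ := fun t => ∑ α with ¬ Disjoint (S α) X, h α t with hK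
  set K' : ℝ → Op Λ := fun t => star (Q t) * K t * Q t with hK'
  set A' : ℝ → Op Λ := fun t => star (Q t) * A * Q t with hA'
  have hKs : ∀ t, star (K t) = K t := fun t => by
    rw [hK, star_sum]; exact Finset.sum_congr rfl fun α _ => (hh t).isSelfAdjoint α
  have hKs' : ∀ t, star (K' t) = K' t := fun t => by
    simp only [hK', star_mul, star_star, hKs, mul_assoc]
  have hderiv : ∀ t, HasDerivAt A' (I • (K' t * A' t - A' t * K' t)) t := by
    intro t
    have := hQ.hasDerivAt_heisenberg (fun t => (hh t).star_sum) A t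
    convert! this using 2
    rw [(hh t).commutator_sum hA]
    have e : ∀ B C : Op Λ, star (Q t) * B * Q t * (star (Q t) * C * Q t) =
        star (Q t) * (B * C) * Q t := fun B C => by
      rw [show star (Q t) * B * Q t * (star (Q t) * C * Q t) =
        star (Q t) * B * (Q t * star (Q t)) * C * Q t by simp only [mul_assoc],
        hQ.mul_star_self, mul_one]
      simp only [mul_assoc]
    simp only [hK', hA', e, mul_sub, sub_mul]
    rfl
  have hQc := hQ.continuous
  refine le_add_integral_of_dissipative continuous_norm norm_add_le
    (fun c hc x => by rw [norm_smul, Real.norm_of_nonneg hc.le]) norm_zero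
    (f := fun t => A' t * P - P * A' t)
    (D := fun t => I • (K' t * (A' t * P - P * A' t) - (A' t * P - P * A' t) * K' t))
    (g := fun t => -(I • (A' t * (K' t * P - P * K' t) - (K' t * P - P * K' t) * A' t)))
    (fun t => ?_) (fun t => ⟨_, fun ε _ => norm_add_smul_commutator_le (hKs' t) ε⟩)
    (fun t => ?_) ?_ hst
  · convert! ((hderiv t).mul_const P).sub ((hderiv t).const_mul P) using 1
    simp only [smul_mul_assoc, mul_smul_comm, ← smul_sub, ← smul_neg, ← smul_add]
    congr 1
    noncomm_ring
  · rw [norm_neg, norm_smul, Complex.norm_I, one_mul]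
    refine (commNorm_le (A' t) _).trans ?_
    have h1 : ‖A' t‖ = ‖A‖ := hQ.norm_heisenberg A t
    rw [h1]
    gcongr
    have : K' t * P - P * K' t = ∑ α with ¬ Disjoint (S α) X,
        (star (Q t) * h α t * Q t * P - P * (star (Q t) * h α t * Q t)) := by
      simp only [hK', hK, Finset.mul_sum, Finset.sum_mul, Finset.sum_sub_distrib]
    rw [this]
    exact norm_sum_le _ _
  · unfold commNorm
    fun_prop

theorem commNorm_pauli_le (A : Op Λ) (b : Bool) (y : Λ) : commNorm A (pauli b y) ≤ 2 * ‖A‖ := by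
  have := commNorm_le A (pauli b y)
  rwa [norm_pauli, mul_one] at this

theorem IsLocalTo.commNorm_eq_zero {A : Op Λ} {X : Finset Λ} (hA : IsLocalTo A X) {y : Λ}
    (hy : y ∉ X) (b : Bool) : commNorm A (pauli b y) = 0 := by
  rw [commNorm, (hA y hy b).eq, sub_self, norm_zero]

/-- The Lieb–Robinson velocity (for distances weighted at unit rate). -/
def lrVelocity (a Z : ℕ) (J : ℝ) : ℝ := 2 * J * Z * Real.exp a

theorem exp_distTo_le {S S' : Finset Λ} {a : ℕ} (h : ¬ Disjoint S S')
    (ha : ∀ x ∈ S', ∀ y ∈ S', latticeDist (x : Site d) (y : Site d) ≤ a) (y : Λ) :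
    Real.exp (distTo S y) ≤ Real.exp a * Real.exp (distTo S' y) := by
  rw [← Real.exp_add]
  exact Real.exp_le_exp.mpr (by exact_mod_cast distTo_le_add h ha y)

/-- Lieb–Robinson bound by Grönwall for the supremum over `α` of the commutators weighted by `exp
(distTo (S α) y)`. Passing to a neighbouring region changes the weight by at most `exp a`, and there
are at most `Z` neighbours, which is the origin of `lrVelocity`. -/
theorem commNorm_term_le (hJ : 0 ≤ J) (hh : ∀ t, LocalTerms (fun α => h α t) S a Z J)
    (hc : ∀ α, Continuous (h α)) (hQ : IsPropagator (fun t => ∑ α, h α t) Q) {s : ℝ}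
    (hs : Q s = 1) (b : Bool) (y : Λ) (α : Fin m) {t : ℝ} (hst : s ≤ t) :
    Real.exp (distTo (S α) y) * commNorm (star (Q t) * h α t * Q t) (pauli b y) ≤
      2 * J * Real.exp (lrVelocity a Z J * (t - s)) := by
  have hQc := hQ.continuous
  set G : ℝ → Fin m → ℝ := fun t α =>
    Real.exp (distTo (S α) y) * commNorm (star (Q t) * h α t * Q t) (pauli b y) with hG
  have hG0 : ∀ t α, 0 ≤ G t α := fun t α => mul_nonneg (Real.exp_nonneg _) (norm_nonneg _)
  have hGc : Continuous G := by
    rw [hG]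
    unfold commNorm
    fun_prop
  have hle : ∀ u β, G u β ≤ ‖G u‖ := fun u β =>
    (le_abs_self _).trans (norm_le_pi_norm (G u) β)
  have hint : ∀ t, s ≤ t → 0 ≤ ∫ u in s..t, ‖G u‖ := fun t ht =>
    intervalIntegral.integral_nonneg ht fun u _ => norm_nonneg _
  have hv : 0 ≤ lrVelocity a Z J := by unfold lrVelocity; positivity
  have hmain : ∀ t, s ≤ t → ‖G t‖ ≤ 2 * J + lrVelocity a Z J * ∫ u in s..t, ‖G u‖ := by
    intro t hst
    refine (pi_norm_le_iff_of_nonneg (by have := hint t hst; positivity)).mpr fun α => ?_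
    rw [Real.norm_of_nonneg (hG0 t α)]
    -- The term is frozen at the final time `t` as a fixed operator; its explicit time dependence is
    -- never differentiated.
    have h1 := commNorm_heisenberg_le hh hc hQ ((hh t).isLocal α) (pauli b y) hst
    have h2 : Real.exp (distTo (S α) y) * commNorm (star (Q s) * h α t * Q s) (pauli b y) ≤
        2 * J := by
      rw [hs, star_one, one_mul, mul_one]
      by_cases hy : y ∈ S α
      · rw [distTo_eq_zero hy, Nat.cast_zero, Real.exp_zero, one_mul]
        refine (commNorm_pauli_le _ b y).trans ?_
        have := (hh t).norm_le α
        linarith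
      · rw [((hh t).isLocal α).commNorm_eq_zero hy, mul_zero]
        positivity
    have h3 : Real.exp (distTo (S α) y) * (∫ u in s..t, 2 * ‖h α t‖ *
        ∑ β with ¬ Disjoint (S β) (S α), commNorm (star (Q u) * h β u * Q u) (pauli b y)) ≤
        lrVelocity a Z J * ∫ u in s..t, ‖G u‖ := by
      rw [← intervalIntegral.integral_const_mul, ← intervalIntegral.integral_const_mul]
      refine intervalIntegral.integral_mono_on hst ?_ ?_ fun u _ => ?_
      · refine Continuous.intervalIntegrable ?_ _ _
        unfold commNorm; fun_prop
      · exact Continuous.intervalIntegrable (by fun_prop) _ _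
      · have hterm : ∀ β ∈ Finset.univ.filter fun β => ¬ Disjoint (S β) (S α),
            Real.exp (distTo (S α) y) * commNorm (star (Q u) * h β u * Q u) (pauli b y) ≤
              Real.exp a * ‖G u‖ := by
          intro β hβ
          rw [Finset.mem_filter, disjoint_comm] at hβ
          calc _ ≤ Real.exp a * Real.exp (distTo (S β) y) *
                commNorm (star (Q u) * h β u * Q u) (pauli b y) :=
                mul_le_mul_of_nonneg_right
                  (exp_distTo_le hβ.2 ((hh u).regions.diam_le β) y) (norm_nonneg _)
            _ = Real.exp a * G u β := by rw [hG]; ring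
            _ ≤ _ := by gcongr; exact hle u β
        calc _ = 2 * ‖h α t‖ * ∑ β with ¬ Disjoint (S β) (S α), Real.exp (distTo (S α) y) *
              commNorm (star (Q u) * h β u * Q u) (pauli b y) := by
              rw [← Finset.mul_sum]; ring
          _ ≤ 2 * J * (Z * (Real.exp a * ‖G u‖)) := by
              gcongr
              · exact Finset.sum_nonneg fun β _ =>
                  mul_nonneg (Real.exp_nonneg _) (norm_nonneg _)
              · exact (hh t).norm_le α
              · refine (Finset.sum_le_card_nsmul _ _ _ hterm).trans ?_
                rw [nsmul_eq_mul]
                gcongr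
                exact (hh t).regions.card_meeting_le α
          _ = _ := by rw [lrVelocity]; ring
    calc G t α ≤ Real.exp (distTo (S α) y) * _ :=
          mul_le_mul_of_nonneg_left h1 (Real.exp_nonneg _)
      _ ≤ _ := by rw [mul_add]; exact add_le_add h2 h3
  exact (hle t α).trans (le_mul_exp_of_le_integral hGc.norm hv hmain hst)

/-- One further iteration starting from `X`, which at most `|X| Z` terms meet. Bounding the initial
commutator with the same prefactor `|X|` makes it cancel the `-1` left by integrating the
exponential. -/
theorem commNorm_observable_le (hJ : 0 ≤ J) (hh : ∀ t, LocalTerms (fun α => h α t) S a Z J)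
    (hc : ∀ α, Continuous (h α)) (hQ : IsPropagator (fun t => ∑ α, h α t) Q) {s : ℝ}
    (hs : Q s = 1) {O : Op Λ} {X : Finset Λ} (hO : IsLocalTo O X) (b : Bool) (y : Λ) {t : ℝ}
    (hst : s ≤ t) :
    Real.exp (distTo X y) * commNorm (star (Q t) * O * Q t) (pauli b y) ≤
      2 * ‖O‖ * X.card * Real.exp (lrVelocity a Z J * (t - s)) := by
  have hQc := hQ.continuous
  set v := lrVelocity a Z J with hv
  have hv0 : 0 ≤ v := by rw [hv, lrVelocity]; positivity
  have h1 := commNorm_heisenberg_le hh hc hQ hO (pauli b y) hst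
  have h2 : Real.exp (distTo X y) * commNorm (star (Q s) * O * Q s) (pauli b y) ≤
      2 * ‖O‖ * X.card := by
    rw [hs, star_one, one_mul, mul_one]
    by_cases hy : y ∈ X
    · rw [distTo_eq_zero hy, Nat.cast_zero, Real.exp_zero, one_mul]
      refine (commNorm_pauli_le _ b y).trans (le_mul_of_one_le_right (by positivity) ?_)
      exact_mod_cast Finset.card_pos.mpr ⟨y, hy⟩
    · rw [hO.commNorm_eq_zero hy, mul_zero]
      positivity
  have h3 : Real.exp (distTo X y) * (∫ u in s..t, 2 * ‖O‖ *
      ∑ β with ¬ Disjoint (S β) X, commNorm (star (Q u) * h β u * Q u) (pauli b y)) ≤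
      ∫ u in s..t, 2 * ‖O‖ * X.card * (v * Real.exp (v * (u - s))) := by
    rw [← intervalIntegral.integral_const_mul]
    refine intervalIntegral.integral_mono_on hst ?_ ?_ fun u hu => ?_
    · refine Continuous.intervalIntegrable ?_ _ _
      unfold commNorm; fun_prop
    · exact Continuous.intervalIntegrable (by fun_prop) _ _
    · have hterm : ∀ β ∈ Finset.univ.filter fun β => ¬ Disjoint (S β) X,
          Real.exp (distTo X y) * commNorm (star (Q u) * h β u * Q u) (pauli b y) ≤
            Real.exp a * (2 * J * Real.exp (v * (u - s))) := by
        intro β hβ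
        rw [Finset.mem_filter, disjoint_comm] at hβ
        calc _ ≤ Real.exp a * Real.exp (distTo (S β) y) *
              commNorm (star (Q u) * h β u * Q u) (pauli b y) :=
              mul_le_mul_of_nonneg_right
                (exp_distTo_le hβ.2 ((hh u).regions.diam_le β) y) (norm_nonneg _)
          _ ≤ _ := by
              rw [mul_assoc]
              exact mul_le_mul_of_nonneg_left (commNorm_term_le hJ hh hc hQ hs b y β hu.1)
                (Real.exp_nonneg _)
      calc _ = 2 * ‖O‖ * ∑ β with ¬ Disjoint (S β) X, Real.exp (distTo X y) *
            commNorm (star (Q u) * h β u * Q u) (pauli b y) := by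
            rw [← Finset.mul_sum]; ring
        _ ≤ 2 * ‖O‖ * (X.card * Z * (Real.exp a * (2 * J * Real.exp (v * (u - s))))) := by
            gcongr
            refine (Finset.sum_le_card_nsmul _ _ _ hterm).trans ?_
            rw [nsmul_eq_mul]
            gcongr
            exact_mod_cast (hh u).regions.card_meeting_finset_le X
        _ = _ := by rw [hv, lrVelocity]; ring
  have h4 : ∫ u in s..t, 2 * ‖O‖ * X.card * (v * Real.exp (v * (u - s))) =
      2 * ‖O‖ * X.card * (Real.exp (v * (t - s)) - 1) := by
    rw [intervalIntegral.integral_const_mul]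
    congr 1
    have hd : ∀ u ∈ Set.uIcc s t, HasDerivAt (fun u => Real.exp (v * (u - s)))
        (v * Real.exp (v * (u - s))) u := fun u _ => by
      have := (((hasDerivAt_id u).sub_const s).const_mul v).exp
      convert! this using 1
      simp [mul_comm]
    rw [intervalIntegral.integral_eq_sub_of_hasDerivAt hd
      (Continuous.intervalIntegrable (by fun_prop) _ _)]
    simp
  calc _ ≤ Real.exp (distTo X y) * _ := mul_le_mul_of_nonneg_left h1 (Real.exp_nonneg _)
    _ ≤ 2 * ‖O‖ * X.card + 2 * ‖O‖ * X.card * (Real.exp (v * (t - s)) - 1) := by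
        rw [mul_add]; exact add_le_add h2 (h3.trans h4.le)
    _ = _ := by ring

/-- The total variation of an observable spreads at most linearly in time. -/
theorem sum_siteVariation_heisenberg_le (hJ : 0 ≤ J)
    (hh : ∀ t, LocalTerms (fun α => h α t) S a Z J)
    (hc : ∀ α, Continuous (h α)) (hQ : IsPropagator (fun t => ∑ α, h α t) Q) {s : ℝ}
    (hs : Q s = 1) {O : Op Λ} {X : Finset Λ} (hO : IsLocalTo O X) {t : ℝ} (hst : s ≤ t) :
    ∑ y, siteVariation (star (Q t) * O * Q t) y ≤
      4 * Real.exp 1 * (2 * (lrVelocity a Z J * (t - s) + 2)) ^ d * (X.card ^ 2 * ‖O‖) := by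
  set v := lrVelocity a Z J with hv
  have hv0 : 0 ≤ v := by rw [hv, lrVelocity]; positivity
  have hR : 0 ≤ v * (t - s) := mul_nonneg hv0 (sub_nonneg.mpr hst)
  have hpt : ∀ y : Λ, siteVariation (star (Q t) * O * Q t) y ≤
      4 * Real.exp 1 * ‖O‖ * X.card * ∑ x ∈ X,
        Real.exp (-(latticeDist (x : Site d) (y : Site d) / (v * (t - s) + 1))) := by
    intro y
    have hb : ∀ b, commNorm (star (Q t) * O * Q t) (pauli b y) ≤
        2 * Real.exp 1 * ‖O‖ * X.card * ∑ x ∈ X,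
          Real.exp (-(latticeDist (x : Site d) (y : Site d) / (v * (t - s) + 1))) := by
      intro b
      have h1 := commNorm_observable_le hJ hh hc hQ hs hO b y hst
      -- For empty `X` the factor `|X| = 0` already makes the commutator vanish; otherwise the
      -- distance to `X` is attained.
      rcases X.eq_empty_or_nonempty with rfl | hX
      · simp only [Finset.card_empty, Nat.cast_zero, mul_zero, zero_mul] at h1 ⊢
        exact nonpos_of_mul_nonpos_right h1 (Real.exp_pos _)
      -- The Lieb–Robinson bound is useless inside the light cone, where the trivial bound `2 ‖O‖`
      -- takes over.
      have h2 : commNorm (star (Q t) * O * Q t) (pauli b y) ≤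
          2 * ‖O‖ * X.card * min 1 (Real.exp (v * (t - s) - distTo X y)) := by
        rw [mul_min_of_nonneg _ _ (by positivity), le_min_iff]
        constructor
        · refine (commNorm_pauli_le _ b y).trans ?_
          rw [hQ.norm_heisenberg, mul_one]
          refine le_mul_of_one_le_right (by positivity) ?_
          exact_mod_cast Finset.card_pos.mpr hX
        · rw [Real.exp_sub, mul_div_assoc', le_div_iff₀ (Real.exp_pos _), mul_comm]
          exact h1
      -- Replacing the nearest site of `X` by the sum over all of `X` makes the sum over `y`
      -- computable; this is the second factor `|X|`.
      obtain ⟨x, hx, hxy⟩ := exists_distTo_eq hX y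
      refine h2.trans ?_
      calc _ ≤ 2 * ‖O‖ * X.card *
            (Real.exp 1 * Real.exp (-(distTo X y / (v * (t - s) + 1)))) := by
            gcongr; exact min_one_exp_le hR _
        _ = 2 * Real.exp 1 * ‖O‖ * X.card *
            Real.exp (-(latticeDist (x : Site d) (y : Site d) / (v * (t - s) + 1))) := by
            rw [hxy]; ring
        _ ≤ _ := by
            gcongr
            exact Finset.single_le_sum (f := fun x : Λ =>
              Real.exp (-(latticeDist (x : Site d) (y : Site d) / (v * (t - s) + 1))))
              (fun _ _ => Real.exp_nonneg _) hx
    have h1 := hb true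
    have h2 := hb false
    have h3 : siteVariation (star (Q t) * O * Q t) y =
        commNorm (star (Q t) * O * Q t) (pauli true y) +
          commNorm (star (Q t) * O * Q t) (pauli false y) := by
      simp [siteVariation, commNorm]
    rw [h3]
    linarith
  calc _ ≤ ∑ y : Λ, 4 * Real.exp 1 * ‖O‖ * X.card * ∑ x ∈ X,
        Real.exp (-(latticeDist (x : Site d) (y : Site d) / (v * (t - s) + 1))) :=
        Finset.sum_le_sum fun y _ => hpt y
    _ = 4 * Real.exp 1 * ‖O‖ * X.card * ∑ x ∈ X, ∑ y : Λ,
        Real.exp (-(latticeDist (x : Site d) (y : Site d) / (v * (t - s) + 1))) := by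
        rw [← Finset.mul_sum, Finset.sum_comm]
    _ ≤ 4 * Real.exp 1 * ‖O‖ * X.card * ∑ x ∈ X, (2 * (v * (t - s) + 1 + 1)) ^ d := by
        gcongr with x _
        exact sum_exp_latticeDist_le Λ x (by linarith)
    _ = _ := by
        rw [Finset.sum_const, nsmul_eq_mul]
        ring

end LiebRobinson

end

end TrotterNoise

namespace TrotterNoise

noncomputable section

/-! ### Dyson series -/

section Dyson

open MeasureTheory Filter Topology

variable {𝔸 : Type*} [NormedRing 𝔸] [NormedAlgebra ℝ 𝔸]

/-- The terms of the Dyson series for `V' = A V` in a Banach algebra. -/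
def dyson (A : ℝ → 𝔸) : ℕ → ℝ → 𝔸
  | 0, _ => 1
  | n + 1, t => ∫ s in (0 : ℝ)..t, A s * dyson A n s

/-- The sum of the Dyson series. -/
def dysonSum (A : ℝ → 𝔸) (t : ℝ) : 𝔸 := ∑' n, dyson A n t

variable {A : ℝ → 𝔸} {C : ℝ}

/-- The size of the `n`-th term of the Dyson series. -/
def dysonBound (e C t : ℝ) (n : ℕ) : ℝ := e * ((C * |t|) ^ n / n.factorial)

/-- Continuity and size go through one induction because both are needed for integrability of the
next integrand. -/
theorem dyson_aux (hA : AEStronglyMeasurable A) (hC : ∀ t, ‖A t‖ ≤ C) (n : ℕ) :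
    Continuous (dyson A n) ∧ ∀ t, ‖dyson A n t‖ ≤ dysonBound ‖(1 : 𝔸)‖ C t n := by
  have hC0 : 0 ≤ C := (norm_nonneg _).trans (hC 0)
  induction n with
  | zero => exact ⟨continuous_const, fun t => by simp [dyson, dysonBound]⟩
  | succ n ih =>
    obtain ⟨hc, hb⟩ := ih
    have hbc : Continuous fun s => C * dysonBound ‖(1 : 𝔸)‖ C s n := by
      unfold dysonBound; fun_prop
    have hn : ∀ s, ‖A s * dyson A n s‖ ≤ C * dysonBound ‖(1 : 𝔸)‖ C s n := fun s =>
      (norm_mul_le _ _).trans (mul_le_mul (hC s) (hb s) (norm_nonneg _) hC0)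
    have hint : ∀ a b, IntervalIntegrable (fun s => A s * dyson A n s) volume a b := fun a b =>
      (hbc.intervalIntegrable a b).mono_fun
        ((hA.mul hc.aestronglyMeasurable).mono_measure Measure.restrict_le_self)
        (Eventually.of_forall fun s => (hn s).trans (le_abs_self _))
    refine ⟨intervalIntegral.continuous_primitive hint 0, fun t => ?_⟩
    calc ‖dyson A (n + 1) t‖ ≤ ∫ s in Set.uIoc 0 t, ‖A s * dyson A n s‖ :=
          intervalIntegral.norm_integral_le_integral_norm_uIoc
      _ ≤ ∫ s in Set.uIoc 0 t, ‖(1 : 𝔸)‖ * C ^ (n + 1) / n.factorial * |s - 0| ^ n := by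
          refine setIntegral_mono (intervalIntegrable_iff.mp (hint 0 t)).norm ?_ fun s => ?_
          · exact intervalIntegrable_iff.mp (Continuous.intervalIntegrable (by fun_prop) _ _)
          · refine (hn s).trans (le_of_eq ?_)
            rw [dysonBound, sub_zero, mul_pow]; ring
      _ = dysonBound ‖(1 : 𝔸)‖ C t (n + 1) := by
          rw [integral_const_mul, integral_pow_abs_sub_uIoc, sub_zero, dysonBound, mul_pow,
            Nat.factorial_succ]
          push_cast
          field_simp

theorem continuous_dyson (hA : AEStronglyMeasurable A) (hC : ∀ t, ‖A t‖ ≤ C) (n : ℕ) :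
    Continuous (dyson A n) := (dyson_aux hA hC n).1

theorem norm_dyson_le (hA : AEStronglyMeasurable A) (hC : ∀ t, ‖A t‖ ≤ C) (n : ℕ) (t : ℝ) :
    ‖dyson A n t‖ ≤ dysonBound ‖(1 : 𝔸)‖ C t n := (dyson_aux hA hC n).2 t

theorem summable_dysonBound (e C t : ℝ) : Summable (dysonBound e C t) :=
  (Real.summable_pow_div_factorial _).mul_left _

theorem dysonBound_le_of_abs_le {e C t R : ℝ} (he : 0 ≤ e) (hC : 0 ≤ C) (h : |t| ≤ R) (n : ℕ) :
    dysonBound e C t n ≤ dysonBound e C R n := by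
  have hR : |t| ≤ |R| := h.trans (le_abs_self R)
  have := pow_le_pow_left₀ (by positivity) (mul_le_mul_of_nonneg_left hR hC) n
  unfold dysonBound
  gcongr

variable [CompleteSpace 𝔸]

theorem summable_dyson (hA : AEStronglyMeasurable A) (hC : ∀ t, ‖A t‖ ≤ C) (t : ℝ) :
    Summable fun n => dyson A n t :=
  Summable.of_norm_bounded (summable_dysonBound _ _ _) fun n => norm_dyson_le hA hC n t

theorem continuous_dysonSum (hA : AEStronglyMeasurable A) (hC : ∀ t, ‖A t‖ ≤ C) :
    Continuous (dysonSum A) := by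
  have hC0 : 0 ≤ C := (norm_nonneg _).trans (hC 0)
  refine continuous_iff_continuousAt.mpr fun t => ?_
  have : ContinuousOn (dysonSum A) (Set.Icc (-(|t| + 1)) (|t| + 1)) :=
    continuousOn_tsum (fun n => (continuous_dyson hA hC n).continuousOn)
      (summable_dysonBound ‖(1 : 𝔸)‖ C (|t| + 1)) fun n s hs =>
        (norm_dyson_le hA hC n s).trans
          (dysonBound_le_of_abs_le (norm_nonneg _) hC0 (abs_le.mpr hs) n)
  refine this.continuousAt (Icc_mem_nhds ?_ ?_)
  · linarith [neg_abs_le t]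
  · linarith [le_abs_self t]

theorem dysonSum_eq (hA : AEStronglyMeasurable A) (hC : ∀ t, ‖A t‖ ≤ C) (t : ℝ) :
    dysonSum A t = 1 + ∫ s in (0 : ℝ)..t, A s * dysonSum A s := by
  have hC0 : 0 ≤ C := (norm_nonneg _).trans (hC 0)
  have h : HasSum (fun n => ∫ s in (0 : ℝ)..t, A s * dyson A n s)
      (∫ s in (0 : ℝ)..t, A s * dysonSum A s) := by
    refine intervalIntegral.hasSum_integral_of_dominated_convergence
      (fun n _ => C * dysonBound ‖(1 : 𝔸)‖ C |t| n) (fun n => ?_) (fun n => ?_) ?_ ?_ ?_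
    · exact (hA.mul (continuous_dyson hA hC n).aestronglyMeasurable).mono_measure
        Measure.restrict_le_self
    · refine Eventually.of_forall fun s hs => (norm_mul_le _ _).trans
        (mul_le_mul (hC s) ((norm_dyson_le hA hC n s).trans
          (dysonBound_le_of_abs_le (norm_nonneg _) hC0 ?_ n)) (norm_nonneg _) hC0)
      have := Set.abs_sub_left_of_mem_uIcc (Set.uIoc_subset_uIcc hs)
      simpa using this
    · exact Eventually.of_forall fun s _ => (summable_dysonBound _ _ _).mul_left C
    · exact continuous_const.intervalIntegrable _ _
    · exact Eventually.of_forall fun s _ => (summable_dyson hA hC s).hasSum.mul_left (A s)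
  rw [dysonSum, (summable_dyson hA hC t).tsum_eq_zero_add, ← h.tsum_eq]
  rfl

theorem dysonSum_zero (hA : AEStronglyMeasurable A) (hC : ∀ t, ‖A t‖ ≤ C) :
    dysonSum A 0 = 1 := by
  rw [dysonSum_eq hA hC, intervalIntegral.integral_same, add_zero]

theorem hasDerivAt_dysonSum (hA : Continuous A) (hC : ∀ t, ‖A t‖ ≤ C) (t : ℝ) :
    HasDerivAt (dysonSum A) (A t * dysonSum A t) t := by
  have hc : Continuous fun s => A s * dysonSum A s :=
    hA.mul (continuous_dysonSum hA.aestronglyMeasurable hC)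
  rw [funext (dysonSum_eq hA.aestronglyMeasurable hC)]
  have := (intervalIntegral.integral_hasDerivAt_right (hc.intervalIntegrable 0 t)
      (hc.stronglyMeasurableAtFilter _ _) hc.continuousAt).const_add 1
  convert! this using 2
  exact (dysonSum_eq hA.aestronglyMeasurable hC t).symm

/-- Almost-everywhere convergence of bounded generators suffices: dominated convergence in each
iterated integral, then in the series. This is how merely measurable Hamiltonians are reached from
continuous ones. -/
theorem tendsto_dysonSum {A' : ℕ → ℝ → 𝔸}
    (hA' : ∀ k, AEStronglyMeasurable (A' k)) (hC : ∀ t, ‖A t‖ ≤ C) (hC' : ∀ k t, ‖A' k t‖ ≤ C)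
    (hlim : ∀ᵐ t, Tendsto (fun k => A' k t) atTop (𝓝 (A t))) (t : ℝ) :
    Tendsto (fun k => dysonSum (A' k) t) atTop (𝓝 (dysonSum A t)) := by
  have hC0 : 0 ≤ C := (norm_nonneg _).trans (hC 0)
  have hterm : ∀ n t, Tendsto (fun k => dyson (A' k) n t) atTop (𝓝 (dyson A n t)) := by
    intro n
    induction n with
    | zero => exact fun t => tendsto_const_nhds
    | succ n ih =>
      intro t
      refine intervalIntegral.tendsto_integral_filter_of_dominated_convergence
        (fun s => C * dysonBound ‖(1 : 𝔸)‖ C s n) (Eventually.of_forall fun k => ?_)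
        (Eventually.of_forall fun k => Eventually.of_forall fun s _ => ?_) ?_ ?_
      · exact ((hA' k).mul (continuous_dyson (hA' k) (hC' k) n).aestronglyMeasurable).mono_measure
          Measure.restrict_le_self
      · exact (norm_mul_le _ _).trans
          (mul_le_mul (hC' k s) (norm_dyson_le (hA' k) (hC' k) n s) (norm_nonneg _) hC0)
      · refine Continuous.intervalIntegrable ?_ _ _
        unfold dysonBound; fun_prop
      · filter_upwards [hlim] with s hs _ using hs.mul (ih s)
  exact tendsto_tsum_of_dominated_convergence (summable_dysonBound ‖(1 : 𝔸)‖ C t)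
    (fun n => hterm n t) (Eventually.of_forall fun k n => norm_dyson_le (hA' k) (hC' k) n t)

end Dyson

/-! ### Time-ordered exponentials and unitary propagators. -/

section Propagator

open Complex (I)

variable {d : ℕ} {Λ : Finset (Site d)}

theorem dysonTerm_eq_dyson (𝓛 : ℝ → Superop Λ) (n : ℕ) : dysonTerm 𝓛 n = dyson 𝓛 n := by
  induction n with
  | zero => rfl
  | succ n ih => funext t; simp only [dysonTerm, dyson, ih]; rfl

theorem timeOrderedExp_eq_dysonSum (𝓛 : ℝ → Superop Λ) (t : ℝ) :
    timeOrderedExp 𝓛 t = dysonSum 𝓛 t := by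
  simp only [timeOrderedExp, dysonSum, dysonTerm_eq_dyson]

/-- The Dyson series of `-iH`; self-adjointness of `H` makes `Q* Q` constant. -/
theorem exists_isPropagator {H : ℝ → Op Λ} (hH : ∀ t, star (H t) = H t) (hc : Continuous H)
    {C : ℝ} (hC : ∀ t, ‖H t‖ ≤ C) : ∃ Q, IsPropagator H Q := by
  have hcA : Continuous fun t => -(I • H t) := by fun_prop
  have hCA : ∀ t, ‖-(I • H t)‖ ≤ C := fun t => by
    rw [norm_neg, norm_smul, Complex.norm_I, one_mul]; exact hC t
  set Q := dysonSum fun t => -(I • H t) with hQ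
  have hd : ∀ t, HasDerivAt Q (-(I • (H t * Q t))) t := fun t => by
    convert! hasDerivAt_dysonSum hcA hCA t using 1
    rw [neg_mul, smul_mul_assoc]
  refine ⟨Q, hd, fun t => ?_⟩
  have hconst : ∀ t, HasDerivAt (fun t => star (Q t) * Q t) 0 t := fun t => by
    convert! ((hd t).star).mul (hd t) using 1
    simp only [star_neg, star_smul, star_mul, hH, RCLike.star_def, Complex.conj_I, mul_neg,
      neg_smul, neg_neg, smul_mul_assoc, mul_smul_comm, mul_assoc]
    abel
  have := is_const_of_deriv_eq_zero (fun t => (hconst t).differentiableAt)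
    (fun t => (hconst t).deriv) t 0
  rw [this, hQ, dysonSum_zero hcA.aestronglyMeasurable hCA, star_one, one_mul]

/-- The propagator between two times. -/
theorem IsPropagator.mul_star {H Q : ℝ → Op Λ} (hQ : IsPropagator H Q) (s : ℝ) :
    IsPropagator H fun t => Q t * star (Q s) where
  hasDerivAt t := by
    convert! (hQ.hasDerivAt t).mul_const (star (Q s)) using 1
    rw [neg_mul, smul_mul_assoc, mul_assoc]
  star_mul_self t := by
    rw [star_mul, star_star, mul_assoc, ← mul_assoc _ (Q t), hQ.star_mul_self, one_mul,
      hQ.mul_star_self]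

end Propagator

end

end TrotterNoise

namespace TrotterNoise

noncomputable section

/-! ### Duality between the operator norm and the trace norm -/

section TraceNorm

variable {n : Type*} [Fintype n] [DecidableEq n]

theorem norm_entry_le_l2_opNorm (A : Matrix n n ℂ) (i j : n) : ‖A i j‖ ≤ ‖A‖ := by
  have h := A.l2_opNorm_mulVec (EuclideanSpace.single j 1)
  have hs : ‖EuclideanSpace.single j (1 : ℂ)‖ = 1 := by simp
  rw [hs, mul_one] at h
  refine le_trans ?_ h
  have := PiLp.norm_apply_le
    ((EuclideanSpace.equiv n ℂ).symm (Matrix.mulVec A (EuclideanSpace.single j (1 : ℂ)))) i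
  simpa using this

/-- Relabelling is a star homomorphism, and these are contractive between C*-algebras; the same
argument handles repeated diagonal blocks below. -/
theorem norm_submatrix_equiv_le {m : Type*} [Fintype m] [DecidableEq m] (e : m ≃ n)
    (A : Matrix n n ℂ) : ‖A.submatrix e e‖ ≤ ‖A‖ := by
  let φ : Matrix n n ℂ →⋆ₙₐ[ℂ] Matrix m m ℂ :=
    { toFun := fun A => A.submatrix e e
      map_smul' := fun _ _ => rfl
      map_zero' := rfl
      map_add' := fun _ _ => rfl
      map_mul' := fun A B => (Matrix.submatrix_mul_equiv A B e e e).symm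
      map_star' := fun _ => rfl }
  exact NonUnitalStarAlgHom.norm_apply_le φ A

theorem norm_fromBlocks_diag_le (A : Matrix n n ℂ) :
    ‖Matrix.fromBlocks A 0 0 A‖ ≤ ‖A‖ := by
  let φ : Matrix n n ℂ →⋆ₙₐ[ℂ] Matrix (n ⊕ n) (n ⊕ n) ℂ :=
    { toFun := fun A => Matrix.fromBlocks A 0 0 A
      map_smul' := fun c A => by simp [Matrix.fromBlocks_smul]
      map_zero' := by simp
      map_add' := fun A B => by simp [Matrix.fromBlocks_add]
      map_mul' := fun A B => by simp [Matrix.fromBlocks_multiply]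
      map_star' := fun A => by
        simp [Matrix.star_eq_conjTranspose, Matrix.fromBlocks_conjTranspose] }
  exact NonUnitalStarAlgHom.norm_apply_le φ A

/-- A completely positive map with two Kraus operators attains its norm at the identity. -/
theorem norm_kraus_le (K R B : Matrix n n ℂ) :
    ‖star K * B * K + star R * B * R‖ ≤ ‖star K * K + star R * R‖ * ‖B‖ := by
  -- Stinespring form: stacking `K` over `R` turns the map into `V* (B ⊕ B) V`, and `‖V* V‖ = ‖V‖²`.
  set V : Matrix (n ⊕ n) n ℂ := Matrix.fromRows K R with hV
  have hVs : V.conjTranspose = Matrix.fromCols K.conjTranspose R.conjTranspose := by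
    rw [hV, Matrix.conjTranspose_fromRows_eq_fromCols_conjTranspose]
  have e1 : star K * K + star R * R = V.conjTranspose * V := by
    rw [hVs, hV, Matrix.fromCols_mul_fromRows]; rfl
  have e2 : star K * B * K + star R * B * R =
      V.conjTranspose * (Matrix.fromBlocks B 0 0 B * V) := by
    rw [hVs, hV, Matrix.fromBlocks_mul_fromRows, Matrix.fromCols_mul_fromRows]
    simp [Matrix.star_eq_conjTranspose, mul_assoc]
  rw [e1, e2, Matrix.l2_opNorm_conjTranspose_mul_self]
  calc _ ≤ ‖V.conjTranspose‖ * ‖Matrix.fromBlocks B 0 0 B * V‖ := Matrix.l2_opNorm_mul _ _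
    _ ≤ ‖V.conjTranspose‖ * (‖Matrix.fromBlocks B 0 0 B‖ * ‖V‖) := by
        gcongr; exact Matrix.l2_opNorm_mul _ _
    _ ≤ ‖V‖ * (‖B‖ * ‖V‖) := by
        rw [Matrix.l2_opNorm_conjTranspose]
        gcongr
        exact norm_fromBlocks_diag_le B
    _ = _ := by ring

theorem exists_unitary_diagonal {A : Matrix n n ℂ} (hA : A.IsHermitian) :
    ∃ V : Matrix n n ℂ, star V * V = 1 ∧ V * star V = 1 ∧
      star V * A * V = Matrix.diagonal fun i => (hA.eigenvalues i : ℂ) := by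
  refine ⟨hA.eigenvectorUnitary, Unitary.coe_star_mul_self _, Unitary.coe_mul_star_self _, ?_⟩
  have := hA.conjStarAlgAut_star_eigenvectorUnitary
  rw [Unitary.conjStarAlgAut_apply] at this
  simp only [Unitary.coe_star, star_star] at this
  exact this.trans (congrArg Matrix.diagonal (funext fun i => rfl))

theorem norm_le_one_of_star_mul_self {V : Matrix n n ℂ} (h : star V * V = 1) : ‖V‖ ≤ 1 := by
  have h1 : ‖V‖ * ‖V‖ ≤ 1 := by
    rw [← CStarRing.norm_star_mul_self, h]
    rw [← Matrix.diagonal_one, Matrix.l2_opNorm_diagonal]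
    exact (pi_norm_le_iff_of_nonneg zero_le_one).mpr fun _ => by simp
  nlinarith [norm_nonneg V]

/-- Hölder's inequality: in an eigenbasis of `M* M` the trace is a sum of diagonal entries, and the
`i`-th is at most `‖A‖` times the length of the `i`-th column of `M V`, a singular value. The
projection `E` isolates that column. -/
theorem norm_trace_mul_le_traceNorm (A M : Matrix n n ℂ) :
    ‖(A * M).trace‖ ≤ ‖A‖ * traceNorm M := by
  have hM := Matrix.isHermitian_conjTranspose_mul_self M
  obtain ⟨V, h1, h2, h3⟩ := exists_unitary_diagonal hM
  have hV := norm_le_one_of_star_mul_self h1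
  have hV' : ‖star V‖ ≤ 1 := by rwa [norm_star]
  have hpos : ∀ i, 0 ≤ hM.eigenvalues i := Matrix.eigenvalues_conjTranspose_mul_self_nonneg M
  have e : (A * M).trace = ∑ i, (star V * A * (M * V)) i i := by
    have : (star V * A * (M * V)).trace = (A * M).trace := by
      rw [mul_assoc, Matrix.trace_mul_comm, mul_assoc, mul_assoc, h2, mul_one]
    rw [← this]; rfl
  rw [e, traceNorm, Finset.mul_sum]
  refine (norm_sum_le _ _).trans (Finset.sum_le_sum fun i _ => ?_)
  set E : Matrix n n ℂ := Matrix.diagonal (Pi.single i 1) with hE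
  have hEs : star E = E := by
    rw [hE, Matrix.star_eq_conjTranspose, Matrix.diagonal_conjTranspose]
    congr 1
    funext j
    by_cases h : j = i
    · subst h; simp
    · simp [h]
  have hcol : ‖M * V * E‖ ≤ Real.sqrt (hM.eigenvalues i) := by
    refine Real.le_sqrt_of_sq_le ?_
    rw [sq, ← CStarRing.norm_star_mul_self]
    have : star (M * V * E) * (M * V * E) =
        Matrix.diagonal (Pi.single i (hM.eigenvalues i : ℂ)) := by
      rw [star_mul, star_mul, hEs, show E * (star V * star M) * (M * V * E) =
        E * (star V * (M.conjTranspose * M) * V) * E by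
          simp only [mul_assoc, Matrix.star_eq_conjTranspose], h3, hE, Matrix.diagonal_mul_diagonal,
        Matrix.diagonal_mul_diagonal]
      congr 1
      funext j
      by_cases h : j = i
      · subst h; simp
      · simp [h]
    rw [this, Matrix.l2_opNorm_diagonal, Pi.norm_single, Complex.norm_real,
      Real.norm_of_nonneg (hpos i)]
  have e2 : (star V * A * (M * V)) i i = (star V * A * (M * V * E)) i i := by
    have : star V * A * (M * V * E) = star V * A * (M * V) * E := (mul_assoc _ _ _).symm
    rw [this, hE, Matrix.mul_diagonal, Pi.single_eq_same, mul_one]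
  rw [e2]
  calc _ ≤ ‖star V * A * (M * V * E)‖ := norm_entry_le_l2_opNorm _ _ _
    _ ≤ ‖star V * A‖ * ‖M * V * E‖ := norm_mul_le _ _
    _ ≤ (‖star V‖ * ‖A‖) * Real.sqrt (hM.eigenvalues i) := by
        gcongr; exact norm_mul_le _ _
    _ ≤ (1 * ‖A‖) * Real.sqrt (hM.eigenvalues i) := by gcongr
    _ = _ := by rw [one_mul]

/-- `W` is the adjoint of the polar phase of `M`, namely `(M* M)^{-1/2} M*`; on the kernel the
convention that the inverse of zero is zero gives the partial isometry. -/
theorem exists_trace_mul_eq_traceNorm (M : Matrix n n ℂ) :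
    ∃ W : Matrix n n ℂ, ‖W‖ ≤ 1 ∧ (W * M).trace = (traceNorm M : ℂ) := by
  have hM := Matrix.isHermitian_conjTranspose_mul_self M
  obtain ⟨V, h1, h2, h3⟩ := exists_unitary_diagonal hM
  have hpos : ∀ i, 0 ≤ hM.eigenvalues i := Matrix.eigenvalues_conjTranspose_mul_self_nonneg M
  set F : Matrix n n ℂ := Matrix.diagonal fun i => ((Real.sqrt (hM.eigenvalues i))⁻¹ : ℂ) with hF
  have hFs : star F = F := by
    rw [hF, Matrix.star_eq_conjTranspose, Matrix.diagonal_conjTranspose]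
    congr 1
    funext j
    simp [← Complex.ofReal_inv]
  refine ⟨V * F * star V * star M, ?_, ?_⟩
  · have hsq : ‖V * F * star V * star M‖ * ‖V * F * star V * star M‖ ≤ 1 := by
      rw [← CStarRing.norm_self_mul_star]
      have : V * F * star V * star M * star (V * F * star V * star M) =
          V * (F * (star V * (M.conjTranspose * M) * V) * F) * star V := by
        simp only [star_mul, hFs, mul_assoc, Matrix.star_eq_conjTranspose,
          Matrix.conjTranspose_conjTranspose]
      rw [this, h3, hF, Matrix.diagonal_mul_diagonal, Matrix.diagonal_mul_diagonal]
      have hV := norm_le_one_of_star_mul_self h1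
      have hV' : ‖star V‖ ≤ 1 := by rwa [norm_star]
      refine (norm_mul_le _ _).trans (mul_le_one₀ ((norm_mul_le _ _).trans
        (mul_le_one₀ hV (norm_nonneg _) ?_)) (norm_nonneg _) hV')
      rw [Matrix.l2_opNorm_diagonal]
      refine (pi_norm_le_iff_of_nonneg zero_le_one).mpr fun i => ?_
      rcases (hpos i).eq_or_lt with h | h
      · simp [← h]
      · have hs : (Real.sqrt (hM.eigenvalues i) : ℂ) ≠ 0 := by
          exact_mod_cast (Real.sqrt_pos.mpr h).ne'
        have : (hM.eigenvalues i : ℂ) =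
            Real.sqrt (hM.eigenvalues i) * Real.sqrt (hM.eigenvalues i) := by
          exact_mod_cast (Real.mul_self_sqrt h.le).symm
        rw [this, inv_mul_cancel_left₀ hs, mul_inv_cancel₀ hs, norm_one]
    nlinarith [norm_nonneg (V * F * star V * star M)]
  · have : V * F * star V * star M * M =
        V * (F * (star V * (M.conjTranspose * M) * V)) * star V := by
      have : V * (F * (star V * (M.conjTranspose * M) * V)) * star V =
          V * F * star V * (M.conjTranspose * M) * (V * star V) := by simp only [mul_assoc]
      rw [this, h2, mul_one]
      simp only [mul_assoc, Matrix.star_eq_conjTranspose]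
    rw [this, Matrix.trace_mul_comm, ← mul_assoc, h1, one_mul, h3, hF,
      Matrix.diagonal_mul_diagonal, Matrix.trace_diagonal, traceNorm, Complex.ofReal_sum]
    refine Finset.sum_congr rfl fun i _ => ?_
    rcases (hpos i).eq_or_lt with h | h
    · simp [← h]
    · have hs : (Real.sqrt (hM.eigenvalues i) : ℂ) ≠ 0 := by
        exact_mod_cast (Real.sqrt_pos.mpr h).ne'
      have : (hM.eigenvalues i : ℂ) =
          Real.sqrt (hM.eigenvalues i) * Real.sqrt (hM.eigenvalues i) := by
        exact_mod_cast (Real.mul_self_sqrt h.le).symm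
      rw [this, inv_mul_cancel_left₀ hs]

theorem IsDensityMatrix.norm_trace_mul_le {ρ : Matrix n n ℂ} (hρ : IsDensityMatrix ρ)
    (B : Matrix n n ℂ) : ‖(B * ρ).trace‖ ≤ ‖B‖ := by
  have hH := hρ.posSemidef.isHermitian
  obtain ⟨V, h1, h2, h3⟩ := exists_unitary_diagonal hH
  have hV := norm_le_one_of_star_mul_self h1
  have hV' : ‖star V‖ ≤ 1 := by rwa [norm_star]
  have hpos : ∀ i, 0 ≤ hH.eigenvalues i := hρ.posSemidef.eigenvalues_nonneg
  have hsum : ∑ i, hH.eigenvalues i = 1 := by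
    have := hH.trace_eq_sum_eigenvalues
    rw [hρ.trace_eq_one] at this
    have h' : ((∑ i, hH.eigenvalues i : ℝ) : ℂ) = 1 := by
      rw [Complex.ofReal_sum]; exact this.symm
    exact_mod_cast h'
  have e : (B * ρ).trace = (star V * B * V * (star V * ρ * V)).trace := by
    have : star V * B * V * (star V * ρ * V) = star V * (B * ((V * star V) * ρ * V)) := by
      simp only [mul_assoc]
    rw [this, h2, one_mul, Matrix.trace_mul_comm (star V), mul_assoc, mul_assoc, h2, mul_one]
  rw [e, h3]
  calc _ ≤ ∑ i, ‖(star V * B * V * Matrix.diagonal fun i => (hH.eigenvalues i : ℂ)) i i‖ :=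
        norm_sum_le _ _
    _ ≤ ∑ i, ‖B‖ * hH.eigenvalues i := by
        refine Finset.sum_le_sum fun i _ => ?_
        rw [Matrix.mul_diagonal, norm_mul, Complex.norm_real, Real.norm_of_nonneg (hpos i)]
        refine mul_le_mul_of_nonneg_right ((norm_entry_le_l2_opNorm _ _ _).trans ?_) (hpos i)
        calc _ ≤ ‖star V * B‖ * ‖V‖ := norm_mul_le _ _
          _ ≤ (‖star V‖ * ‖B‖) * ‖V‖ := by gcongr; exact norm_mul_le _ _
          _ ≤ (1 * ‖B‖) * 1 := by gcongr
          _ = _ := by ring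
    _ = ‖B‖ := by rw [← Finset.mul_sum, hsum, mul_one]

end TraceNorm

/-! ### Trace-norm contractivity of Lindbladians, with the trace norm realized as the dual norm
`‖traceDual σ‖`. -/

section Dissipative

variable {d : ℕ} {Λ : Finset (Site d)}

/-- The functional `B ↦ Tr[B σ]`. -/
def traceDual : Op Λ →L[ℂ] Op Λ →L[ℂ] ℂ :=
  (ContinuousLinearMap.compL ℂ (Op Λ) (Op Λ) ℂ
    (LinearMap.toContinuousLinearMap (Matrix.traceLinearMap (Config Λ) ℂ ℂ))).comp
    (ContinuousLinearMap.mul ℂ (Op Λ)).flip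

theorem norm_trace_mul_le (σ B : Op Λ) : ‖(B * σ).trace‖ ≤ ‖traceDual σ‖ * ‖B‖ :=
  (traceDual σ).le_opNorm B

theorem IsDensityMatrix.norm_traceDual_le {ρ : Op Λ} (hρ : IsDensityMatrix ρ) :
    ‖traceDual ρ‖ ≤ 1 :=
  ContinuousLinearMap.opNorm_le_bound _ zero_le_one fun B => by
    rw [one_mul]; exact hρ.norm_trace_mul_le B

/-- Only a one-dimensional ancilla is used in the diamond norm. The polar phase converts the
dual-norm hypothesis into the trace-norm constraint of the supremum. -/
theorem norm_trace_mul_apply_le {𝓝 : Superop Λ} (h𝓝 : diamondNorm 𝓝 ≤ 1) {σ : Op Λ}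
    (hσ : ‖traceDual σ‖ ≤ 1) (B : Op Λ) : ‖(B * 𝓝 σ).trace‖ ≤ ‖B‖ := by
  let e : Config Λ × Fin 1 ≃ Config Λ := Equiv.prodUnique _ _
  have htr : ∀ (A M : Op Λ), (A.submatrix e e * M.submatrix e e).trace = (A * M).trace := by
    intro A M
    rw [Matrix.submatrix_mul_equiv, Matrix.trace, Matrix.trace]
    exact Equiv.sum_comp e fun i => (A * M) i i
  have hσ1 : traceNorm (σ.submatrix e e) ≤ 1 := by
    obtain ⟨W, hW, h⟩ := exists_trace_mul_eq_traceNorm (σ.submatrix e e)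
    have hW2 : W = (W.submatrix e.symm e.symm).submatrix e e := by simp
    rw [hW2, htr] at h
    have h1 := norm_trace_mul_le σ (W.submatrix e.symm e.symm)
    rw [h, Complex.norm_real] at h1
    have h2 := norm_submatrix_equiv_le e.symm W
    have h3 : ‖traceDual σ‖ * ‖W.submatrix e.symm e.symm‖ ≤ 1 :=
      mul_le_one₀ hσ (norm_nonneg _) (h2.trans hW)
    exact (le_abs_self _).trans (h1.trans h3)
  have hamp : ampliation 𝓝 1 (σ.submatrix e e) = (𝓝 σ).submatrix e e := rfl
  have h1 : ENNReal.ofReal (traceNorm ((𝓝 σ).submatrix e e)) ≤ 1 := by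
    rw [← hamp]
    refine le_trans ?_ h𝓝
    unfold diamondNorm
    exact le_iSup_of_le 1 (le_iSup_of_le (σ.submatrix e e) (le_iSup_of_le hσ1 le_rfl))
  rw [ENNReal.ofReal_le_one] at h1
  rw [← htr]
  refine (norm_trace_mul_le_traceNorm _ _).trans ?_
  refine (mul_le_of_le_one_right (norm_nonneg _) h1).trans (norm_submatrix_equiv_le e B)

/-- `D` does not increase the trace norm to first order. -/
def IsDissipative (D : Op Λ → Op Λ) : Prop :=
  ∃ C : ℝ, ∀ ε : ℝ, 0 < ε → ∀ σ : Op Λ,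
    ‖traceDual σ + (ε : ℂ) • traceDual (D σ)‖ ≤ (1 + C * ε ^ 2) * ‖traceDual σ‖

theorem IsDissipative.zero : IsDissipative (fun _ : Op Λ => (0 : Op Λ)) := by
  refine ⟨0, fun ε _ σ => le_of_eq ?_⟩
  have e : traceDual σ + (ε : ℂ) • traceDual 0 = traceDual σ := by
    refine ContinuousLinearMap.ext fun B => ?_
    change (B * σ).trace + (ε : ℂ) • (B * 0).trace = (B * σ).trace
    simp
  rw [e, zero_mul, add_zero, one_mul]

/-- A step of length `ε` along `D + D'` is the mean of steps of length `2ε` along `D` and along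
`D'`, which also explains the constant. -/
theorem IsDissipative.add {D D' : Op Λ → Op Λ} (h : IsDissipative D) (h' : IsDissipative D') :
    IsDissipative fun σ => D σ + D' σ := by
  obtain ⟨C, hC⟩ := h
  obtain ⟨C', hC'⟩ := h'
  refine ⟨2 * (C + C'), fun ε hε σ => ?_⟩
  have e : traceDual σ + (ε : ℂ) • traceDual (D σ + D' σ) =
      (1 / 2 : ℂ) • ((traceDual σ + ((2 * ε : ℝ) : ℂ) • traceDual (D σ)) +
        (traceDual σ + ((2 * ε : ℝ) : ℂ) • traceDual (D' σ))) := by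
    rw [map_add]; push_cast; module
  rw [e, norm_smul]
  have h1 := hC (2 * ε) (by positivity) σ
  have h2 := hC' (2 * ε) (by positivity) σ
  have h3 := norm_add_le (traceDual σ + ((2 * ε : ℝ) : ℂ) • traceDual (D σ))
    (traceDual σ + ((2 * ε : ℝ) : ℂ) • traceDual (D' σ))
  rw [show ‖(1 / 2 : ℂ)‖ = 1 / 2 by norm_num]
  nlinarith

theorem IsDissipative.sum {ι : Type*} (s : Finset ι) {D : ι → Op Λ → Op Λ}
    (h : ∀ i, IsDissipative (D i)) : IsDissipative fun σ => ∑ i ∈ s, D i σ := by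
  classical
  induction s using Finset.induction_on with
  | empty => simpa using IsDissipative.zero
  | insert i s hi ih =>
    simp only [Finset.sum_insert hi]
    exact (h i).add ih

theorem IsDissipative.smul {D : Op Λ → Op Λ} (h : IsDissipative D) {γ : ℝ} (hγ : 0 ≤ γ) :
    IsDissipative fun σ => (γ : ℂ) • D σ := by
  rcases hγ.eq_or_lt with rfl | hγ
  · simpa using IsDissipative.zero
  obtain ⟨C, hC⟩ := h
  refine ⟨C * γ ^ 2, fun ε hε σ => ?_⟩
  have := hC (ε * γ) (by positivity) σ
  rw [map_smul, smul_smul, ← Complex.ofReal_mul]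
  refine this.trans (le_of_eq ?_)
  ring

/-- Trace-norm estimates on states follow by duality from operator-norm estimates for the Heisenberg
adjoint `D'`. -/
theorem IsDissipative.of_dual {D : Op Λ → Op Λ} (D' : Op Λ → Op Λ)
    (h : ∀ B σ, (B * D σ).trace = (D' B * σ).trace) {C : ℝ}
    (hC : ∀ ε : ℝ, 0 < ε → ∀ B, ‖B + ε • D' B‖ ≤ (1 + C * ε ^ 2) * ‖B‖) (hC0 : 0 ≤ C) :
    IsDissipative D := by
  refine ⟨C, fun ε hε σ => ContinuousLinearMap.opNorm_le_bound _ (by positivity) fun B => ?_⟩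
  have e : (traceDual σ + (ε : ℂ) • traceDual (D σ)) B = traceDual σ (B + ε • D' B) := by
    change (B * σ).trace + (ε : ℂ) • (B * D σ).trace = ((B + ε • D' B) * σ).trace
    rw [← Complex.coe_smul ε (D' B), h, add_mul, smul_mul_assoc, Matrix.trace_add,
      Matrix.trace_smul]
  rw [e]
  refine ((traceDual σ).le_opNorm _).trans ?_
  calc _ ≤ ‖traceDual σ‖ * ((1 + C * ε ^ 2) * ‖B‖) := by gcongr; exact hC ε hε B
    _ = _ := by ring

theorem trace_mul_cycle_left (A B C : Op Λ) : (A * (B * C)).trace = (C * A * B).trace := by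
  rw [← mul_assoc, Matrix.trace_mul_comm, mul_assoc]

theorem isDissipative_hamiltonian {G : Op Λ} (hG : star G = G) :
    IsDissipative fun σ => (-Complex.I) • (G * σ - σ * G) := by
  refine IsDissipative.of_dual (fun B => Complex.I • (G * B - B * G)) (fun B σ => ?_)
    (fun ε _ B => norm_add_smul_commutator_le hG ε) (by positivity)
  have : (B * (σ * G)).trace = (G * B * σ).trace := by
    rw [← mul_assoc, Matrix.trace_mul_comm, mul_assoc]
  simp only [mul_smul_comm, smul_mul_assoc, mul_sub, sub_mul, Matrix.trace_smul, Matrix.trace_sub,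
    this, mul_assoc]
  rw [← mul_assoc, ← mul_assoc, neg_smul, ← smul_neg, neg_sub]

/-- To first order the Heisenberg step is the completely positive map with Kraus operators `K = 1 -
(ε/2) L* L` and `R = √ε L`. These satisfy `K* K + R* R = 1 + (ε²/4) (L* L)²`, so both the failure of
unitality and the correction term are quadratic in `ε`. -/
theorem isDissipative_jump (L : Op Λ) :
    IsDissipative fun σ => L * σ * star L -
      (1 / 2 : ℂ) • (star L * L * σ + σ * (star L * L)) := by
  set P : Op Λ := star L * L with hP
  have hPs : star P = P := by rw [hP, star_mul, star_star]
  refine IsDissipative.of_dual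
    (fun B => star L * B * L - (1 / 2 : ℂ) • (P * B + B * P)) (fun B σ => ?_)
    (C := ‖P‖ ^ 2 / 2) (fun ε hε B => ?_) (by positivity)
  · have e1 : (B * (L * σ * star L)).trace = (star L * B * L * σ).trace :=
      (trace_mul_cycle_left B (L * σ) (star L)).trans (by simp only [mul_assoc])
    have e2 : (B * (σ * P)).trace = (P * B * σ).trace := trace_mul_cycle_left B σ P
    simp only [mul_sub, sub_mul, mul_smul_comm, smul_mul_assoc, mul_add, add_mul,
      Matrix.trace_sub, Matrix.trace_smul, Matrix.trace_add, e1, e2]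
    rw [← mul_assoc B P σ]
    ring
  · set K : Op Λ := 1 - ((ε / 2 : ℝ) : ℂ) • P with hK
    set R : Op Λ := ((Real.sqrt ε : ℝ) : ℂ) • L with hR
    have hKs : star K = K := by
      rw [hK, star_sub, star_one, star_smul, hPs, RCLike.star_def, Complex.conj_ofReal]
    have hs : (Real.sqrt ε : ℂ) * Real.sqrt ε = ε := by
      exact_mod_cast Real.mul_self_sqrt hε.le
    have hRR : ∀ B : Op Λ, star R * B * R = (ε : ℂ) • (star L * B * L) := fun B => by
      rw [hR, star_smul, RCLike.star_def, Complex.conj_ofReal]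
      simp only [smul_mul_assoc, mul_smul_comm, smul_smul, hs]
    have hKK : ∀ B : Op Λ, star K * B * K = B - ((ε / 2 : ℝ) : ℂ) • (P * B + B * P) +
        ((ε / 2 : ℝ) : ℂ) ^ 2 • (P * B * P) := fun B => by
      rw [hKs, hK]
      simp only [sub_mul, mul_sub, one_mul, mul_one, smul_mul_assoc, mul_smul_comm, smul_add,
        smul_sub, smul_smul, sq]
      abel
    have e : B + ε • (star L * B * L - (1 / 2 : ℂ) • (P * B + B * P)) =
        (star K * B * K + star R * B * R) - ((ε / 2 : ℝ) : ℂ) ^ 2 • (P * B * P) := by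
      rw [hKK, hRR, ← Complex.coe_smul ε]
      push_cast
      module
    have e1 : star K * K + star R * R = 1 + ((ε / 2 : ℝ) : ℂ) ^ 2 • (P * P) := by
      have h1 := hKK 1
      have h2 := hRR 1
      simp only [mul_one, one_mul] at h1 h2
      rw [h1, h2, ← hP]
      push_cast
      module
    have hn : ‖((ε / 2 : ℝ) : ℂ) ^ 2‖ = ε ^ 2 / 4 := by
      rw [norm_pow, Complex.norm_real, Real.norm_eq_abs, sq_abs]; ring
    have h1 : ‖star K * B * K + star R * B * R‖ ≤ (1 + ε ^ 2 / 4 * ‖P‖ ^ 2) * ‖B‖ := by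
      refine (norm_kraus_le K R B).trans ?_
      gcongr
      rw [e1]
      refine (norm_add_le _ _).trans ?_
      rw [CStarRing.norm_one, norm_smul, hn, sq ‖P‖]
      gcongr
      exact norm_mul_le _ _
    have h2 : ‖((ε / 2 : ℝ) : ℂ) ^ 2 • (P * B * P)‖ ≤ ε ^ 2 / 4 * ‖P‖ ^ 2 * ‖B‖ := by
      rw [norm_smul, hn]
      calc ε ^ 2 / 4 * ‖P * B * P‖ ≤ ε ^ 2 / 4 * (‖P‖ * ‖B‖ * ‖P‖) := by
            gcongr
            refine (norm_mul_le _ _).trans ?_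
            gcongr
            exact norm_mul_le _ _
        _ = _ := by ring
    rw [e]
    refine (norm_sub_le _ _).trans ((add_le_add h1 h2).trans (le_of_eq ?_))
    ring

theorem IsLindbladianOn.isDissipative {𝓝 : Superop Λ} {S : Finset Λ} (h : IsLindbladianOn 𝓝 S) :
    IsDissipative 𝓝 := by
  obtain ⟨n, G, L, hG, -, -, h⟩ := h
  have := (isDissipative_hamiltonian (Matrix.IsHermitian.eq hG)).add
    (IsDissipative.sum Finset.univ fun k => isDissipative_jump (L k))
  convert! this using 1
  funext σ
  exact h σ

theorem IsLocalTo.star {A : Op Λ} {S : Finset Λ} (h : IsLocalTo A S) : IsLocalTo (star A) S :=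
  fun x hx b => by
    have := congrArg Star.star (h x hx b).eq
    rw [star_mul, star_mul, star_pauli] at this
    exact this.symm

/-- Observables away from the support of a Lindbladian are conserved. -/
theorem IsLindbladianOn.trace_mul_apply_eq_zero {𝓝 : Superop Λ} {S : Finset Λ}
    (h : IsLindbladianOn 𝓝 S) {A : Op Λ} (hA : IsLocalTo A Sᶜ) (σ : Op Λ) :
    (A * 𝓝 σ).trace = 0 := by
  obtain ⟨n, G, L, -, hG, hL, h⟩ := h
  have hGA : Commute G A := hG.isLocalTo.commute hA disjoint_compl_right
  rw [h, mul_add, Matrix.trace_add, Finset.mul_sum, Matrix.trace_sum, Finset.sum_eq_zero, add_zero,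
    mul_smul_comm, Matrix.trace_smul, mul_sub, Matrix.trace_sub, trace_mul_cycle_left A σ G,
    hGA.eq, mul_assoc, sub_self, smul_zero]
  intro k _
  have h1 : Commute (L k) A := (hL k).isLocalTo.commute hA disjoint_compl_right
  have h2 : Commute (L k).conjTranspose A :=
    (hL k).isLocalTo.star.commute hA disjoint_compl_right
  have h3 : Commute ((L k).conjTranspose * L k) A := h2.mul_left h1
  have e1 : (A * (L k * σ * (L k).conjTranspose)).trace =
      ((L k).conjTranspose * L k * A * σ).trace := by
    rw [trace_mul_cycle_left, mul_assoc, ← mul_assoc A, ← h1.eq]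
    simp only [mul_assoc]
  have e2 : (A * ((L k).conjTranspose * L k * σ)).trace =
      ((L k).conjTranspose * L k * A * σ).trace := by
    rw [← mul_assoc, ← h3.eq]
  rw [mul_sub, Matrix.trace_sub, mul_smul_comm, Matrix.trace_smul, mul_add, Matrix.trace_add,
    trace_mul_cycle_left A σ, e1, e2, smul_eq_mul]
  ring

end Dissipative

end

end TrotterNoise

namespace TrotterNoise

noncomputable section

/-! ### The effect of the noise -/

section Noise

open Complex (I)

variable {d m : ℕ} {Λ : Finset (Site d)}

theorem hamiltonianGenerator_apply (H σ : Op Λ) :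
    hamiltonianGenerator H σ = (-I) • (H * σ - σ * H) := rfl

theorem norm_hamiltonianGenerator_le (H : Op Λ) : ‖hamiltonianGenerator H‖ ≤ 2 * ‖H‖ :=
  ContinuousLinearMap.opNorm_le_bound _ (by positivity) fun σ => by
    rw [hamiltonianGenerator_apply, norm_smul, norm_neg, Complex.norm_I, one_mul]
    exact commNorm_le H σ

theorem continuous_hamiltonianGenerator :
    Continuous (hamiltonianGenerator : Op Λ → Superop Λ) := by
  unfold hamiltonianGenerator
  fun_prop

theorem GeomLocalRegions.sum_region_sum_le {S : Fin m → Finset Λ} {a Z : ℕ}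
    (h : GeomLocalRegions S a Z) {f : Λ → ℝ} (hf : ∀ x, 0 ≤ f x) :
    ∑ α, ∑ x ∈ S α, f x ≤ Z * ∑ x, f x := by
  rw [Finset.sum_comm' (t' := Finset.univ) (s' := fun x => Finset.univ.filter fun α => x ∈ S α)
    (by simp), Finset.mul_sum]
  refine Finset.sum_le_sum fun x _ => ?_
  rw [Finset.sum_const, nsmul_eq_mul]
  refine mul_le_mul_of_nonneg_right ?_ (hf x)
  exact_mod_cast h.card_containing_le x

theorem norm_traceDual_le_of_isDissipative {σ : ℝ → Op Λ} {D : ℝ → Op Λ → Op Λ}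
    (hσ : ∀ t, HasDerivAt σ (D t (σ t)) t) (hD : ∀ t, IsDissipative (D t)) {t : ℝ}
    (ht : 0 ≤ t) : ‖traceDual (σ t)‖ ≤ ‖traceDual (σ 0)‖ := by
  have hsmul : ∀ (c : ℝ) (x : Op Λ), traceDual (c • x) = (c : ℂ) • traceDual x := fun c x => by
    rw [← Complex.coe_smul c x, map_smul]
  have h := le_add_integral_of_dissipative (p := fun σ : Op Λ => ‖traceDual σ‖)
    (continuous_norm.comp traceDual.continuous)
    (fun x y => by simp only [map_add]; exact norm_add_le _ _)
    (fun c hc x => by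
      simp only [hsmul]
      rw [norm_smul, Complex.norm_real, Real.norm_of_nonneg hc.le]) (by simp)
    (f := σ) (D := fun t => D t (σ t)) (g := fun _ => 0) (b := fun _ => 0)
    (fun t => by rw [add_zero]; exact hσ t) (fun t => ?_) (fun t => by simp) continuous_const ht
  · simpa using h
  · obtain ⟨C, hC⟩ := hD t
    refine ⟨C, fun ε hε => ?_⟩
    simp only [map_add, hsmul]
    exact hC ε hε (σ t)

/-- Observables are estimated locally against a bounded Lindbladian. -/
theorem norm_trace_mul_lindbladian_le {𝓝 : Superop Λ} {S : Finset Λ} (hS : IsLindbladianOn 𝓝 S)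
    (h𝓝 : diamondNorm 𝓝 ≤ 1) {σ : Op Λ} (hσ : ‖traceDual σ‖ ≤ 1) (A : Op Λ) :
    ‖(A * 𝓝 σ).trace‖ ≤ ∑ x ∈ S, siteVariation A x := by
  obtain ⟨A', h1, h2⟩ := exists_approx_isLocalTo_compl A S
  have : (A * 𝓝 σ).trace = ((A - A') * 𝓝 σ).trace := by
    rw [sub_mul, Matrix.trace_sub, hS.trace_mul_apply_eq_zero h1, sub_zero]
  rw [this]
  exact (norm_trace_mul_apply_le h𝓝 hσ _).trans h2

variable {a' Z' : ℕ}

/-- The generator of the noisy evolution. -/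
def noisyLindbladian (H : Op Λ) (N : LocalNoise Λ a' Z') (γ : ℝ) : Superop Λ :=
  hamiltonianGenerator H + (γ : ℂ) • ∑ α, N.term α

theorem noisyLindbladian_apply (H : Op Λ) (N : LocalNoise Λ a' Z') (γ : ℝ) (σ : Op Λ) :
    noisyLindbladian H N γ σ =
      (-I) • (H * σ - σ * H) + (γ : ℂ) • ∑ α, N.term α σ := by
  rw [← hamiltonianGenerator_apply, noisyLindbladian]
  simp

theorem continuous_noisyLindbladian (N : LocalNoise Λ a' Z') (γ : ℝ) :
    Continuous fun H : Op Λ => noisyLindbladian H N γ :=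
  continuous_hamiltonianGenerator.add continuous_const

theorem norm_noisyLindbladian_le {H : Op Λ} {C : ℝ} (hH : ‖H‖ ≤ C) (N : LocalNoise Λ a' Z')
    (γ : ℝ) : ‖noisyLindbladian H N γ‖ ≤ 2 * C + ‖(γ : ℂ) • ∑ α, N.term α‖ := by
  refine (norm_add_le _ _).trans (add_le_add_left ?_ _)
  have := norm_hamiltonianGenerator_le H
  linarith

theorem isDissipative_noisyLindbladian {H : Op Λ} (hH : star H = H) (N : LocalNoise Λ a' Z')
    {γ : ℝ} (hγ : 0 ≤ γ) : IsDissipative (noisyLindbladian H N γ) := by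
  have := (isDissipative_hamiltonian hH).add
    ((IsDissipative.sum Finset.univ fun α => (N.lindbladian α).isDissipative).smul hγ)
  convert! this using 1
  funext σ
  exact noisyLindbladian_apply H N γ σ

/-- Interpolation along `s ↦ Tr[Q(s) B Q(s)* V(s) ρ]`, which equals the noisy value at `s = t` and
the noiseless one at `s = 0`. The Hamiltonian contributions cancel by cyclicity of the trace,
leaving only the noise in the derivative. -/
theorem norm_trace_noisy_sub_le {H Q : ℝ → Op Λ} (hH : ∀ t, star (H t) = H t)
    (hc : Continuous H) {C : ℝ} (hC : ∀ t, ‖H t‖ ≤ C) (hQ : IsPropagator H Q)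
    (N : LocalNoise Λ a' Z') {γ : ℝ} (hγ : 0 ≤ γ) {ρ : Op Λ} (hρ : ‖traceDual ρ‖ ≤ 1) (O : Op Λ)
    {t : ℝ} (ht : 0 ≤ t) {D : ℝ} (hD : ∀ s ∈ Set.Icc 0 t,
      ∑ x, siteVariation (Q s * (star (Q t) * O * Q t) * star (Q s)) x ≤ D) :
    ‖(O * dysonSum (fun s => noisyLindbladian (H s) N γ) t ρ).trace -
      (Q 0 * (star (Q t) * O * Q t) * star (Q 0) * ρ).trace‖ ≤ γ * (Z' * D) * t := by
  set B := star (Q t) * O * Q t with hB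
  set V := dysonSum fun s => noisyLindbladian (H s) N γ with hV
  have hcL : Continuous fun s => noisyLindbladian (H s) N γ :=
    (continuous_noisyLindbladian N γ).comp hc
  have hCL := fun s => norm_noisyLindbladian_le (hC s) N γ
  have hV0 : V 0 = 1 := dysonSum_zero hcL.aestronglyMeasurable hCL
  have hσ : ∀ s, HasDerivAt (fun s => V s ρ) (noisyLindbladian (H s) N γ (V s ρ)) s := fun s =>
    ((ContinuousLinearMap.apply ℂ (Op Λ) ρ).restrictScalars ℝ).hasFDerivAt.comp_hasDerivAt s
      (hasDerivAt_dysonSum hcL hCL s)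
  have hσ1 : ∀ s, 0 ≤ s → ‖traceDual (V s ρ)‖ ≤ 1 := fun s hs => by
    refine (norm_traceDual_le_of_isDissipative hσ
      (fun t => isDissipative_noisyLindbladian (hH t) N hγ) hs).trans ?_
    rw [hV0]
    exact hρ
  have hO : ∀ s, HasDerivAt (fun s => Q s * B * star (Q s))
      ((-I) • (H s * (Q s * B * star (Q s)) - Q s * B * star (Q s) * H s)) s := fun s => by
    convert! ((hQ.hasDerivAt s).mul_const B).mul (hQ.hasDerivAt s).star using 1
    simp only [star_neg, star_smul, star_mul, hH, RCLike.star_def, Complex.conj_I, neg_mul,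
      neg_smul, neg_neg, smul_mul_assoc, mul_smul_comm, smul_sub, mul_assoc]
    abel
  have hy : ∀ s, HasDerivAt (fun s => (Q s * B * star (Q s) * V s ρ).trace)
      ((γ : ℂ) * ∑ α, (Q s * B * star (Q s) * N.term α (V s ρ)).trace) s := fun s => by
    have h1 := ((LinearMap.toContinuousLinearMap
      (Matrix.traceLinearMap (Config Λ) ℂ ℂ)).restrictScalars ℝ).hasFDerivAt.comp_hasDerivAt s
        ((hO s).mul (hσ s))
    convert! h1 using 1
    change _ = Matrix.trace _
    rw [noisyLindbladian_apply]
    generalize Q s * B * star (Q s) = A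
    generalize V s ρ = σ
    rw [mul_add, smul_mul_assoc, mul_smul_comm, mul_smul_comm, Matrix.trace_add, Matrix.trace_add,
      Matrix.trace_smul, Matrix.trace_smul, Matrix.trace_smul,
      Finset.mul_sum Finset.univ (fun α => N.term α σ) A, Matrix.trace_sum,
      sub_mul, mul_sub, Matrix.trace_sub, Matrix.trace_sub, trace_mul_cycle_left A σ (H s),
      ← mul_assoc A (H s) σ]
    simp only [smul_eq_mul]
    ring
  have hbound : ∀ s ∈ Set.Ico 0 t,
      ‖(γ : ℂ) * ∑ α, (Q s * B * star (Q s) * N.term α (V s ρ)).trace‖ ≤ γ * (Z' * D) := by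
    intro s hs
    rw [norm_mul, Complex.norm_real, Real.norm_of_nonneg hγ]
    refine mul_le_mul_of_nonneg_left ((norm_sum_le _ _).trans ?_) hγ
    calc _ ≤ ∑ α, ∑ x ∈ N.region α, siteVariation (Q s * B * star (Q s)) x :=
          Finset.sum_le_sum fun α _ => norm_trace_mul_lindbladian_le (N.lindbladian α)
            (N.diamond_le α) (hσ1 s hs.1) _
      _ ≤ Z' * ∑ x, siteVariation (Q s * B * star (Q s)) x :=
          N.regions.sum_region_sum_le fun x => siteVariation_nonneg _ x
      _ ≤ _ := by gcongr; exact hD s ⟨hs.1, hs.2.le⟩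
  have hmain := norm_image_sub_le_of_norm_deriv_le_segment'
    (fun s _ => (hy s).hasDerivWithinAt) hbound t ⟨ht, le_rfl⟩
  have e1 : Q t * B * star (Q t) = O := by
    rw [hB, show Q t * (star (Q t) * O * Q t) * star (Q t) =
      (Q t * star (Q t)) * O * (Q t * star (Q t)) by simp only [mul_assoc], hQ.mul_star_self,
      one_mul, mul_one]
  rw [e1, hV0, sub_zero] at hmain
  exact hmain

/-- The size of the light cone at time `t`. -/
def lightCone (d a Z : ℕ) (J t : ℝ) : ℝ :=
  4 * Real.exp 1 * (2 * (lrVelocity a Z J * t + 2)) ^ d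

theorem lrVelocity_nonneg {J : ℝ} (hJ : 0 ≤ J) (a Z : ℕ) : 0 ≤ lrVelocity a Z J := by
  unfold lrVelocity; positivity

theorem lightCone_mono {J s t : ℝ} (hJ : 0 ≤ J) (hs : 0 ≤ s) (hst : s ≤ t) (d a Z : ℕ) :
    lightCone d a Z J s ≤ lightCone d a Z J t := by
  have := lrVelocity_nonneg hJ a Z
  unfold lightCone
  gcongr

theorem LocalTerms.norm_sum_le {h : Fin m → Op Λ} {S : Fin m → Finset Λ} {a Z : ℕ} {J : ℝ}
    (H : LocalTerms h S a Z J) : ‖∑ α, h α‖ ≤ m * J := by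
  refine (_root_.norm_sum_le _ _).trans ?_
  refine (Finset.sum_le_card_nsmul _ _ _ fun α _ => H.norm_le α).trans ?_
  simp

theorem noise_error_le_of_continuous {h : Fin m → ℝ → Op Λ} {S : Fin m → Finset Λ} {a Z : ℕ}
    {J : ℝ} (hJ : 0 ≤ J) (hh : ∀ t, LocalTerms (fun α => h α t) S a Z J)
    (hc : ∀ α, Continuous (h α)) (N : LocalNoise Λ a' Z') {γ : ℝ} (hγ : 0 ≤ γ) {ρ : Op Λ}
    (hρ : ‖traceDual ρ‖ ≤ 1) {O : Op Λ} {X : Finset Λ} (hO : IsLocalTo O X) {t : ℝ}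
    (ht : 0 ≤ t) :
    ‖(O * dysonSum (fun s => noisyLindbladian (∑ α, h α s) N γ) t ρ).trace -
      (O * dysonSum (fun s => noisyLindbladian (∑ α, h α s) N 0) t ρ).trace‖ ≤
      γ * (Z' * (lightCone d a Z J t * (X.card ^ 2 * ‖O‖))) * t := by
  have hcH : Continuous fun t => ∑ α, h α t := by fun_prop
  have hsH : ∀ t, star (∑ α, h α t) = ∑ α, h α t := fun t => (hh t).star_sum
  have hCH : ∀ t, ‖∑ α, h α t‖ ≤ m * J := fun t => (hh t).norm_sum_le
  obtain ⟨Q, hQ⟩ := exists_isPropagator hsH hcH hCH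
  have hD : ∀ s ∈ Set.Icc 0 t,
      ∑ x, siteVariation (Q s * (star (Q t) * O * Q t) * star (Q s)) x ≤
        lightCone d a Z J t * (X.card ^ 2 * ‖O‖) := by
    intro s hs
    -- The propagator restarted at `s` is the identity there, so the light cone grows only for the
    -- time `t - s`.
    have h1 := sum_siteVariation_heisenberg_le hJ hh hc (hQ.mul_star s) (hQ.mul_star_self s) hO
      hs.2
    have e : star (Q t * star (Q s)) * O * (Q t * star (Q s)) =
        Q s * (star (Q t) * O * Q t) * star (Q s) := by
      simp only [star_mul, star_star, mul_assoc]
    rw [e] at h1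
    refine h1.trans (mul_le_mul_of_nonneg_right ?_ (by positivity))
    exact lightCone_mono hJ (sub_nonneg.mpr hs.2) (by linarith [hs.1]) d a Z
  have h1 := norm_trace_noisy_sub_le hsH hcH hCH hQ N hγ hρ O ht hD
  -- At rate zero the same estimate becomes an equality, which identifies the noiseless Dyson series
  -- with conjugation by `Q`.
  have h2 := norm_trace_noisy_sub_le hsH hcH hCH hQ N le_rfl hρ O ht hD
  rw [zero_mul, zero_mul] at h2
  rw [sub_eq_zero.mp (norm_le_zero_iff.mp h2)]
  exact h1

end Noise

/-! ### Averaging a bounded measurable function over short time intervals. -/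

section Mollify

open MeasureTheory Filter Topology

variable {E : Type*} [NormedAddCommGroup E]

variable {f : ℝ → E} {J : ℝ}

theorem intervalIntegrable_of_norm_le (hf : AEStronglyMeasurable f) (hJ : ∀ t, ‖f t‖ ≤ J)
    (a b : ℝ) : IntervalIntegrable f volume a b :=
  (continuous_const.intervalIntegrable (μ := volume) a b).mono_fun (f := fun _ => J)
    (hf.mono_measure Measure.restrict_le_self)
    (Eventually.of_forall fun s => (hJ s).trans (le_abs_self _))

variable [NormedSpace ℝ E]

/-- The average of `f` over the interval `[t, t + δ]`. -/
def mollify (f : ℝ → E) (δ t : ℝ) : E := δ⁻¹ • ∫ s in t..(t + δ), f s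

theorem mollify_eq (hf : AEStronglyMeasurable f) (hJ : ∀ t, ‖f t‖ ≤ J) (δ t : ℝ) :
    mollify f δ t = δ⁻¹ • ((∫ s in (0 : ℝ)..(t + δ), f s) - ∫ s in (0 : ℝ)..t, f s) := by
  have h := intervalIntegrable_of_norm_le hf hJ
  rw [mollify, intervalIntegral.integral_interval_sub_left (h _ _) (h _ _)]

theorem continuous_mollify (hf : AEStronglyMeasurable f) (hJ : ∀ t, ‖f t‖ ≤ J) (δ : ℝ) :
    Continuous (mollify f δ) := by
  rw [funext (mollify_eq hf hJ δ)]
  have h := intervalIntegral.continuous_primitive (intervalIntegrable_of_norm_le hf hJ) 0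
  fun_prop

theorem norm_mollify_le (hJ : ∀ t, ‖f t‖ ≤ J) {δ : ℝ} (hδ : 0 < δ) (t : ℝ) :
    ‖mollify f δ t‖ ≤ J := by
  have h := intervalIntegral.norm_integral_le_of_norm_le_const (a := t) (b := t + δ)
    fun s _ => hJ s
  rw [add_sub_cancel_left, abs_of_pos hδ] at h
  rw [mollify, norm_smul, norm_inv, Real.norm_of_nonneg hδ.le, inv_mul_le_iff₀ hδ]
  linarith

/-- Linear constraints survive averaging; applied to self-adjointness and to commutation with the
outside Paulis. -/
theorem map_mollify_eq_zero [CompleteSpace E] {F : Type*} [NormedAddCommGroup F]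
    [NormedSpace ℝ F] [CompleteSpace F]
    (hf : AEStronglyMeasurable f) (hJ : ∀ t, ‖f t‖ ≤ J) (L : E →L[ℝ] F) (hL : ∀ t, L (f t) = 0)
    (δ t : ℝ) : L (mollify f δ t) = 0 := by
  rw [mollify, map_smul, ← L.intervalIntegral_comp_comm (intervalIntegrable_of_norm_le hf hJ _ _)]
  simp [hL]

/-- Lebesgue's differentiation theorem, along the window lengths `1 / (k + 1)`. -/
theorem ae_tendsto_mollify [CompleteSpace E] (hf : AEStronglyMeasurable f) (hJ : ∀ t, ‖f t‖ ≤ J) :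
    ∀ᵐ t, Tendsto (fun k : ℕ => mollify f (1 / ((k : ℝ) + 1)) t) atTop (𝓝 (f t)) := by
  have hloc : LocallyIntegrable f volume := by
    rw [locallyIntegrable_iff]
    intro K hK
    refine Measure.integrableOn_of_bounded hK.measure_lt_top.ne hf (M := J) ?_
    exact Eventually.of_forall fun t => hJ t
  have hδ : Tendsto (fun k : ℕ => 1 / ((k : ℝ) + 1)) atTop (𝓝[≠] 0) :=
    tendsto_nhdsWithin_iff.mpr ⟨tendsto_one_div_add_atTop_nhds_zero_nat,
      Eventually.of_forall fun k => by
        have : (0 : ℝ) < 1 / ((k : ℝ) + 1) := by positivity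
        exact this.ne'⟩
  filter_upwards [LocallyIntegrable.ae_hasDerivAt_integral hloc] with t ht
  have := (hasDerivAt_iff_tendsto_slope_zero.mp (ht 0)).comp hδ
  refine this.congr fun k => ?_
  rw [mollify_eq hf hJ]
  rfl

end Mollify

/-! ### The noise error for Hamiltonians measurable in time. -/

section Noise

open MeasureTheory Filter Topology

variable {d : ℕ} {Λ : Finset (Site d)} {a Z a' Z' : ℕ} {J : ℝ}

/-- A Hamiltonian without terms is compatible with negative `J`; passing to `|J|` supplies the sign
condition of the Lieb–Robinson bounds. -/
theorem SimulatorHamiltonian.localTerms (H : SimulatorHamiltonian Λ a Z J) (t : ℝ) :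
    LocalTerms (fun α => H.term α t) H.region a Z |J| :=
  { (H.isLocal t).localTerms with
    norm_le := fun α => ((H.isLocal t).norm_le α).trans (le_abs_self J) }

theorem SimulatorHamiltonian.aestronglyMeasurable_term (H : SimulatorHamiltonian Λ a Z J)
    (α : Fin H.numTerms) : AEStronglyMeasurable (H.term α) := by
  have : H.term α = fun t => ∑ σ, ∑ η, H.term α t σ η • (Matrix.single σ η 1 : Op Λ) := by
    funext t
    conv_lhs => rw [Matrix.matrix_eq_sum_single (H.term α t)]
    simp
  rw [this]
  refine Finset.aestronglyMeasurable_fun_sum _ fun σ _ =>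
    Finset.aestronglyMeasurable_fun_sum _ fun η _ => ?_
  exact (H.measurable α σ η).aestronglyMeasurable.smul_const _

theorem SimulatorHamiltonian.localTerms_mollify (H : SimulatorHamiltonian Λ a Z J) {δ : ℝ}
    (hδ : 0 < δ) (t : ℝ) :
    LocalTerms (fun α => mollify (H.term α) δ t) H.region a Z |J| where
  regions := (H.localTerms t).regions
  norm_le α := norm_mollify_le (fun t => (H.localTerms t).norm_le α) hδ t
  isSelfAdjoint α := by
    have := map_mollify_eq_zero (H.aestronglyMeasurable_term α)
      (fun t => (H.localTerms t).norm_le α)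
      ((starL' ℝ : Op Λ ≃L[ℝ] Op Λ).toContinuousLinearMap - ContinuousLinearMap.id ℝ (Op Λ))
      (fun t => by simpa [sub_eq_zero] using (H.localTerms t).isSelfAdjoint α) δ t
    simpa [sub_eq_zero] using this
  isLocal α := fun x hx b => by
    have := map_mollify_eq_zero (H.aestronglyMeasurable_term α)
      (fun t => (H.localTerms t).norm_le α)
      ((ContinuousLinearMap.mul ℝ (Op Λ)).flip (pauli b x) -
        ContinuousLinearMap.mul ℝ (Op Λ) (pauli b x))
      (fun t => by simpa [sub_eq_zero] using ((H.localTerms t).isLocal α x hx b).eq) δ t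
    rw [Commute, SemiconjBy]
    simpa [sub_eq_zero] using this

/-- Time averages keep the same regions and bounds, so the continuous case holds uniformly along the
mollification and passes to the limit, both at rate `γ` and at rate zero. -/
theorem noise_error_le (H : SimulatorHamiltonian Λ a Z J) (N : LocalNoise Λ a' Z') {γ : ℝ}
    (hγ : 0 ≤ γ) {ρ : Op Λ} (hρ : ‖traceDual ρ‖ ≤ 1) {O : Op Λ} {X : Finset Λ}
    (hO : IsLocalTo O X) {t : ℝ} (ht : 0 ≤ t) :
    ‖(O * timeOrderedExp (noisyGenerator H N γ) t ρ).trace -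
      (O * timeOrderedExp (fun s => hamiltonianGenerator (H.total s)) t ρ).trace‖ ≤
      γ * (Z' * (lightCone d a Z |J| t * (X.card ^ 2 * ‖O‖))) * t := by
  have hlim : ∀ γ : ℝ, Tendsto (fun k : ℕ => (O * dysonSum (fun s => noisyLindbladian
      (∑ α, mollify (H.term α) (1 / ((k : ℝ) + 1)) s) N γ) t ρ).trace) atTop
      (𝓝 (O * dysonSum (fun s => noisyLindbladian (H.total s) N γ) t ρ).trace) := by
    intro γ
    have h1 := tendsto_dysonSum (A := fun s => noisyLindbladian (H.total s) N γ)
      (A' := fun (k : ℕ) s => noisyLindbladian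
        (∑ α, mollify (H.term α) (1 / ((k : ℝ) + 1)) s) N γ)
      (fun k => ?_) (fun s => norm_noisyLindbladian_le (H.localTerms s).norm_sum_le N γ)
      (fun k s => norm_noisyLindbladian_le
        (H.localTerms_mollify (by positivity) s).norm_sum_le N γ) ?_ t
    · have hcont : Continuous fun V : Superop Λ => (O * V ρ).trace := by
        have : Continuous fun V : Superop Λ => V ρ :=
          (ContinuousLinearMap.apply ℂ (Op Λ) ρ).continuous
        fun_prop
      exact (hcont.tendsto _).comp h1
    · refine Continuous.aestronglyMeasurable ?_
      refine (continuous_noisyLindbladian N γ).comp (continuous_finsetSum _ fun α _ => ?_)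
      exact continuous_mollify (H.aestronglyMeasurable_term α)
        (fun t => (H.localTerms t).norm_le α) _
    · have : ∀ᵐ s, ∀ α, Tendsto (fun k : ℕ => mollify (H.term α) (1 / ((k : ℝ) + 1)) s) atTop
          (𝓝 (H.term α s)) := ae_all_iff.mpr fun α =>
        ae_tendsto_mollify (H.aestronglyMeasurable_term α) fun t => (H.localTerms t).norm_le α
      filter_upwards [this] with s hs
      exact ((continuous_noisyLindbladian N γ).tendsto _).comp
        (tendsto_finsetSum _ fun α _ => hs α)
  have e1 : timeOrderedExp (noisyGenerator H N γ) t =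
      dysonSum (fun s => noisyLindbladian (H.total s) N γ) t := timeOrderedExp_eq_dysonSum _ _
  have e2 : timeOrderedExp (fun s => hamiltonianGenerator (H.total s)) t =
      dysonSum (fun s => noisyLindbladian (H.total s) N 0) t := by
    rw [timeOrderedExp_eq_dysonSum]
    congr 1
    funext s
    refine ContinuousLinearMap.ext fun σ => ?_
    rw [noisyLindbladian_apply, Complex.ofReal_zero, zero_smul, add_zero,
      hamiltonianGenerator_apply]
  rw [e1, e2]
  refine le_of_tendsto ((hlim γ).sub (hlim 0)).norm (Eventually.of_forall fun k => ?_)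
  exact noise_error_le_of_continuous (abs_nonneg J)
    (fun s => H.localTerms_mollify (by positivity) s)
    (fun α => continuous_mollify (H.aestronglyMeasurable_term α)
        (fun t => (H.localTerms t).norm_le α) _) N hγ hρ hO ht

end Noise

end

end TrotterNoise

namespace TrotterNoise

noncomputable section

/-! ### Derivative bounds and Taylor estimates -/

section Jets

open scoped ContDiff

variable {E F : Type*} [NormedAddCommGroup E] [NormedSpace ℝ E] [NormedAddCommGroup F]
  [NormedSpace ℝ F]

/-- The `j`-th derivative of `f` is bounded by `b * c ^ j` for all `j ≤ k`. -/
def JetBound (c : ℝ) : ℕ → ℝ → (ℝ → E) → Prop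
  | 0, b, f => ∀ s, ‖f s‖ ≤ b
  | k + 1, b, f => (∀ s, ‖f s‖ ≤ b) ∧
      ∃ g : ℝ → E, (∀ s, HasDerivAt f (g s) s) ∧ JetBound c k (b * c) g

/-- `f` is `k` times differentiable, and its derivatives of order less than `k` vanish at `0`. -/
def FlatAtZero : ℕ → (ℝ → E) → Prop
  | 0, _ => True
  | k + 1, f => f 0 = 0 ∧ ∃ f' : ℝ → E, (∀ s, HasDerivAt f (f' s) s) ∧ FlatAtZero k f'

namespace JetBound

theorem of_succ {c : ℝ} {k : ℕ} : ∀ {b : ℝ} {f : ℝ → E}, JetBound c (k + 1) b f →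
    JetBound c k b f := by
  induction k with
  | zero => exact fun h => h.1
  | succ k ih =>
    rintro b f ⟨h1, f', h2, h3⟩
    exact ⟨h1, f', h2, ih h3⟩

theorem add {c : ℝ} {k : ℕ} : ∀ {b₁ b₂ : ℝ} {f g : ℝ → E}, JetBound c k b₁ f →
    JetBound c k b₂ g → JetBound c k (b₁ + b₂) fun s => f s + g s := by
  induction k with
  | zero => exact fun hf hg s => (norm_add_le _ _).trans (add_le_add (hf s) (hg s))
  | succ k ih =>
    rintro b₁ b₂ f g ⟨h1, f', h2, h3⟩ ⟨h1', g', h2', h3'⟩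
    refine ⟨fun s => (norm_add_le _ _).trans (add_le_add (h1 s) (h1' s)), fun s => f' s + g' s,
      fun s => (h2 s).add (h2' s), ?_⟩
    rw [add_mul]
    exact ih h3 h3'

theorem const {c b : ℝ} (hc : 0 ≤ c) {v : E} (hv : ‖v‖ ≤ b) (k : ℕ) :
    JetBound c k b fun _ => v := by
  have hb : 0 ≤ b := (norm_nonneg _).trans hv
  have hzero : ∀ k : ℕ, ∀ b : ℝ, 0 ≤ b → JetBound c k b fun _ => (0 : E) := by
    intro k
    induction k with
    | zero => exact fun b hb s => by simpa using hb
    | succ k ih =>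
      exact fun b hb => ⟨fun s => by simpa using hb, fun _ => 0, fun s => hasDerivAt_const s 0,
        ih _ (mul_nonneg hb hc)⟩
  cases k with
  | zero => exact fun _ => hv
  | succ k =>
    exact ⟨fun _ => hv, fun _ => 0, fun s => hasDerivAt_const s v, hzero k _ (mul_nonneg hb hc)⟩

theorem sum {ι : Type*} (t : Finset ι) {c : ℝ} (hc : 0 ≤ c) {k : ℕ} {b : ι → ℝ} {f : ι → ℝ → E}
    (h : ∀ i, JetBound c k (b i) (f i)) :
    JetBound c k (∑ i ∈ t, b i) fun s => ∑ i ∈ t, f i s := by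
  classical
  induction t using Finset.induction_on with
  | empty => simpa using JetBound.const (E := E) hc (by simp) k
  | insert i t hi ih =>
    simp only [Finset.sum_insert hi]
    exact (h i).add ih

theorem clm {c : ℝ} (L : E →L[ℝ] F) {C : ℝ} (hC : 0 ≤ C) (hL : ∀ v, ‖L v‖ ≤ C * ‖v‖) {k : ℕ} :
    ∀ {b : ℝ} {f : ℝ → E}, JetBound c k b f → JetBound c k (C * b) fun s => L (f s) := by
  induction k with
  | zero => exact fun h s => (hL _).trans (mul_le_mul_of_nonneg_left (h s) hC)
  | succ k ih =>
    rintro b f ⟨h1, f', h2, h3⟩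
    refine ⟨fun s => (hL _).trans (mul_le_mul_of_nonneg_left (h1 s) hC), fun s => L (f' s),
      fun s => L.hasFDerivAt.comp_hasDerivAt s (h2 s), ?_⟩
    rw [mul_assoc]
    exact ih h3

end JetBound

namespace FlatAtZero

theorem of_succ {k : ℕ} : ∀ {f : ℝ → E}, FlatAtZero (k + 1) f → FlatAtZero k f := by
  induction k with
  | zero => exact fun _ => trivial
  | succ k ih =>
    rintro f ⟨h1, f', h2, h3⟩
    exact ⟨h1, f', h2, ih h3⟩

theorem deriv {k : ℕ} {f f' : ℝ → E} (h : FlatAtZero (k + 1) f)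
    (hf : ∀ s, HasDerivAt f (f' s) s) : FlatAtZero k f' := by
  obtain ⟨-, g, h2, h3⟩ := h
  rwa [show f' = g from funext fun s => (hf s).unique (h2 s)]

theorem add {k : ℕ} : ∀ {f g : ℝ → E}, FlatAtZero k f → FlatAtZero k g →
    FlatAtZero k fun s => f s + g s := by
  induction k with
  | zero => exact fun _ _ => trivial
  | succ k ih =>
    rintro f g ⟨h1, f', h2, h3⟩ ⟨h1', g', h2', h3'⟩
    exact ⟨by simp [h1, h1'], fun s => f' s + g' s, fun s => (h2 s).add (h2' s), ih h3 h3'⟩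

theorem clm (L : E →L[ℝ] F) {k : ℕ} :
    ∀ {f : ℝ → E}, FlatAtZero k f → FlatAtZero k fun s => L (f s) := by
  induction k with
  | zero => exact fun _ => trivial
  | succ k ih =>
    rintro f ⟨h1, f', h2, h3⟩
    exact ⟨by simp [h1], fun s => L (f' s), fun s => L.hasFDerivAt.comp_hasDerivAt s (h2 s),
      ih h3⟩

theorem mul_contDiff {𝔸 : Type*} [NormedRing 𝔸] [NormedAlgebra ℝ 𝔸] {k : ℕ} :
    ∀ {f g : ℝ → 𝔸}, FlatAtZero k f → ContDiff ℝ ∞ g → FlatAtZero k fun s => f s * g s := by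
  induction k with
  | zero => exact fun _ _ => trivial
  | succ k ih =>
    intro f g hf hg
    obtain ⟨h1, f', h2, h3⟩ := hf
    have hg' := contDiff_infty_iff_deriv.mp hg
    refine ⟨by simp [h1], fun s => f' s * g s + f s * _root_.deriv g s,
      fun s => (h2 s).mul (hg'.1 s).hasDerivAt, (ih h3 hg).add (ih ?_ hg'.2)⟩
    exact FlatAtZero.of_succ ⟨h1, f', h2, h3⟩

theorem of_iteratedDeriv {k : ℕ} : ∀ {f : ℝ → E}, ContDiff ℝ ∞ f →
    (∀ i < k, iteratedDeriv i f 0 = 0) → FlatAtZero k f := by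
  induction k with
  | zero => exact fun _ _ => trivial
  | succ k ih =>
    intro f hf h
    have hf' := contDiff_infty_iff_deriv.mp hf
    refine ⟨by simpa using h 0 (Nat.succ_pos k), _root_.deriv f, fun s => (hf'.1 s).hasDerivAt,
      ih hf'.2 fun i hi => ?_⟩
    rw [← iteratedDeriv_succ']
    exact h (i + 1) (Nat.succ_lt_succ hi)

/-- Taylor's estimate. -/
theorem norm_le {c : ℝ} (hc : 0 ≤ c) {k : ℕ} : ∀ {b : ℝ} {f : ℝ → E}, FlatAtZero k f →
    JetBound c k b f → ∀ u, 0 ≤ u → ‖f u‖ ≤ b * (c * u) ^ k := by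
  induction k with
  | zero => exact fun _ h u _ => by simpa using h u
  | succ k ih =>
    rintro b f ⟨h1, f', h2, h3⟩ hb u hu
    obtain ⟨hb1, g, hg1, hg2⟩ := hb
    have hb0 : 0 ≤ b := (norm_nonneg _).trans (hb1 0)
    rw [show g = f' from funext fun s => (hg1 s).unique (h2 s)] at hg2
    have hbound : ∀ s ∈ Set.Ico 0 u, ‖f' s‖ ≤ b * c * (c * u) ^ k := fun s hs => by
      refine (ih h3 hg2 s hs.1).trans ?_
      have := hs.2.le
      have := hs.1
      gcongr
    have := norm_image_sub_le_of_norm_deriv_le_segment' (fun s _ => (h2 s).hasDerivWithinAt)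
      hbound u ⟨hu, le_rfl⟩
    rw [h1, sub_zero, sub_zero] at this
    refine this.trans (le_of_eq ?_)
    ring

end FlatAtZero

end Jets

/-! ### One-parameter unitary groups -/

section Exp

open NormedSpace
open scoped ContDiff

variable {𝔸 : Type*} [NormedRing 𝔸] [NormedAlgebra ℝ 𝔸]

theorem star_exp_smul [StarRing 𝔸] [ContinuousStar 𝔸] [StarModule ℝ 𝔸] {B : 𝔸} (hB : star B = -B)
    (s : ℝ) : star (exp (s • B)) = exp ((-s) • B) := by
  rw [star_exp, star_smul, hB, star_trivial, smul_neg, neg_smul]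

variable [CompleteSpace 𝔸]

theorem contDiff_exp_smul (B : 𝔸) : ContDiff ℝ ∞ fun s : ℝ => exp (s • B) := by
  have h : ∀ n : ℕ, ContDiff ℝ n fun s : ℝ => exp (s • B) := by
    intro n
    induction n with
    | zero =>
      rw [Nat.cast_zero, contDiff_zero]
      exact continuous_iff_continuousAt.mpr fun s => (hasDerivAt_exp_smul_const B s).continuousAt
    | succ n ih =>
      rw [Nat.cast_succ, contDiff_succ_iff_deriv]
      refine ⟨fun s => (hasDerivAt_exp_smul_const B s).differentiableAt, by simp, ?_⟩
      rw [show deriv (fun s : ℝ => exp (s • B)) = fun s => exp (s • B) * B from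
        funext fun s => (hasDerivAt_exp_smul_const B s).deriv]
      exact ih.mul contDiff_const
  exact contDiff_infty.mpr h

theorem iteratedDeriv_exp_smul (B : 𝔸) (k : ℕ) :
    iteratedDeriv k (fun s : ℝ => exp (s • B)) = fun s => B ^ k * exp (s • B) := by
  induction k with
  | zero => simp
  | succ k ih =>
    rw [iteratedDeriv_succ, ih]
    funext s
    rw [((hasDerivAt_exp_smul_const' B s).const_mul (B ^ k)).deriv, pow_succ, mul_assoc]

theorem exp_add_smul (B : 𝔸) (s t : ℝ) : exp ((s + t) • B) = exp (s • B) * exp (t • B) := by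
  let _ : NormedAlgebra ℚ 𝔸 := NormedAlgebra.restrictScalars ℚ ℝ 𝔸
  rw [add_smul, exp_add_of_commute]
  exact ((Commute.refl B).smul_left s).smul_right t

theorem exp_smul_add_of_commute {B C : 𝔸} (h : Commute B C) (s : ℝ) :
    exp (s • (B + C)) = exp (s • B) * exp (s • C) := by
  let _ : NormedAlgebra ℚ 𝔸 := NormedAlgebra.restrictScalars ℚ ℝ 𝔸
  rw [smul_add, exp_add_of_commute]
  exact (h.smul_left s).smul_right s

theorem exp_smul_mul_neg (B : 𝔸) (s : ℝ) : exp (s • B) * exp ((-s) • B) = 1 := by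
  rw [← exp_add_smul, add_neg_cancel, zero_smul, exp_zero]

theorem exp_neg_smul_mul (B : 𝔸) (s : ℝ) : exp ((-s) • B) * exp (s • B) = 1 := by
  rw [← exp_add_smul, neg_add_cancel, zero_smul, exp_zero]

/-- Conjugation by the flow generated by `B`. -/
def flowConj (B : 𝔸) (f : ℝ → 𝔸) (s : ℝ) : 𝔸 := exp (s • B) * f s * exp ((-s) • B)

theorem hasDerivAt_flowConj (B : 𝔸) {f f' : ℝ → 𝔸} (hf : ∀ s, HasDerivAt f (f' s) s) (s : ℝ) :
    HasDerivAt (flowConj B f) (flowConj B (fun s => f' s + (B * f s - f s * B)) s) s := by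
  have h1 : HasDerivAt (fun s : ℝ => exp ((-s) • B)) (-(B * exp ((-s) • B))) s := by
    have := (hasDerivAt_exp_smul_const' B (-s)).scomp s (hasDerivAt_neg s)
    rw [neg_one_smul] at this
    exact this
  have := ((hasDerivAt_exp_smul_const B s).mul (hf s)).mul h1
  convert! this using 1
  simp only [flowConj, Pi.mul_apply]
  generalize exp ((-s) • B) = e
  noncomm_ring

variable [StarRing 𝔸] [CStarRing 𝔸] [StarModule ℝ 𝔸]

theorem norm_flowConj {B : 𝔸} (hB : star B = -B) (f : ℝ → 𝔸) (s : ℝ) :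
    ‖flowConj B f s‖ = ‖f s‖ := by
  have hu : ∀ s : ℝ, exp (s • B) ∈ unitary 𝔸 := fun s => by
    rw [Unitary.mem_iff, star_exp_smul hB]
    exact ⟨exp_neg_smul_mul B s, exp_smul_mul_neg B s⟩
  rw [flowConj, CStarRing.norm_mul_mem_unitary _ (hu _), CStarRing.norm_mem_unitary_mul _ (hu _)]

/-- The derivative of the conjugated function is the conjugation of `f' + [B, f]`, and conjugation
is isometric; each derivative thus costs an extra `2β` in the rate. -/
theorem JetBound.flowConj {B : 𝔸} (hB : star B = -B) {β c : ℝ} (hβ : ‖B‖ ≤ β)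
    {k : ℕ} : ∀ {b : ℝ} {f : ℝ → 𝔸}, JetBound c k b f →
      JetBound (c + 2 * β) k b (flowConj B f) := by
  have hβ0 : 0 ≤ β := (norm_nonneg _).trans hβ
  induction k with
  | zero => exact fun h s => by rw [norm_flowConj hB]; exact h s
  | succ k ih =>
    intro b f h
    obtain ⟨h1, f', h2, h3⟩ := h
    have h0 : JetBound c k b f := JetBound.of_succ ⟨h1, f', h2, h3⟩
    refine ⟨fun s => by rw [norm_flowConj hB]; exact h1 s, _, hasDerivAt_flowConj B h2, ?_⟩
    rw [mul_add]
    refine ih (h3.add ?_)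
    have := h0.clm (ContinuousLinearMap.mul ℝ 𝔸 B - (ContinuousLinearMap.mul ℝ 𝔸).flip B)
      (C := 2 * β) (by positivity) (fun v => ?_)
    · rw [mul_comm b]
      exact this
    · change ‖B * v - v * B‖ ≤ _
      have h1 := norm_sub_le (B * v) (v * B)
      have h2 := norm_mul_le B v
      have h3 := norm_mul_le v B
      have h4 := mul_le_mul_of_nonneg_right hβ (norm_nonneg v)
      nlinarith

end Exp

end

end TrotterNoise

namespace TrotterNoise

noncomputable section

/-! ### Products of exponentials and their logarithmic derivatives -/

section ExpProd

open NormedSpace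
open scoped ContDiff

variable {𝔸 : Type*} [NormedRing 𝔸] [NormedAlgebra ℝ 𝔸]

/-- `exp(s B₁) ⋯ exp(s B_M)`. -/
def expProd (L : List 𝔸) (s : ℝ) : 𝔸 := (L.map fun B => exp (s • B)).prod

/-- The generator of `expProd L`, that is `G` with `(expProd L)' = G * expProd L`. -/
def expProdGenerator : List 𝔸 → ℝ → 𝔸
  | [], _ => 0
  | B :: L, s => B + flowConj B (expProdGenerator L) s

theorem expProdGenerator_cons (B : 𝔸) (L : List 𝔸) (s : ℝ) :
    expProdGenerator (B :: L) s = B + flowConj B (expProdGenerator L) s := rfl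

theorem flowConj_eq_sum {ι : Type*} {t : Finset ι} {B : 𝔸} {f : ℝ → 𝔸} {F : ι → ℝ → 𝔸} {s : ℝ}
    (h : f s = ∑ i ∈ t, F i s) : flowConj B f s = ∑ i ∈ t, flowConj B (F i) s := by
  simp only [flowConj, h, Finset.mul_sum, Finset.sum_mul]

theorem expProd_cons (B : 𝔸) (L : List 𝔸) (s : ℝ) :
    expProd (B :: L) s = exp (s • B) * expProd L s := by simp [expProd]

theorem expProd_zero (L : List 𝔸) : expProd L 0 = 1 := by
  induction L with
  | nil => rfl
  | cons B L ih => rw [expProd_cons, ih, zero_smul, exp_zero, mul_one]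

theorem star_flowConj [StarRing 𝔸] [CStarRing 𝔸] [StarModule ℝ 𝔸] {B : 𝔸}
    (hB : star B = -B) {f : ℝ → 𝔸} {s : ℝ} (hf : star (f s) = -f s) :
    star (flowConj B f s) = -flowConj B f s := by
  simp only [flowConj, star_mul, star_exp_smul hB, hf, neg_neg]
  noncomm_ring

theorem star_expProdGenerator [StarRing 𝔸] [CStarRing 𝔸] [StarModule ℝ 𝔸] {L : List 𝔸}
    (hL : ∀ B ∈ L, star B = -B) (s : ℝ) :
    star (expProdGenerator L s) = -expProdGenerator L s := by
  induction L with
  | nil => simp [expProdGenerator]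
  | cons B L ih =>
    have h := star_flowConj (hL B (by simp)) (ih fun C hC => hL C (by simp [hC]))
    rw [expProdGenerator, star_add, h, hL B (by simp), neg_add]

variable [CompleteSpace 𝔸]

theorem hasDerivAt_expProd (L : List 𝔸) (s : ℝ) :
    HasDerivAt (expProd L) (expProdGenerator L s * expProd L s) s := by
  induction L with
  | nil =>
    rw [expProdGenerator, zero_mul]
    exact hasDerivAt_const s (1 : 𝔸)
  | cons B L ih =>
    have h := (hasDerivAt_exp_smul_const' B s).mul ih
    rw [show expProd (B :: L) = (fun s => exp (s • B)) * expProd L from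
      funext fun s => expProd_cons B L s]
    convert! h using 1
    simp only [expProdGenerator, flowConj, Pi.mul_apply]
    have := exp_neg_smul_mul B s
    generalize exp ((-s) • B) = e at *
    generalize exp (s • B) = f at *
    calc (B + f * expProdGenerator L s * e) * (f * expProd L s)
        = B * f * expProd L s + f * expProdGenerator L s * (e * f) * expProd L s := by
          noncomm_ring
      _ = _ := by rw [this]; noncomm_ring

theorem contDiff_expProd (L : List 𝔸) : ContDiff ℝ ∞ (expProd L) := by
  induction L with
  | nil => exact contDiff_const
  | cons B L ih =>
    rw [show expProd (B :: L) = fun s => exp (s • B) * expProd L s from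
      funext fun s => expProd_cons B L s]
    exact (contDiff_exp_smul B).mul ih

theorem expProd_mem_unitary [StarRing 𝔸] [CStarRing 𝔸] [StarModule ℝ 𝔸] {L : List 𝔸}
    (hL : ∀ B ∈ L, star B = -B) (s : ℝ) : expProd L s ∈ unitary 𝔸 := by
  induction L with
  | nil => exact one_mem _
  | cons B L ih =>
    rw [expProd_cons]
    refine mul_mem ?_ (ih fun C hC => hL C (by simp [hC]))
    have hB := hL B (by simp)
    rw [Unitary.mem_iff, star_exp_smul hB]
    exact ⟨exp_neg_smul_mul B s, exp_smul_mul_neg B s⟩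

/-- Here `C` plays the distant terms of a class: its exponential splits off and then cancels through
`f s`. -/
theorem flowConj_add_of_commute {B C : 𝔸} (h : Commute B C) {f : ℝ → 𝔸} {s : ℝ}
    (hC : Commute C (f s)) : flowConj (B + C) f s = flowConj B f s := by
  have h1 : Commute (exp (s • C)) (f s) := by
    let _ : NormedAlgebra ℚ 𝔸 := NormedAlgebra.restrictScalars ℚ ℝ 𝔸
    exact (hC.smul_left s).exp_left
  rw [flowConj, flowConj, exp_smul_add_of_commute h, add_comm B C, exp_smul_add_of_commute h.symm,
    mul_assoc (exp (s • B)), h1.eq]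
  calc exp (s • B) * (f s * exp (s • C)) * (exp ((-s) • C) * exp ((-s) • B))
      = exp (s • B) * f s * (exp (s • C) * exp ((-s) • C)) * exp ((-s) • B) := by noncomm_ring
    _ = _ := by rw [exp_smul_mul_neg, mul_one]

end ExpProd

/-! ### Thickened regions -/

section Thicken

variable {d m : ℕ} {Λ : Finset (Site d)}

/-- The sites at distance at most `R` from `S`. -/
def thicken (R : ℕ) (S : Finset Λ) : Finset Λ :=
  Finset.univ.filter fun y => ∃ x ∈ S, latticeDist (x : Site d) (y : Site d) ≤ R

theorem mem_thicken {R : ℕ} {S : Finset Λ} {y : Λ} :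
    y ∈ thicken R S ↔ ∃ x ∈ S, latticeDist (x : Site d) (y : Site d) ≤ R := by
  simp [thicken]

theorem subset_thicken (R : ℕ) (S : Finset Λ) : S ⊆ thicken R S := fun x hx =>
  mem_thicken.mpr ⟨x, hx, by simp [latticeDist_self]⟩

theorem thicken_mono {R R' : ℕ} (h : R ≤ R') (S : Finset Λ) : thicken R S ⊆ thicken R' S :=
  fun _ hy => by
    obtain ⟨x, hx, hd⟩ := mem_thicken.mp hy
    exact mem_thicken.mpr ⟨x, hx, hd.trans h⟩

theorem subset_thicken_of_not_disjoint {S S' : Finset Λ} {a R : ℕ}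
    (ha : ∀ x ∈ S', ∀ y ∈ S', latticeDist (x : Site d) (y : Site d) ≤ a)
    (h : ¬ Disjoint S' (thicken R S)) : S' ⊆ thicken (R + a) S := fun y hy => by
  obtain ⟨z, hz, hz'⟩ := Finset.not_disjoint_iff.mp h
  obtain ⟨x, hx, hd⟩ := mem_thicken.mp hz'
  exact mem_thicken.mpr ⟨x, hx,
    (latticeDist_triangle _ (z : Site d) _).trans (Nat.add_le_add hd (ha z hz y hy))⟩

theorem card_thicken_le {S : Finset Λ} {a : ℕ} (R : ℕ)
    (ha : ∀ x ∈ S, ∀ y ∈ S, latticeDist (x : Site d) (y : Site d) ≤ a) :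
    ((thicken R S).card : ℝ) ≤ ballVolume d (a + R) := by
  rcases S.eq_empty_or_nonempty with rfl | ⟨x, hx⟩
  · simpa [thicken] using ballVolume_nonneg d (a + R)
  · refine le_trans ?_ (card_ball_le Λ (x : Site d) (a + R))
    exact_mod_cast Finset.card_le_card fun y hy => by
      obtain ⟨z, hz, hd⟩ := mem_thicken.mp hy
      simp only [Finset.mem_filter, Finset.mem_univ, true_and]
      exact (latticeDist_triangle _ (z : Site d) _).trans (Nat.add_le_add (ha x hx z hz) hd)

/-- Exchange the sums: a site lies in a thickened region exactly when the region meets the ball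
around the site, and each site of the ball lies in at most `Z` regions. -/
theorem GeomLocalRegions.sum_thicken_sum_le {S : Fin m → Finset Λ} {a Z : ℕ}
    (h : GeomLocalRegions S a Z) (R : ℕ) {f : Λ → ℝ} (hf : ∀ x, 0 ≤ f x) :
    ∑ α, ∑ x ∈ thicken R (S α), f x ≤ ballVolume d R * Z * ∑ x, f x := by
  rw [Finset.sum_comm' (t' := Finset.univ)
    (s' := fun x => Finset.univ.filter fun α => x ∈ thicken R (S α)) (by simp), Finset.mul_sum]
  refine Finset.sum_le_sum fun x _ => ?_
  rw [Finset.sum_const, nsmul_eq_mul]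
  refine mul_le_mul_of_nonneg_right ?_ (hf x)
  have h1 : (Finset.univ.filter fun α => x ∈ thicken R (S α)).card ≤
      (Finset.univ.filter fun y : Λ => latticeDist (x : Site d) (y : Site d) ≤ R).card * Z := by
    refine (Finset.card_le_card fun α hα => ?_).trans (h.card_meeting_finset_le _)
    simp only [Finset.mem_filter, Finset.mem_univ, true_and] at hα ⊢
    obtain ⟨z, hz, hd⟩ := mem_thicken.mp hα
    refine Finset.not_disjoint_iff.mpr ⟨z, hz, ?_⟩
    simpa [latticeDist_comm] using hd
  refine (Nat.cast_le.mpr h1).trans ?_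
  rw [Nat.cast_mul]
  exact mul_le_mul_of_nonneg_right (card_ball_le Λ _ R) (Nat.cast_nonneg _)

end Thicken

/-! ### Locality of the generator of a product formula -/

section TrotterGenerator

open Complex (I)

variable {d m K : ℕ} {Λ : Finset (Site d)}

namespace IsLocalTo

variable {A B : Op Λ} {S : Finset Λ}

theorem zero (S : Finset Λ) : IsLocalTo (0 : Op Λ) S := fun _ _ _ => Commute.zero_left _

theorem add (hA : IsLocalTo A S) (hB : IsLocalTo B S) : IsLocalTo (A + B) S :=
  fun x hx b => (hA x hx b).add_left (hB x hx b)

theorem mul (hA : IsLocalTo A S) (hB : IsLocalTo B S) : IsLocalTo (A * B) S :=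
  fun x hx b => (hA x hx b).mul_left (hB x hx b)

theorem smul (hA : IsLocalTo A S) (c : ℂ) : IsLocalTo (c • A) S :=
  fun x hx b => (hA x hx b).smul_left c

theorem sum {ι : Type*} {t : Finset ι} {f : ι → Op Λ} (h : ∀ i ∈ t, IsLocalTo (f i) S) :
    IsLocalTo (∑ i ∈ t, f i) S :=
  fun x hx b => Commute.sum_left _ _ _ fun i hi => h i hi x hx b

theorem exp_smul (hA : IsLocalTo A S) (s : ℝ) : IsLocalTo (NormedSpace.exp (s • A)) S :=
  fun x hx b => by
    let _ : NormedAlgebra ℚ (Op Λ) := NormedAlgebra.restrictScalars ℚ ℝ (Op Λ)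
    exact ((hA x hx b).smul_left s).exp_left

theorem flowConj (hB : IsLocalTo B S) {f : ℝ → Op Λ} {s : ℝ} (hf : IsLocalTo (f s) S) :
    IsLocalTo (flowConj B f s) S :=
  ((hB.exp_smul s).mul hf).mul (hB.exp_smul (-s))

end IsLocalTo

/-- The generators `-i x_j H_{r_j}` of the factors of a product formula. -/
def factorGenerators {n : Type*} [Fintype n] [DecidableEq n] (H : Fin K → Matrix n n ℂ)
    (L : List (ℝ × Fin K)) : List (Matrix n n ℂ) :=
  L.map fun y => (-(I * (y.1 : ℂ))) • H y.2

theorem factorGenerators_cons {n : Type*} [Fintype n] [DecidableEq n] (H : Fin K → Matrix n n ℂ)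
    (y : ℝ × Fin K) (L : List (ℝ × Fin K)) :
    factorGenerators H (y :: L) = ((-(I * (y.1 : ℂ))) • H y.2) :: factorGenerators H L := rfl

theorem star_of_mem_factorGenerators {n : Type*} [Fintype n] [DecidableEq n]
    {H : Fin K → Matrix n n ℂ} (hH : ∀ j, star (H j) = H j) {L : List (ℝ × Fin K)}
    {B : Matrix n n ℂ} (hB : B ∈ factorGenerators H L) : star B = -B := by
  obtain ⟨y, -, rfl⟩ := List.mem_map.mp hB
  rw [star_smul, hH, ← neg_smul]
  congr 1
  simp

/-- Only the commuting terms near the support of `f` contribute to the conjugation of `f` by the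
flow of their sum. -/
theorem LocalTerms.exists_flowConj_eq {h : Fin m → Op Λ} {S : Fin m → Finset Λ} {a Z : ℕ} {J : ℝ}
    (hh : LocalTerms h S a Z J) (hJ : 0 ≤ J) {color : Fin m → Fin K}
    (hcomm : ∀ α β, color α = color β → Commute (h α) (h β)) (t : ℝ) (j : Fin K) {R : ℕ}
    (α : Fin m) {f : ℝ → Op Λ} (hf : ∀ s, IsLocalTo (f s) (thicken R (S α))) :
    ∃ B' : Op Λ, star B' = -B' ∧ ‖B'‖ ≤ |t| * (ballVolume d (a + R) * Z * J) ∧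
      IsLocalTo B' (thicken (R + a) (S α)) ∧
      flowConj ((-(I * (t : ℂ))) • ∑ α with color α = j, h α) f = flowConj B' f := by
  have hnorm : ‖-(I * (t : ℂ))‖ = |t| := by simp
  -- Keeping only the terms that meet the support of `f` gives a generator whose norm does not
  -- depend on the size of `Λ`.
  let P : Fin m → Prop := fun β => ¬ Disjoint (S β) (thicken R (S α))
  let u := Finset.univ.filter fun β => color β = j
  refine ⟨(-(I * (t : ℂ))) • ∑ β ∈ u.filter P, h β, ?_, ?_, ?_, ?_⟩
  · have hsum : star (∑ β ∈ u.filter P, h β) = ∑ β ∈ u.filter P, h β := by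
      rw [_root_.star_sum]
      exact Finset.sum_congr rfl fun β _ => hh.isSelfAdjoint β
    exact star_of_mem_factorGenerators (H := fun _ : Fin 1 => ∑ β ∈ u.filter P, h β)
      (fun _ => hsum) (L := [(t, 0)]) (by simp [factorGenerators])
  · rw [norm_smul, hnorm]
    refine mul_le_mul_of_nonneg_left ?_ (abs_nonneg t)
    refine (norm_sum_le_of_le _ fun β _ => hh.norm_le β).trans ?_
    rw [Finset.sum_const, nsmul_eq_mul]
    refine mul_le_mul_of_nonneg_right ?_ hJ
    have h1 : (u.filter P).card ≤ (thicken R (S α)).card * Z := by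
      refine (Finset.card_le_card fun β hβ => ?_).trans
        (hh.regions.card_meeting_finset_le (thicken R (S α)))
      simpa using (Finset.mem_filter.mp hβ).2
    refine (Nat.cast_le.mpr h1).trans ?_
    rw [Nat.cast_mul]
    exact mul_le_mul_of_nonneg_right (card_thicken_le R (hh.regions.diam_le α))
      (Nat.cast_nonneg _)
  · refine IsLocalTo.smul (IsLocalTo.sum fun β hβ => ?_) _
    exact (hh.isLocal β).mono
      (subset_thicken_of_not_disjoint (hh.regions.diam_le β) (Finset.mem_filter.mp hβ).2)
  · funext s
    have hsplit : (-(I * (t : ℂ))) • ∑ α with color α = j, h α =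
          (-(I * (t : ℂ))) • ∑ β ∈ u.filter P, h β +
        (-(I * (t : ℂ))) • ∑ β ∈ u.filter (fun β => ¬ P β), h β := by
      rw [← smul_add, Finset.sum_filter_add_sum_filter_not]
    rw [hsplit]
    refine flowConj_add_of_commute ?_ ?_
    · refine (Commute.smul_left ?_ _).smul_right _
      refine Commute.sum_left _ _ _ fun β hβ => Commute.sum_right _ _ _ fun β' hβ' => ?_
      refine hcomm _ _ ?_
      simp only [u, Finset.mem_filter, Finset.mem_univ, true_and] at hβ hβ'
      exact hβ.1.trans hβ'.1.symm
    · refine Commute.smul_left (Commute.sum_left _ _ _ fun β hβ => ?_) _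
      refine (hh.isLocal β).commute (hf s) ?_
      simpa [P] using (Finset.mem_filter.mp hβ).2

/-- The generator of a product formula is a sum of quasi-local terms. -/
theorem exists_local_decomposition (d a Z : ℕ) {J : ℝ} (hJ : 0 ≤ J) (p : ℕ)
    (L : List (ℝ × Fin K)) :
    ∃ (R : ℕ) (b c : ℝ), 0 ≤ b ∧ 0 ≤ c ∧ ∀ {Λ : Finset (Site d)} {m : ℕ} {h : Fin m → Op Λ}
      {S : Fin m → Finset Λ} {color : Fin m → Fin K}, LocalTerms h S a Z J →
      (∀ α β, color α = color β → Commute (h α) (h β)) →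
      ∃ F : Fin m → ℝ → Op Λ,
        (∀ s, expProdGenerator (factorGenerators (fun j => ∑ α with color α = j, h α) L) s =
          ∑ α, F α s) ∧
        (∀ α s, IsLocalTo (F α s) (thicken R (S α))) ∧ ∀ α, JetBound c p b (F α) := by
  induction L with
  | nil =>
    refine ⟨0, 0, 0, le_rfl, le_rfl, fun {Λ m h S color} _ _ => ⟨fun _ _ => 0, fun s => ?_,
      fun α s => IsLocalTo.zero _, fun α => JetBound.const le_rfl (by simp) p⟩⟩
    simp [factorGenerators, expProdGenerator]
  | cons y L ih =>
    obtain ⟨R, b, c, hb, hc, hF⟩ := ih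
    obtain ⟨t, j⟩ := y
    have hV := ballVolume_nonneg d (a + R)
    -- Prepending one exponential extends the range by `a`, adds one scaled term to the size, and
    -- raises the derivative rate by twice the norm of the truncated generator.
    refine ⟨R + a, |t| * J + b, c + 2 * (|t| * (ballVolume d (a + R) * Z * J)), by positivity,
      by positivity, fun {Λ m h S color} hh hcomm => ?_⟩
    obtain ⟨F, hF1, hF2, hF3⟩ := hF hh hcomm
    have hnorm : ‖-(I * (t : ℂ))‖ = |t| := by simp
    have key := fun α => hh.exists_flowConj_eq hJ hcomm t j α (hF2 α)
    -- The recursion for the generator is distributed over `α`: each piece receives its own term if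
    -- it belongs to the current class, and its old part is conjugated.
    refine ⟨fun α s => (if color α = j then (-(I * (t : ℂ))) • h α else 0) +
      flowConj ((-(I * (t : ℂ))) • ∑ α with color α = j, h α) (F α) s,
      fun s => ?_, fun α s => ?_, fun α => ?_⟩
    · rw [Finset.sum_add_distrib, ← Finset.sum_filter, ← Finset.smul_sum]
      rw [factorGenerators_cons, expProdGenerator_cons, flowConj_eq_sum (hF1 s)]
    · obtain ⟨B', -, -, hB', hBB'⟩ := key α
      refine IsLocalTo.add ?_ ?_
      · split_ifs
        · exact ((hh.isLocal α).mono (subset_thicken _ _)).smul _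
        · exact IsLocalTo.zero _
      · rw [hBB']
        exact hB'.flowConj ((hF2 α s).mono (thicken_mono (Nat.le_add_right R a) _))
    · obtain ⟨B', hs, hn, -, hBB'⟩ := key α
      refine JetBound.add (JetBound.const (by positivity) ?_ p) ?_
      · split_ifs
        · rw [norm_smul, hnorm]
          exact mul_le_mul_of_nonneg_left (hh.norm_le α) (abs_nonneg t)
        · simpa using mul_nonneg (abs_nonneg t) hJ
      · rw [hBB']
        exact (hF3 α).flowConj hs hn

end TrotterGenerator

end

end TrotterNoise

namespace TrotterNoise

noncomputable section

open Complex (I)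

/-! ### Order conditions -/

section OrderConditions

open scoped ContDiff

variable {K M : ℕ} {n n' : Type*} [Fintype n] [DecidableEq n] [Fintype n'] [DecidableEq n']

theorem evolution_mul (H : Matrix n n ℂ) (y s : ℝ) :
    evolution H (y * s) = NormedSpace.exp (s • ((-(I * (y : ℂ))) • H)) := by
  rw [evolution, ← Complex.coe_smul s, smul_smul]
  congr 2
  push_cast
  ring

theorem evolution_eq_exp (H : Matrix n n ℂ) (s : ℝ) :
    evolution H s = NormedSpace.exp (s • ((-I) • H)) := by
  have := evolution_mul H 1 s
  simpa using this

/-- The factors of a product formula, as a list. -/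
def formulaFactors (r : Fin M → Fin K) (x : Fin M → ℝ) : List (ℝ × Fin K) :=
  List.ofFn fun j => (x j, r j)

theorem productFormula_eq_expProd (r : Fin M → Fin K) (x : Fin M → ℝ) (H : Fin K → Matrix n n ℂ)
    (s : ℝ) :
    productFormula r x H s = expProd (factorGenerators H (formulaFactors r x)) s := by
  rw [productFormula, expProd, factorGenerators, formulaFactors, List.map_ofFn, List.map_ofFn]
  congr 2
  funext j
  exact evolution_mul _ _ _

theorem reindex_exp (e : n ≃ n') (A : Matrix n n ℂ) :
    Matrix.reindexAlgEquiv ℂ ℂ e (NormedSpace.exp A) =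
      NormedSpace.exp (Matrix.reindexAlgEquiv ℂ ℂ e A) := by
  let _ : NormedAlgebra ℚ (Matrix n n ℂ) := NormedAlgebra.restrictScalars ℚ ℝ _
  let _ : NormedAlgebra ℚ (Matrix n' n' ℂ) := NormedAlgebra.restrictScalars ℚ ℝ _
  exact NormedSpace.map_exp (Matrix.reindexAlgEquiv ℂ ℂ e)
    (LinearMap.continuous_of_finiteDimensional
      (Matrix.reindexAlgEquiv ℂ ℂ e : Matrix n n ℂ ≃ₐ[ℂ] Matrix n' n' ℂ).toLinearMap) A

theorem reindex_evolution (e : n ≃ n') (H : Matrix n n ℂ) (s : ℝ) :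
    Matrix.reindexAlgEquiv ℂ ℂ e (evolution H s) =
      evolution (Matrix.reindexAlgEquiv ℂ ℂ e H) s := by
  rw [evolution, reindex_exp, map_smul, evolution]

theorem reindex_productFormula (e : n ≃ n') (r : Fin M → Fin K) (x : Fin M → ℝ)
    (H : Fin K → Matrix n n ℂ) (s : ℝ) :
    Matrix.reindexAlgEquiv ℂ ℂ e (productFormula r x H s) =
      productFormula r x (fun j => Matrix.reindexAlgEquiv ℂ ℂ e (H j)) s := by
  rw [productFormula, productFormula, map_list_prod, List.map_ofFn]
  congr 2
  funext j
  exact reindex_evolution _ _ _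

/-- Derivatives of orders `0` to `p` agree, hence flatness of order `p + 1`. The order conditions
speak of matrices indexed by `Fin n`, so the statement is transported along an enumeration of the
basis. -/
theorem IsTrotterFormula.flatAtZero {p : ℕ} {r : Fin M → Fin K} {x : Fin M → ℝ}
    (hS : IsTrotterFormula p r x) {H : Fin K → Matrix n n ℂ} (hH : ∀ j, star (H j) = H j) :
    FlatAtZero (p + 1) fun s => productFormula r x H s - evolution (∑ j, H j) s := by
  have hfin : ∀ (N : ℕ) (H : Fin K → Matrix (Fin N) (Fin N) ℂ), (∀ j, star (H j) = H j) →
      FlatAtZero (p + 1) fun s => productFormula r x H s - evolution (∑ j, H j) s := by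
    intro N H hH
    have h1 : ContDiff ℝ ∞ (productFormula r x H) := by
      rw [show productFormula r x H = _ from funext (productFormula_eq_expProd r x H)]
      exact contDiff_expProd _
    have h2 : evolution (∑ j, H j) = fun s : ℝ => NormedSpace.exp (s • ((-I) • ∑ j, H j)) :=
      funext (evolution_eq_exp _)
    have h3 : ContDiff ℝ ∞ (evolution (∑ j, H j)) := h2 ▸ contDiff_exp_smul _
    refine FlatAtZero.of_iteratedDeriv (h1.sub h3) fun i hi => ?_
    rw [iteratedDeriv_fun_sub (h1.contDiffAt.of_le (by exact_mod_cast le_top))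
      (h3.contDiffAt.of_le (by exact_mod_cast le_top)), hS N H hH i (by omega), h2,
      iteratedDeriv_exp_smul]
    simp
  let e := Fintype.equivFin n
  let φ : Matrix (Fin (Fintype.card n)) (Fin (Fintype.card n)) ℂ →L[ℝ] Matrix n n ℂ :=
    LinearMap.toContinuousLinearMap
      ((Matrix.reindexAlgEquiv ℂ ℂ e.symm).toLinearMap.restrictScalars ℝ)
  have h := (hfin _ (fun j => Matrix.reindexAlgEquiv ℂ ℂ e (H j)) fun j => by
    conv_rhs => rw [← hH j]
    rfl).clm φ
  have hback : ∀ A : Matrix n n ℂ, φ (Matrix.reindexAlgEquiv ℂ ℂ e A) = A := fun A =>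
    (Matrix.reindexAlgEquiv ℂ ℂ e).symm_apply_apply A
  convert! h using 2 with s
  rw [map_sub, ← reindex_productFormula, ← map_sum, ← reindex_evolution, hback, hback]

/-- The error in the generator of a product formula. -/
def generatorError (r : Fin M → Fin K) (x : Fin M → ℝ) (H : Fin K → Matrix n n ℂ) (s : ℝ) :
    Matrix n n ℂ :=
  expProdGenerator (factorGenerators H (formulaFactors r x)) s + I • ∑ j, H j

/-- With `Δ` the product formula `P` minus the exact evolution, `G + iH = (Δ' + iHΔ) P*`;
differentiating `Δ` costs one order. -/
theorem IsTrotterFormula.flatAtZero_generatorError {p : ℕ} {r : Fin M → Fin K} {x : Fin M → ℝ}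
    (hS : IsTrotterFormula p r x) {H : Fin K → Matrix n n ℂ} (hH : ∀ j, star (H j) = H j) :
    FlatAtZero p (generatorError r x H) := by
  set L := factorGenerators H (formulaFactors r x) with hL
  have hP : productFormula r x H = expProd L := funext (productFormula_eq_expProd r x H)
  have h0 := hS.flatAtZero hH
  rw [hP] at h0
  have hW : ∀ s, HasDerivAt (evolution (∑ j, H j))
      (((-I) • ∑ j, H j) * evolution (∑ j, H j) s) s := fun s => by
    rw [show evolution (∑ j, H j) = fun s : ℝ => NormedSpace.exp (s • ((-I) • ∑ j, H j)) from
      funext (evolution_eq_exp _)]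
    exact hasDerivAt_exp_smul_const' _ s
  have h1 := h0.deriv fun s => (hasDerivAt_expProd L s).sub (hW s)
  have h2 := h0.of_succ.clm (ContinuousLinearMap.mul ℝ (Matrix n n ℂ) (I • ∑ j, H j))
  have hstar : ContDiff ℝ ∞ fun s => star (expProd L s) :=
    (starL' ℝ : Matrix n n ℂ ≃L[ℝ] Matrix n n ℂ).contDiff.comp (contDiff_expProd L)
  convert! (h1.add h2).mul_contDiff hstar using 1
  funext s
  have hu := (Unitary.mem_iff.mp (expProd_mem_unitary (fun B hB =>
    star_of_mem_factorGenerators (L := formulaFactors r x) hH hB) s)).2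
  change expProdGenerator L s + I • ∑ j, H j = (expProdGenerator L s * expProd L s -
    ((-I) • ∑ j, H j) * evolution (∑ j, H j) s +
    (I • ∑ j, H j) * (expProd L s - evolution (∑ j, H j) s)) * star (expProd L s)
  rw [neg_smul, neg_mul, mul_sub, sub_neg_eq_add,
    show ∀ a b c : Matrix n n ℂ, a + b + (c - b) = a + c from fun a b c => by abel, ← add_mul,
    mul_assoc, hu, mul_one]

end OrderConditions

/-! ### The error of one step -/

section Step

variable {d m K M : ℕ} {Λ : Finset (Site d)}

theorem isPropagator_evolution {H : Op Λ} (hH : star H = H) :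
    IsPropagator (fun _ => H) (evolution H) := by
  have hskew : star ((-I) • H) = -((-I) • H) := by
    rw [star_smul, hH, ← neg_smul]
    simp
  constructor
  · intro t
    rw [show evolution H = fun s : ℝ => NormedSpace.exp (s • ((-I) • H)) from
      funext (evolution_eq_exp _)]
    have := hasDerivAt_exp_smul_const' (𝕂 := ℝ) ((-I) • H) t
    rwa [neg_smul, neg_mul, smul_mul_assoc, ← neg_smul I H] at this
  · intro t
    rw [evolution_eq_exp, star_exp_smul hskew, exp_neg_smul_mul]

theorem evolution_add (H : Op Λ) (s t : ℝ) :
    evolution H (s + t) = evolution H s * evolution H t := by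
  simp only [evolution_eq_exp, exp_add_smul]

theorem evolution_zero (H : Op Λ) : evolution H 0 = 1 := by
  rw [evolution_eq_exp, zero_smul, NormedSpace.exp_zero]

theorem commute_evolution (H : Op Λ) (t : ℝ) : Commute H (evolution H t) := by
  rw [evolution_eq_exp]
  let _ : NormedAlgebra ℚ (Op Λ) := NormedAlgebra.restrictScalars ℚ ℝ (Op Λ)
  exact (((Commute.refl H).smul_right (-I)).smul_right t).exp_right

theorem hasDerivAt_evolution_conj {H : Op Λ} (hH : star H = H) (A : Op Λ) (t : ℝ) :
    HasDerivAt (fun t => star (evolution H t) * A * evolution H t)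
      (I • (H * (star (evolution H t) * A * evolution H t) -
        star (evolution H t) * A * evolution H t * H)) t := by
  convert! (isPropagator_evolution hH).hasDerivAt_heisenberg (fun _ => hH) A t using 2
  have h1 := (commute_evolution H t).eq
  have h2 : star (evolution H t) * H = H * star (evolution H t) := by
    have := congrArg star h1
    rwa [star_mul, star_mul, hH] at this
  simp only [mul_sub, sub_mul, mul_assoc]
  rw [← h1, ← mul_assoc (star _) H, h2, mul_assoc]

/-- Duhamel interpolation `u ↦ P(u)* X(s - u) P(u)` with `X` the exact Heisenberg evolution: its
derivative is a unitary conjugate of the commutator of `G + iH` with `X(s - u)`, up to sign. -/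
theorem norm_conj_sub_evolution_le {H : Op Λ} (hH : star H = H) {P G : ℝ → Op Λ}
    (hP : ∀ s, HasDerivAt P (G s * P s) s) (hP0 : P 0 = 1) (hPu : ∀ s, P s ∈ unitary (Op Λ))
    (hG : ∀ s, star (G s) = -G s) (A : Op Λ) {s ε : ℝ} (hs : 0 ≤ s)
    (hε : ∀ u ∈ Set.Icc 0 s,
      ‖(G u + I • H) * (star (evolution H (s - u)) * A * evolution H (s - u)) -
        star (evolution H (s - u)) * A * evolution H (s - u) * (G u + I • H)‖ ≤ ε) :
    ‖star (P s) * A * P s - star (evolution H s) * A * evolution H s‖ ≤ ε * s := by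
  let X : ℝ → Op Λ := fun v => star (evolution H v) * A * evolution H v
  have hX : ∀ v, HasDerivAt X (I • (H * X v - X v * H)) v := hasDerivAt_evolution_conj hH A
  have hX' : ∀ u, HasDerivAt (fun u => X (s - u)) (-(I • (H * X (s - u) - X (s - u) * H))) u :=
    fun u => by
      have := (hX (s - u)).scomp u ((hasDerivAt_id u).const_sub s)
      rw [neg_one_smul] at this
      exact this
  let D : ℝ → Op Λ := fun u =>
    -(star (P u) * ((G u + I • H) * X (s - u) - X (s - u) * (G u + I • H)) * P u)
  have hQ : ∀ u, HasDerivAt (fun u => star (P u) * X (s - u) * P u) (D u) u := fun u => by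
    have := (((hP u).star).mul (hX' u)).mul (hP u)
    convert! this using 1
    simp only [D, star_mul, hG, Pi.mul_apply, smul_sub, add_mul, mul_add,
      smul_mul_assoc, mul_smul_comm, sub_mul, mul_sub, mul_neg, neg_mul, mul_assoc, neg_sub]
    abel
  have hbound : ∀ u ∈ Set.Ico 0 s, ‖D u‖ ≤ ε := fun u hu => by
    rw [norm_neg, CStarRing.norm_mul_mem_unitary _ (hPu u),
      CStarRing.norm_mem_unitary_mul _ (Unitary.star_mem (hPu u))]
    exact hε u ⟨hu.1, hu.2.le⟩
  have := norm_image_sub_le_of_norm_deriv_le_segment' (fun u _ => (hQ u).hasDerivWithinAt)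
    hbound s ⟨hs, le_rfl⟩
  simpa [X, hP0, evolution_zero] using this

/-- Telescoping arranged so that each one-step error acts on an exactly evolved observable, for
which the light cone of `H` is available; the surrounding product-formula steps are isometric. -/
theorem norm_conj_pow_sub_evolution_le {H U : Op Λ} (hU : U ∈ unitary (Op Λ))
    (O : Op Λ) {s ε : ℝ} (T : ℕ)
    (hε : ∀ k < T, ‖star U * (star (evolution H (k * s)) * O * evolution H (k * s)) * U -
      star (evolution H s) * (star (evolution H (k * s)) * O * evolution H (k * s)) *
        evolution H s‖ ≤ ε) :
    ‖star (U ^ T) * O * U ^ T - star (evolution H (T * s)) * O * evolution H (T * s)‖ ≤ T * ε := by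
  induction T with
  | zero => simp [evolution_zero]
  | succ T ih =>
    have h1 := ih fun k hk => hε k (hk.trans T.lt_succ_self)
    have h2 := hε T T.lt_succ_self
    have h3 : evolution H ((T + 1 : ℕ) * s) = evolution H (T * s) * evolution H s := by
      rw [← evolution_add]
      congr 1
      push_cast
      ring
    rw [h3]
    generalize evolution H (T * s) = V at *
    generalize evolution H s = W at *
    have h4 : star (U ^ (T + 1)) * O * U ^ (T + 1) - star (V * W) * O * (V * W) =
        star U * (star (U ^ T) * O * U ^ T - star V * O * V) * U +
        (star U * (star V * O * V) * U - star W * (star V * O * V) * W) := by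
      rw [pow_succ, star_mul, star_mul]
      noncomm_ring
    rw [h4]
    refine (norm_add_le _ _).trans ?_
    rw [CStarRing.norm_mul_mem_unitary _ hU,
      CStarRing.norm_mem_unitary_mul _ (Unitary.star_mem hU)]
    push_cast
    linarith

/-- The commutator of the generator error with an observable is controlled by the local
variations of the observable. -/
theorem IsTrotterFormula.exists_commutator_bound {p : ℕ} {r : Fin M → Fin K} {x : Fin M → ℝ}
    (hS : IsTrotterFormula p r x) (d a Z : ℕ) {J : ℝ} (hJ : 0 ≤ J) :
    ∃ C : ℝ, 0 ≤ C ∧ ∀ {Λ : Finset (Site d)} {m : ℕ} {h : Fin m → Op Λ}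
      {S : Fin m → Finset Λ} {color : Fin m → Fin K}, LocalTerms h S a Z J →
      (∀ α β, color α = color β → Commute (h α) (h β)) → ∀ (A : Op Λ) (u : ℝ), 0 ≤ u →
      ‖generatorError r x (fun j => ∑ α with color α = j, h α) u * A -
        A * generatorError r x (fun j => ∑ α with color α = j, h α) u‖ ≤
        C * u ^ p * ∑ y, siteVariation A y := by
  obtain ⟨R, b, c, hb, hc, hF⟩ := exists_local_decomposition d a Z hJ p (formulaFactors r x)
  have hV := ballVolume_nonneg d R
  refine ⟨2 * (b + J) * (ballVolume d R * Z) * c ^ p, by positivity,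
    fun {Λ m h S color} hh hcomm A u hu => ?_⟩
  obtain ⟨F, hF1, hF2, hF3⟩ := hF hh hcomm
  -- The approximants are independent of `s`, so replacing `A` by `A - A' α` commutes with
  -- differentiation in `s`.
  choose A' hA' hAA' using fun α => exists_approx_isLocalTo_compl A (thicken R (S α))
  set H : Fin K → Op Λ := fun j => ∑ α with color α = j, h α with hHdef
  have hH : ∀ j, star (H j) = H j := fun j => by
    rw [hHdef, _root_.star_sum]
    exact Finset.sum_congr rfl fun α _ => hh.isSelfAdjoint α
  have hsum : ∑ j, H j = ∑ α, h α := Finset.sum_fiberwise _ _ _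
  let comm : Op Λ → Op Λ →L[ℝ] Op Λ := fun B =>
    (ContinuousLinearMap.mul ℝ (Op Λ)).flip B - ContinuousLinearMap.mul ℝ (Op Λ) B
  have hcommutator : ∀ B E : Op Λ, comm B E = E * B - B * E := fun _ _ => rfl
  have hnorm : ∀ B E : Op Λ, ‖comm B E‖ ≤ 2 * ‖B‖ * ‖E‖ := fun B E => by
    have h1 := norm_sub_le (E * B) (B * E)
    have h2 := norm_mul_le E B
    have h3 := norm_mul_le B E
    rw [hcommutator]
    nlinarith
  have hterm : ∀ α, JetBound c p (2 * ‖A - A' α‖ * (b + J))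
      fun s => comm (A - A' α) (F α s + I • h α) := fun α =>
    ((hF3 α).add (JetBound.const hc (by rw [norm_smul, Complex.norm_I, one_mul]
                                        exact hh.norm_le α) p)).clm _ (by positivity) (hnorm _)
  have hexp : ∀ s, generatorError r x H s * A - A * generatorError r x H s =
      ∑ α, comm (A - A' α) (F α s + I • h α) := fun s => by
    have hlocal : ∀ α, comm (A - A' α) (F α s + I • h α) = comm A (F α s + I • h α) := fun α => by
      have h1 : Commute (F α s + I • h α) (A' α) :=
        ((hF2 α s).add (((hh.isLocal α).mono (subset_thicken _ _)).smul I)).commute (hA' α)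
          disjoint_compl_right
      rw [hcommutator, hcommutator, mul_sub, sub_mul, h1.eq]
      abel
    simp only [hlocal]
    rw [← map_sum, hcommutator, Finset.sum_add_distrib, ← Finset.smul_sum, ← hsum, ← hF1]
    rfl
  -- Flatness holds for the full commutator and the derivative bounds come from its local terms;
  -- `hexp` identifies the two, so Taylor's estimate may combine them.
  have hflat := (hS.flatAtZero_generatorError hH).clm (comm A)
  have hjet := JetBound.sum Finset.univ hc hterm
  simp only [← hexp] at hjet
  refine (hflat.norm_le hc hjet u hu).trans ?_
  have h1 : ∑ α, 2 * ‖A - A' α‖ * (b + J) ≤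
      2 * (b + J) * (ballVolume d R * Z * ∑ y, siteVariation A y) := by
    calc ∑ α, 2 * ‖A - A' α‖ * (b + J) = 2 * (b + J) * ∑ α, ‖A - A' α‖ := by
          rw [Finset.mul_sum]
          exact Finset.sum_congr rfl fun α _ => by ring
      _ ≤ 2 * (b + J) * ∑ α, ∑ y ∈ thicken R (S α), siteVariation A y :=
          mul_le_mul_of_nonneg_left (Finset.sum_le_sum fun α _ => hAA' α) (by positivity)
      _ ≤ _ := mul_le_mul_of_nonneg_left
          (hh.regions.sum_thicken_sum_le R (siteVariation_nonneg A)) (by positivity)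
  refine (mul_le_mul_of_nonneg_right h1 (by positivity)).trans (le_of_eq ?_)
  rw [mul_pow]
  ring

/-- The Trotter error of a local observable. -/
theorem IsTrotterFormula.exists_trotter_error_le {p : ℕ} {r : Fin M → Fin K} {x : Fin M → ℝ}
    (hS : IsTrotterFormula p r x) (d a Z : ℕ) {J : ℝ} (hJ : 0 ≤ J) :
    ∃ C : ℝ, 0 ≤ C ∧ ∀ {Λ : Finset (Site d)} {m : ℕ} {h : Fin m → Op Λ}
      {S : Fin m → Finset Λ} {color : Fin m → Fin K}, LocalTerms h S a Z J →
      (∀ α β, color α = color β → Commute (h α) (h β)) →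
      ∀ {O : Op Λ} {X : Finset Λ}, IsLocalTo O X → ∀ {s : ℝ}, 0 ≤ s → ∀ T : ℕ,
      ‖star (productFormula r x (fun j => ∑ α with color α = j, h α) s ^ T) * O *
          productFormula r x (fun j => ∑ α with color α = j, h α) s ^ T -
        star (evolution (∑ α, h α) (T * s)) * O * evolution (∑ α, h α) (T * s)‖ ≤
        T * (C * s ^ p * (lightCone d a Z J (T * s) * (X.card ^ 2 * ‖O‖)) * s) := by
  obtain ⟨C, hC, hE⟩ := hS.exists_commutator_bound d a Z hJ
  refine ⟨C, hC, fun {Λ m h S color} hh hcomm {O X} hO {s} hs T => ?_⟩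
  have hE := hE hh hcomm
  set H : Fin K → Op Λ := fun j => ∑ α with color α = j, h α with hHdef
  have hH : ∀ j, star (H j) = H j := fun j => by
    rw [hHdef, _root_.star_sum]
    exact Finset.sum_congr rfl fun α _ => hh.isSelfAdjoint α
  have hsum : ∑ j, H j = ∑ α, h α := Finset.sum_fiberwise _ _ _
  have htot : star (∑ α, h α) = ∑ α, h α := hh.star_sum
  have hskew : ∀ B ∈ factorGenerators H (formulaFactors r x), star B = -B := fun B hB =>
    star_of_mem_factorGenerators hH hB
  rw [productFormula_eq_expProd]
  refine norm_conj_pow_sub_evolution_le (expProd_mem_unitary hskew s) O T fun k hk => ?_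
  refine norm_conj_sub_evolution_le htot (hasDerivAt_expProd _) (expProd_zero _)
    (expProd_mem_unitary hskew) (star_expProdGenerator hskew) _ hs fun u hu => ?_
  have h1 := hE (star (evolution (∑ α, h α) (s - u)) *
    (star (evolution (∑ α, h α) (k * s)) * O * evolution (∑ α, h α) (k * s)) *
      evolution (∑ α, h α) (s - u)) u hu.1
  rw [generatorError, hsum] at h1
  refine h1.trans ?_
  have hks : 0 ≤ k * s := by positivity
  have h2 : star (evolution (∑ α, h α) (s - u)) *
      (star (evolution (∑ α, h α) (k * s)) * O * evolution (∑ α, h α) (k * s)) *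
      evolution (∑ α, h α) (s - u) = star (evolution (∑ α, h α) (k * s + (s - u))) * O *
        evolution (∑ α, h α) (k * s + (s - u)) := by
    rw [evolution_add, star_mul]
    noncomm_ring
  have h0 : 0 ≤ k * s + (s - u) := add_nonneg hks (sub_nonneg.mpr hu.2)
  have h3 := sum_siteVariation_heisenberg_le hJ (fun _ => hh) (fun _ => continuous_const)
    (isPropagator_evolution htot) (evolution_zero _) hO h0
  rw [sub_zero] at h3
  rw [h2]
  -- Because `k < T`, the observable has been evolved for at most the total time.
  have hT : k * s + (s - u) ≤ T * s := by
    have : ((k : ℝ) + 1) ≤ T := by exact_mod_cast hk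
    nlinarith [hu.1]
  have h4 := lightCone_mono hJ h0 hT d a Z
  have h5 : u ^ p ≤ s ^ p := pow_le_pow_left₀ hu.1 hu.2 p
  have h6 : 0 ≤ ∑ y, siteVariation (star (evolution (∑ α, h α) (k * s + (s - u))) * O *
      evolution (∑ α, h α) (k * s + (s - u))) y :=
    Finset.sum_nonneg fun y _ => siteVariation_nonneg _ y
  refine mul_le_mul (mul_le_mul_of_nonneg_left h5 hC) (h3.trans ?_) h6 (by positivity)
  exact mul_le_mul_of_nonneg_right h4 (by positivity)

end Step

end

end TrotterNoise

namespace TrotterNoise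

noncomputable section

/-! ### Total error -/

/-- `lightCone` is at most this constant times `t ^ d` for `t ≥ t₀`. -/
def lightConeConst (d a Z : ℕ) (J t₀ : ℝ) : ℝ :=
  4 * Real.exp 1 * (2 * (lrVelocity a Z J + 2 / t₀)) ^ d

theorem lightConeConst_nonneg {J t₀ : ℝ} (hJ : 0 ≤ J) (ht₀ : 0 < t₀) (d a Z : ℕ) :
    0 ≤ lightConeConst d a Z J t₀ := by
  have := lrVelocity_nonneg hJ a Z
  unfold lightConeConst
  positivity

/-- The additive constant of the light-cone radius is absorbed through `2 ≤ (2 / t₀) t`; this is the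
only use of a lower bound on the time. -/
theorem lightCone_le {J t₀ t : ℝ} (hJ : 0 ≤ J) (ht₀ : 0 < t₀) (ht : t₀ ≤ t) (d a Z : ℕ) :
    lightCone d a Z J t ≤ lightConeConst d a Z J t₀ * t ^ d := by
  have hv := lrVelocity_nonneg hJ a Z
  have h1 : 2 ≤ 2 / t₀ * t := by
    rw [div_mul_eq_mul_div, le_div_iff₀ ht₀]
    linarith
  have ht0 := ht₀.le.trans ht
  rw [lightCone, lightConeConst, mul_assoc _ (_ ^ d), ← mul_pow]
  refine mul_le_mul_of_nonneg_left (pow_le_pow_left₀ (by positivity) ?_ d) (by positivity)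
  linarith

section Total

variable {d p K M : ℕ} {r : Fin M → Fin K} {x : Fin M → ℝ} {a₀ Z₀ a₁ Z₁ a₂ Z₂ : ℕ}
  {J₀ J₁ c : ℝ}

/-- The noiseless simulator is the intermediate point: `implements` turns its expectation value into
that of the Trotter circuit, and cyclicity moves all evolutions onto the observable. -/
theorem NoisySimulation.error_le_add
    (E : NoisySimulation d r x a₀ Z₀ J₀ a₁ Z₁ J₁ a₂ Z₂ c) {δ : ℝ}
    (hδ : ‖star (productFormula r x E.target.part (E.τ / E.T) ^ E.T) * E.O *
        productFormula r x E.target.part (E.τ / E.T) ^ E.T -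
      star (evolution E.target.total E.τ) * E.O * evolution E.target.total E.τ‖ ≤ δ) :
    E.error ≤ δ + E.γ * (Z₂ * (lightCone d a₁ Z₁ |J₁| E.tsim * (E.X.card ^ 2 * ‖E.O‖))) *
      E.tsim := by
  have hnoise := noise_error_le E.simulator E.noise E.γ_pos.le E.isState.norm_traceDual_le
    E.O_supported.isLocalTo E.tsim_nonneg
  set U := productFormula r x E.target.part (E.τ / E.T) ^ E.T
  have hskew : star ((-Complex.I) • E.target.total) = -((-Complex.I) • E.target.total) := by
    rw [star_smul, TargetHamiltonian.total, E.target.isLocal.localTerms.star_sum, ← neg_smul]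
    simp
  have hW : evolution E.target.total (-E.τ) = star (evolution E.target.total E.τ) := by
    rw [evolution_eq_exp, evolution_eq_exp, star_exp_smul hskew]
  have h1 : E.targetValue =
      (star (evolution E.target.total E.τ) * E.O * evolution E.target.total E.τ * E.ρ₀).trace := by
    rw [NoisySimulation.targetValue, hW, ← mul_assoc, Matrix.trace_mul_comm]
    simp only [mul_assoc]
  have h2 : (E.O * (timeOrderedExp (fun s => hamiltonianGenerator (E.simulator.total s)) E.tsim)
      E.ρ₀).trace = (star U * E.O * U * E.ρ₀).trace := by
    rw [E.implements, ← mul_assoc, Matrix.trace_mul_comm, ← Matrix.star_eq_conjTranspose]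
    simp only [mul_assoc]
    rfl
  have h3 : ‖(E.O * (timeOrderedExp (fun s => hamiltonianGenerator (E.simulator.total s)) E.tsim)
      E.ρ₀).trace - E.targetValue‖ ≤ δ := by
    rw [h1, h2, ← Matrix.trace_sub, ← sub_mul]
    exact (E.isState.norm_trace_mul_le _).trans hδ
  rw [NoisySimulation.error, norm_sub_rev, NoisySimulation.simulatedValue, add_comm δ]
  exact (norm_sub_le_norm_sub_add_norm_sub _ _ _).trans (add_le_add hnoise h3)

theorem exists_error_le (hS : IsTrotterFormula p r x) {τ₀ : ℝ} (hτ₀ : 0 < τ₀) :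
    ∃ A B : ℝ, 0 < A ∧ 0 < B ∧
      ∀ E : NoisySimulation d r x a₀ Z₀ J₀ a₁ Z₁ J₁ a₂ Z₂ c, τ₀ ≤ E.τ →
        E.error ≤ (A * (E.τ ^ (d + p + 1) / (E.T : ℝ) ^ p) + B * (E.γ * (E.T : ℝ) ^ (d + 1))) *
          ((E.X.card : ℝ) ^ 2 * ‖E.O‖) := by
  obtain ⟨C, hC, hE⟩ := hS.exists_trotter_error_le d a₀ Z₀ (abs_nonneg J₀)
  have hc0 := lightConeConst_nonneg (abs_nonneg J₀) hτ₀ d a₀ Z₀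
  have hc1 := lightConeConst_nonneg (abs_nonneg J₁) one_pos d a₁ Z₁
  -- The summands `+ 1` only ensure strict positivity. The time `t_sim` may be small, so it is
  -- enlarged to `(|c| + 1) T`, which is at least `1` and allows the threshold `t₀ = 1`.
  refine ⟨C * lightConeConst d a₀ Z₀ |J₀| τ₀ + 1,
    Z₂ * lightConeConst d a₁ Z₁ |J₁| 1 * (|c| + 1) ^ (d + 1) + 1, by positivity, by positivity,
    fun E hτ => ?_⟩
  have hT : (0 : ℝ) < E.T := Nat.cast_pos.mpr E.T_pos
  have hT1 : (1 : ℝ) ≤ E.T := Nat.one_le_cast.mpr E.T_pos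
  have hτT : 0 ≤ E.τ / E.T := div_nonneg E.τ_pos.le hT.le
  have hcancel : (E.T : ℝ) * (E.τ / E.T) = E.τ := mul_div_cancel₀ _ hT.ne'
  have hlocal : LocalTerms E.target.term E.target.region a₀ Z₀ |J₀| :=
    { E.target.isLocal.localTerms with
      norm_le := fun α => (E.target.isLocal.norm_le α).trans (le_abs_self J₀) }
  have h1 := hE hlocal E.target.commute E.O_supported.isLocalTo hτT E.T
  rw [hcancel] at h1
  refine (E.error_le_add h1).trans ?_
  set D : ℝ := (E.X.card : ℝ) ^ 2 * ‖E.O‖ with hD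
  have hD0 : 0 ≤ D := by positivity
  have hτ0 := E.τ_pos
  have hγ0 := E.γ_pos
  have h2 : E.T * (C * (E.τ / E.T) ^ p * (lightCone d a₀ Z₀ |J₀| E.τ * D) * (E.τ / E.T)) ≤
      (C * lightConeConst d a₀ Z₀ |J₀| τ₀ + 1) * (E.τ ^ (d + p + 1) / (E.T : ℝ) ^ p) * D := by
    calc _ ≤ E.T * (C * (E.τ / E.T) ^ p *
            (lightConeConst d a₀ Z₀ |J₀| τ₀ * E.τ ^ d * D) * (E.τ / E.T)) := by
          gcongr
          exact lightCone_le (abs_nonneg _) hτ₀ hτ d a₀ Z₀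
      _ = C * lightConeConst d a₀ Z₀ |J₀| τ₀ * (E.τ ^ (d + p + 1) / (E.T : ℝ) ^ p) * D := by
          rw [div_pow, pow_add, pow_add]
          field_simp
      _ ≤ _ := by
          gcongr
          linarith
  have h3 : E.tsim ≤ (|c| + 1) * E.T :=
    E.tsim_le.trans (mul_le_mul_of_nonneg_right (by linarith [le_abs_self c]) hT.le)
  have h4 : 1 ≤ (|c| + 1) * E.T := by nlinarith [abs_nonneg c]
  have h5 : lightCone d a₁ Z₁ |J₁| E.tsim ≤
      lightConeConst d a₁ Z₁ |J₁| 1 * ((|c| + 1) * E.T) ^ d :=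
    (lightCone_mono (abs_nonneg _) E.tsim_nonneg h3 d a₁ Z₁).trans
      (lightCone_le (abs_nonneg _) one_pos h4 d a₁ Z₁)
  have htsim := E.tsim_nonneg
  have h6 : E.γ * (Z₂ * (lightCone d a₁ Z₁ |J₁| E.tsim * D)) * E.tsim ≤
      (Z₂ * lightConeConst d a₁ Z₁ |J₁| 1 * (|c| + 1) ^ (d + 1) + 1) *
        (E.γ * (E.T : ℝ) ^ (d + 1)) * D := by
    calc _ ≤ E.γ * (Z₂ * (lightConeConst d a₁ Z₁ |J₁| 1 * ((|c| + 1) * E.T) ^ d * D)) *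
            ((|c| + 1) * E.T) := by gcongr
      _ = Z₂ * lightConeConst d a₁ Z₁ |J₁| 1 * (|c| + 1) ^ (d + 1) *
            (E.γ * (E.T : ℝ) ^ (d + 1)) * D := by
          rw [mul_pow]
          ring
      _ ≤ _ := by
          gcongr
          linarith
  rw [add_mul]
  exact add_le_add h2 h6

end Total

/-! ### Optimal number of steps -/

section Optimization

/-- Strict Bernoulli inequality for `u ^ p` with exponent `(q + p) / p`, multiplied by `p` and
divided by `u ^ p`. -/
theorem lt_of_ne_one {p q : ℕ} (hp : 1 ≤ p) (hq : 1 ≤ q) {u : ℝ} (hu : 0 < u) (hu1 : u ≠ 1) :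
    (q + p : ℝ) < q / u ^ p + p * u ^ q := by
  have hp0 : (0 : ℝ) < p := by exact_mod_cast hp
  have hq0 : (0 : ℝ) < q := by exact_mod_cast hq
  have hup : 0 < u ^ p := pow_pos hu p
  have hne : u ^ p - 1 ≠ 0 := by
    rw [sub_ne_zero]
    exact fun h => hu1 ((pow_eq_one_iff_of_nonneg hu.le (by omega)).mp h)
  have h1 : (1 : ℝ) < (q + p) / p := by rw [lt_div_iff₀ hp0]; linarith
  have h := one_add_mul_self_lt_rpow_one_add (by linarith : -1 ≤ u ^ p - 1) hne h1
  have h2 : (1 + (u ^ p - 1)) ^ ((q + p : ℝ) / p) = u ^ q * u ^ p := by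
    rw [add_sub_cancel, ← Real.rpow_natCast u p, ← Real.rpow_mul hu.le, mul_div_cancel₀ _ hp0.ne',
      Real.rpow_add hu, Real.rpow_natCast, Real.rpow_natCast]
  rw [h2] at h
  have h3 : p * (1 + (q + p) / p * (u ^ p - 1)) = p + (q + p) * (u ^ p - 1) := by
    field_simp
  have h4 := mul_lt_mul_of_pos_left h hp0
  rw [h3] at h4
  rw [← sub_pos, show (q : ℝ) / u ^ p + p * u ^ q - (q + p) =
    (p * (u ^ q * u ^ p) - (p + (q + p) * (u ^ p - 1))) / u ^ p by field_simp; ring]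
  exact div_pos (sub_pos.mpr h4) hup

/-- The stationary point is `κ ^ (q + p) = p A / (q B)`; rescaling by `κ` reduces the claim to the
normalized inequality at `u = y / κ`. -/
theorem exists_unique_minimum {p q : ℕ} (hp : 1 ≤ p) (hq : 1 ≤ q) {A B : ℝ} (hA : 0 < A)
    (hB : 0 < B) :
    ∃ κ : ℝ, 0 < κ ∧ ∀ y : ℝ, 0 < y → y ≠ κ → A / κ ^ p + B * κ ^ q < A / y ^ p + B * y ^ q := by
  have hp0 : (0 : ℝ) < p := by exact_mod_cast hp
  have hq0 : (0 : ℝ) < q := by exact_mod_cast hq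
  obtain ⟨κ, hκ, hκ'⟩ : ∃ κ : ℝ, 0 < κ ∧ κ ^ (q + p) = p * A / (q * B) :=
    ⟨(p * A / (q * B)) ^ ((q + p : ℕ) : ℝ)⁻¹, by positivity,
      Real.rpow_inv_natCast_pow (by positivity) (by omega)⟩
  refine ⟨κ, hκ, fun y hy hne => ?_⟩
  have h := lt_of_ne_one hp hq (div_pos hy hκ) (by rwa [ne_eq, div_eq_one_iff_eq hκ.ne'])
  have hAeq : A = q * B * (κ ^ q * κ ^ p) / p := by
    rw [← pow_add, hκ']
    field_simp
  have h5 := mul_lt_mul_of_pos_left h (show 0 < B * κ ^ q / p by positivity)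
  have h6 : B * κ ^ q / p * (q + p) = A / κ ^ p + B * κ ^ q := by
    rw [hAeq]
    field_simp
  have h7 : B * κ ^ q / p * (q / (y / κ) ^ p + p * (y / κ) ^ q) = A / y ^ p + B * y ^ q := by
    rw [hAeq, div_pow, div_pow]
    field_simp
  rwa [h6, h7] at h5

/-- With `g = γ^{-1/(p+d+1)}`, so `γ = g^{-(p+d+1)}`, both summands scale alike and the dependence
on `y` separates. -/
theorem bracket_eq {d p : ℕ} (A B : ℝ) {τ g y : ℝ} (hτ : 0 < τ) (hg : 0 < g) (hy : 0 < y) :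
    A * (τ ^ (d + p + 1) / (y * τ * g) ^ p) +
        B * ((g ^ (p + d + 1))⁻¹ * (y * τ * g) ^ (d + 1)) =
      τ ^ (d + 1) / g ^ p * (A / y ^ p + B * y ^ (d + 1)) := by
  simp only [mul_pow, pow_add, pow_one]
  field_simp

theorem rate_eq_inv_pow {γ : ℝ} (hγ : 0 < γ) (p d : ℕ) :
    γ = ((γ ^ (-(1 : ℝ) / (p + d + 1))) ^ (p + d + 1))⁻¹ := by
  have h : (p + d + 1 : ℝ) ≠ 0 := by positivity
  rw [← Real.rpow_natCast, ← Real.rpow_mul hγ.le]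
  push_cast
  rw [div_mul_cancel₀ _ h, Real.rpow_neg_one, inv_inv]

theorem rate_rpow_eq_inv_pow {γ : ℝ} (hγ : 0 < γ) (p d : ℕ) :
    γ ^ ((p : ℝ) / (p + d + 1)) = ((γ ^ (-(1 : ℝ) / (p + d + 1))) ^ p)⁻¹ := by
  rw [← Real.rpow_natCast, ← Real.rpow_mul hγ.le, ← Real.rpow_neg hγ.le]
  congr 1
  ring

end Optimization

end

end TrotterNoise

/-! ### The three claims assembled. -/

theorem proposition1 (d p K M : ℕ) (hp : 1 ≤ p)
    (r : Fin M → Fin K) (x : Fin M → ℝ) (hS : IsTrotterFormula p r x)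
    (a₀ Z₀ : ℕ) (J₀ : ℝ) (a₁ Z₁ : ℕ) (J₁ : ℝ) (a₂ Z₂ : ℕ) (c τ₀ : ℝ) (hτ₀ : 0 < τ₀) :
    ∃ A B : ℝ, 0 < A ∧ 0 < B ∧
      -- the error bound `O(τ^{d+p+1}/T^p) + O(γ T^{d+1})`
      (∀ E : NoisySimulation d r x a₀ Z₀ J₀ a₁ Z₁ J₁ a₂ Z₂ c, τ₀ ≤ E.τ →
        E.error ≤ (A * (E.τ ^ (d + p + 1) / (E.T : ℝ) ^ p) + B * (E.γ * (E.T : ℝ) ^ (d + 1))) *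
          ((E.X.card : ℝ) ^ 2 * ‖E.O‖)) ∧
      -- as a function of a real number `T > 0`, the bound has a unique minimum, which is
      -- at `T = κ τ γ^{-1/(p+d+1)}`
      (∃ κ : ℝ, 0 < κ ∧ ∀ τ γ : ℝ, 0 < τ → 0 < γ → ∀ T : ℝ, 0 < T →
        T ≠ κ * τ * γ ^ (-(1 : ℝ) / (p + d + 1)) →
          A * (τ ^ (d + p + 1) / (κ * τ * γ ^ (-(1 : ℝ) / (p + d + 1))) ^ p) +
              B * (γ * (κ * τ * γ ^ (-(1 : ℝ) / (p + d + 1))) ^ (d + 1)) <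
            A * (τ ^ (d + p + 1) / T ^ p) + B * (γ * T ^ (d + 1))) ∧
      -- the choice `T = τ Θ(γ^{-1/(p+d+1)})`
      (∀ c₁ c₂ : ℝ, 0 < c₁ → 0 < c₂ → ∃ C : ℝ, 0 < C ∧
        ∀ E : NoisySimulation d r x a₀ Z₀ J₀ a₁ Z₁ J₁ a₂ Z₂ c, τ₀ ≤ E.τ →
          c₁ * (E.τ * E.γ ^ (-(1 : ℝ) / (p + d + 1))) ≤ E.T →
          E.T ≤ c₂ * (E.τ * E.γ ^ (-(1 : ℝ) / (p + d + 1))) →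
            E.error ≤ C * (E.γ ^ ((p : ℝ) / (p + d + 1)) * E.τ ^ (d + 1)) *
                ((E.X.card : ℝ) ^ 2 * ‖E.O‖) ∧
              E.tsim ≤ C * (E.τ * E.γ ^ (-(1 : ℝ) / (p + d + 1)))) := by
  obtain ⟨A, B, hA, hB, hE⟩ := exists_error_le (d := d) (a₀ := a₀) (Z₀ := Z₀) (J₀ := J₀)
    (a₁ := a₁) (Z₁ := Z₁) (J₁ := J₁) (a₂ := a₂) (Z₂ := Z₂) (c := c) hS hτ₀
  refine ⟨A, B, hA, hB, hE, ?_, ?_⟩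
  · obtain ⟨κ, hκ, hmin⟩ := exists_unique_minimum hp (Nat.succ_pos d) hA hB
    refine ⟨κ, hκ, fun τ γ hτ hγ T hT hne => ?_⟩
    have hrate := rate_eq_inv_pow hγ p d
    have hg : 0 < γ ^ (-(1 : ℝ) / (p + d + 1)) := Real.rpow_pos_of_pos hγ _
    generalize γ ^ (-(1 : ℝ) / (p + d + 1)) = g at *
    -- In the rescaled variable `y` the minimizer no longer depends on `τ` or `γ`.
    obtain ⟨y, rfl⟩ : ∃ y, T = y * τ * g := ⟨T / (τ * g), by field_simp⟩
    have hy : 0 < y := by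
      rw [mul_assoc] at hT
      exact pos_of_mul_pos_left hT (mul_pos hτ hg).le
    rw [hrate, bracket_eq A B hτ hg hκ, bracket_eq A B hτ hg hy]
    exact mul_lt_mul_of_pos_left (hmin y hy fun h => hne (by rw [h])) (by positivity)
  · intro c₁ c₂ hc₁ hc₂
    -- The first two summands bound the rescaled bracket for `c₁ ≤ y ≤ c₂`; the last serves the
    -- simulation time.
    refine ⟨A / c₁ ^ p + B * c₂ ^ (d + 1) + |c| * c₂, by positivity, fun E hτ h₁ h₂ => ?_⟩
    have hτ0 := E.τ_pos
    have hγ0 := E.γ_pos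
    have hT : (0 : ℝ) < E.T := Nat.cast_pos.mpr E.T_pos
    have hbound := hE E hτ
    have hrate := rate_eq_inv_pow hγ0 p d
    rw [rate_rpow_eq_inv_pow hγ0 p d]
    have hg : 0 < E.γ ^ (-(1 : ℝ) / (p + d + 1)) := Real.rpow_pos_of_pos hγ0 _
    generalize E.γ ^ (-(1 : ℝ) / (p + d + 1)) = g at *
    constructor
    · refine hbound.trans (mul_le_mul_of_nonneg_right ?_ (by positivity))
      obtain ⟨y, hy⟩ : ∃ y, (E.T : ℝ) = y * E.τ * g := ⟨E.T / (E.τ * g), by field_simp⟩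
      have hτg : 0 < E.τ * g := mul_pos hτ0 hg
      rw [hy, mul_assoc] at h₁ h₂
      have hy₁ := le_of_mul_le_mul_right h₁ hτg
      have hy₂ := le_of_mul_le_mul_right h₂ hτg
      have hy0 : 0 < y := hc₁.trans_le hy₁
      rw [hy, hrate, bracket_eq A B hτ0 hg hy0]
      calc E.τ ^ (d + 1) / g ^ p * (A / y ^ p + B * y ^ (d + 1))
          ≤ E.τ ^ (d + 1) / g ^ p * (A / c₁ ^ p + B * c₂ ^ (d + 1) + |c| * c₂) := by
            have : 0 ≤ |c| * c₂ := by positivity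
            have h3 : A / y ^ p ≤ A / c₁ ^ p := by gcongr
            have h4 : B * y ^ (d + 1) ≤ B * c₂ ^ (d + 1) := by gcongr
            exact mul_le_mul_of_nonneg_left (by linarith) (by positivity)
        _ = _ := by rw [div_eq_mul_inv]; ring
    · calc E.tsim ≤ |c| * E.T :=
            E.tsim_le.trans (mul_le_mul_of_nonneg_right (le_abs_self c) hT.le)
        _ ≤ |c| * (c₂ * (E.τ * g)) := mul_le_mul_of_nonneg_left h₂ (abs_nonneg c)
        _ = |c| * c₂ * (E.τ * g) := by ring
        _ ≤ _ := by
            have : 0 < A / c₁ ^ p + B * c₂ ^ (d + 1) := by positivity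
            gcongr
            linarith
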